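/- Let $G$ be a compact Lie group (not necessarily connected), $K\subseteq G$ a closed subgroup and $M=G/K$, with normalized Haar measure $dx$ on $G$ and its image, the normalized $G$-invariant measure, on $M$. Fix an $\mathrm{Ad}(G)$-invariant inner product on the Lie algebra of $G$ and an orthonormal basis $Y_1,\dots,Y_n$ of it, and let $\mathcal L=\sum_i Y_i^2$ be the Laplacian (Casimir element) of $G$, the $Y_i$ acting as left-invariant vector fields. Let $\widehat G_0$ be the set of equivalence classes of continuous irreducible unitary representations $\xi:G\to U(d_\xi)$ that have a non-zero $K$-fixed vector. Choose in each class a matrix representative, in an orthonormal basis whose first $k_\xi$ vectors span the space of $K$-fixed vectors, and let $I_\xi$ be the diagonal matrix with $k_\xi$ ones followed by zeros. Let $\lambda_\xi\ge 0$ be determined by $-\mathcal L\,\xi(x)=\lambda_\xi\,\xi(x)$, and $\langle\xi\rangle=(1+\lambda_\xi)^{1/2}$. For $f\in C^\infty(M)$ put $\widehat f(\xi)=\int_G f(xK)\,\xi(x)^*\,dx$, and for a distribution $u\in\mathcal D'(M)$ put $\widehat u(\xi)=\langle u,I_\xi\,\xi(\cdot)^*\rangle$. For $r\in\mathbb R$,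 $1\le p\le\infty$ and $0<q\le\infty$, the Besov space $B^r_{p,q}(M)$ consists of all $u\in\mathcal D'(M)$ with $$\|u\|_{B^r_{p,q}}=\Big\|\Big(2^{mr}\Big\|\sum_{[\xi]\in\widehat G_0,\ 2^m\le\langle\xi\rangle<2^{m+1}}d_\xi\,\mathrm{Tr}[\xi(x)\widehat u(\xi)]\Big\|_{L^p(M)}\Big)_{m\in\mathbb N}\Big\|_{\ell^q(\mathbb N)}<\infty .$$ Let $\sigma$ assign to each $[\xi]\in\widehat G_0$ a matrix $\sigma(\xi)\in\mathbb C^{d_\xi\times d_\xi}$ with $\sigma(\xi)_{ij}=0$ whenever $i>k_\xi$ or $j>k_\xi$, and let $A=\mathrm{Op}(\sigma)$ be the Fourier multiplier $$Af(x)=\sum_{[\xi]\in\widehat G_0}d_\xi\,\mathrm{Tr}[\xi(x)\sigma(\xi)\widehat f(\xi)],\qquad f\in C^\infty(M).$$ Let $1\le p_1,p_2\le\infty$ and suppose that $A$ is bounded from $L^{p_1}(M)$ into $L^{p_2}(M)$, i.e. $\|Af\|_{L^{p_2}(M)}\le C_0\|f\|_{L^{p_1}(M)}$ for all $f\in C^\infty(M)$,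 with a constant $C_0$. Then $A$ extends from $C^\infty(M)$ to a linear operator $T$ on $\mathcal D'(M)$ with $\widehat{Tu}(\xi)=\sigma(\xi)\widehat u(\xi)$ for all $u\in\mathcal D'(M)$ and $[\xi]\in\widehat G_0$, and for all $r\in\mathbb R$ and $0<q\le\infty$ this $T$ maps $B^r_{p_1,q}(M)$ boundedly into $B^r_{p_2,q}(M)$: there is a constant $C$ with $\|Tu\|_{B^r_{p_2,q}}\le C\|u\|_{B^r_{p_1,q}}$ for all $u\in B^r_{p_1,q}(M)$. -/

import Mathlib

open MeasureTheory
open scoped Manifold ContDiff Matrix ENNReal NNReal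

noncomputable section

namespace HomBesov

section Reps

variable {G : Type*} [Group G]

/-- The representation of `G` on `ℂ^d` given by a homomorphism into the unitary group `U(d)`. -/
def toRep {d : ℕ} (ξ : G →* Matrix.unitaryGroup (Fin d) ℂ) : Representation ℂ G (Fin d → ℂ) where
  toFun g := Matrix.toLin' (ξ g : Matrix (Fin d) (Fin d) ℂ)
  map_one' := by simp; rfl
  map_mul' g h := by simp [Matrix.toLin'_mul]; rfl

/-- A continuous irreducible unitary representation `ξ : G → U(d)`, in matrix form, of type I with
respect to `K` (it has a non-zero `K`-fixed vector), written in an orthonormal basis of the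
representation space whose first `k` vectors span the space of `K`-fixed vectors. -/
structure TypeOneRep (G : Type*) [Group G] [TopologicalSpace G] (K : Subgroup G) where
  /-- the dimension `d_ξ` -/
  d : ℕ
  /-- the representation -/
  hom : G →* Matrix.unitaryGroup (Fin d) ℂ
  continuous_hom : Continuous fun g => (hom g : Matrix (Fin d) (Fin d) ℂ)
  irreducible : (toRep hom).IsIrreducible
  /-- the dimension `k_ξ` of the space of `K`-fixed vectors -/
  k : ℕ
  k_pos : 0 < k
  k_le : k ≤ d
  fixed_iff : ∀ v : Fin d → ℂ,
    (∀ h ∈ K, (hom h : Matrix (Fin d) (Fin d) ℂ) *ᵥ v = v) ↔ ∀ i : Fin d, k ≤ (i : ℕ) → v i = 0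

variable [TopologicalSpace G] {K : Subgroup G}

namespace TypeOneRep

/-- The matrix `ξ(g)`. -/
def mat (ξ : TypeOneRep G K) (g : G) : Matrix (Fin ξ.d) (Fin ξ.d) ℂ := (ξ.hom g).1

/-- Unitary equivalence of representations. -/
def Equivalent (ξ η : TypeOneRep G K) : Prop :=
  ∃ U : Matrix (Fin η.d) (Fin ξ.d) ℂ, U * Uᴴ = 1 ∧ Uᴴ * U = 1 ∧ ∀ g, U * ξ.mat g = η.mat g * U

instance setoid (G : Type*) [Group G] [TopologicalSpace G] (K : Subgroup G) :
    Setoid (TypeOneRep G K) where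
  r := Equivalent
  iseqv :=
    { refl := fun ξ => ⟨1, by simp, by simp, by simp⟩
      symm := by
        rintro ξ η ⟨U, h1, h2, h3⟩
        refine ⟨Uᴴ, by simpa using h2, by simpa using h1, fun g => ?_⟩
        calc Uᴴ * η.mat g = Uᴴ * (η.mat g * U) * Uᴴ := by
              rw [Matrix.mul_assoc, Matrix.mul_assoc, h1, Matrix.mul_one]
          _ = (Uᴴ * U) * ξ.mat g * Uᴴ := by rw [← h3 g]; simp only [Matrix.mul_assoc]
          _ = ξ.mat g * Uᴴ := by rw [h2, Matrix.one_mul]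
      trans := by
        rintro ξ η ζ ⟨U, h1, h2, h3⟩ ⟨V, k1, k2, k3⟩
        refine ⟨V * U, ?_, ?_, fun g => ?_⟩
        · rw [Matrix.conjTranspose_mul, Matrix.mul_assoc, ← Matrix.mul_assoc U, h1, Matrix.one_mul,
            k1]
        · rw [Matrix.conjTranspose_mul, Matrix.mul_assoc, ← Matrix.mul_assoc Vᴴ, k2,
            Matrix.one_mul, h2]
        · rw [Matrix.mul_assoc, h3, ← Matrix.mul_assoc, k3, Matrix.mul_assoc] }

/-- The matrix `I_ξ`: the diagonal matrix with ones in the first `k_ξ` places, i.e. the orthogonal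
projection onto the `K`-fixed vectors. -/
def proj (ξ : TypeOneRep G K) : Matrix (Fin ξ.d) (Fin ξ.d) ℂ :=
  Matrix.diagonal fun i => if (i : ℕ) < ξ.k then 1 else 0

theorem mat_mul_proj (ξ : TypeOneRep G K) {h : G} (hh : h ∈ K) : ξ.mat h * ξ.proj = ξ.proj := by
  ext i j
  rw [proj, Matrix.mul_diagonal]
  by_cases hj : (j : ℕ) < ξ.k
  · have h1 := (ξ.fixed_iff (Pi.single j 1)).2 (fun i hi => by
      rw [Pi.single_eq_of_ne]; rintro rfl; omega) h hh
    have h2 := congrFun h1 i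
    rw [Matrix.mulVec_single_one] at h2
    simp only [Matrix.col_apply] at h2
    rw [if_pos hj, mul_one, mat, h2]
    by_cases hij : i = j
    · subst hij; simp [hj]
    · simp [hij]
  · by_cases hij : i = j
    · subst hij; simp [hj]
    · simp [hij, hj]

/-- The function `xK ↦ ξ(x) I_ξ` on `M = G/K`. -/
def onM (ξ : TypeOneRep G K) : G ⧸ K → Matrix (Fin ξ.d) (Fin ξ.d) ℂ :=
  Quotient.lift (fun x => ξ.mat x * ξ.proj) (by
    intro x y hxy
    have hK : x⁻¹ * y ∈ K := QuotientGroup.leftRel_apply.1 hxy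
    have hy : ξ.mat y = ξ.mat x * ξ.mat (x⁻¹ * y) := by
      have : ξ.hom y = ξ.hom x * ξ.hom (x⁻¹ * y) := by rw [← map_mul]; simp
      simp only [mat]
      rw [this]; rfl
    show ξ.mat x * ξ.proj = ξ.mat y * ξ.proj
    rw [hy, Matrix.mul_assoc, ξ.mat_mul_proj hK])

end TypeOneRep

/-- The set `Ĝ₀` of equivalence classes of irreducible unitary representations of `G` of type I with
respect to `K`. -/
def Dual (G : Type*) [Group G] [TopologicalSpace G] (K : Subgroup G) : Type _ :=
  Quotient (TypeOneRep.setoid G K)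

/-- A fixed representative of a class in `Ĝ₀`. -/
def Dual.rep (ξ : Dual G K) : TypeOneRep G K := Quotient.out ξ

/-- A family of matrices `a(ξ) ∈ ℂ^{d_ξ × d_ξ}`, one for each `[ξ] ∈ Ĝ₀`. -/
abbrev MatFamily (G : Type*) [Group G] [TopologicalSpace G] (K : Subgroup G) : Type _ :=
  (ξ : Dual G K) → Matrix (Fin ξ.rep.d) (Fin ξ.rep.d) ℂ

/-- The symbol of a Fourier multiplier on `G/K`: `σ(ξ)_{ij} = 0` unless `i, j` both are among the
first `k_ξ` indices. -/
def IsMultiplierSymbol (σ : MatFamily G K) : Prop :=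
  ∀ (ξ : Dual G K) (i j : Fin ξ.rep.d), ξ.rep.k ≤ (i : ℕ) ∨ ξ.rep.k ≤ (j : ℕ) → σ ξ i j = 0

/-- The Fourier series `∑_{[ξ] ∈ Ĝ₀} d_ξ Tr[ξ(x) I_ξ a(ξ)]`, as a function of `xK ∈ G/K`. The
projection `I_ξ` may be left out when the rows of `a(ξ)` of index beyond `k_ξ` vanish, which holds
for Fourier coefficients of functions and distributions on `G/K` and for multiplier symbols. -/
def fourierSeries (a : MatFamily G K) (x : G ⧸ K) : ℂ :=
  ∑' ξ : Dual G K, (ξ.rep.d : ℂ) * (ξ.rep.onM x * a ξ).trace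

end Reps

section Measures

variable (G : Type*) [Group G] [TopologicalSpace G] [IsTopologicalGroup G] [CompactSpace G]
  [MeasurableSpace G] [BorelSpace G]

/-- The normalized Haar measure of the compact group `G`. -/
def haarG : Measure G := Measure.haarMeasure ⊤

/-- The normalized `G`-invariant measure of `M = G/K`. -/
def haarM (K : Subgroup G) : Measure (G ⧸ K) := (haarG G).map QuotientGroup.mk

instance : IsProbabilityMeasure (haarG G) :=
  ⟨by simpa [haarG] using Measure.haarMeasure_self (K₀ := (⊤ : TopologicalSpace.PositiveCompacts G))⟩

instance (K : Subgroup G) : IsProbabilityMeasure (haarM G K) :=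
  Measure.isProbabilityMeasure_map QuotientGroup.measurable_coe.aemeasurable

variable {G} {K : Subgroup G}

/-- The Fourier coefficients `f̂(ξ) = ∫_G f(xK) ξ(x)^* dx` of a function on `G/K`. -/
def fourier (f : G ⧸ K → ℂ) : MatFamily G K :=
  fun ξ => Matrix.of fun i j => ∫ x, f (x : G ⧸ K) * (ξ.rep.mat x)ᴴ i j ∂(haarG G)

/-- The operator `Op(σ)f(x) = ∑_{[ξ] ∈ Ĝ₀} d_ξ Tr[ξ(x) σ(ξ) f̂(ξ)]`. -/
def Op (σ : MatFamily G K) (f : G ⧸ K → ℂ) : G ⧸ K → ℂ :=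
  fourierSeries fun ξ => σ ξ * fourier f ξ

end Measures

section Smooth

variable {E : Type*} [NormedAddCommGroup E] [NormedSpace ℝ E]
  {G : Type*} [Group G] [TopologicalSpace G] [ChartedSpace E G]

/-- The adjoint representation of `G` on its Lie algebra. -/
def Ad (g : G) (X : GroupLieAlgebra 𝓘(ℝ, E) G) : GroupLieAlgebra 𝓘(ℝ, E) G :=
  mfderiv 𝓘(ℝ, E) 𝓘(ℝ, E) (fun x : G => g * x * g⁻¹) 1 X

/-- The derivative of a function along the left-invariant vector field of `X`. -/
def lieDeriv (X : GroupLieAlgebra 𝓘(ℝ, E) G) (f : G → ℂ) (g : G) : ℂ :=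
  mfderiv 𝓘(ℝ, E) 𝓘(ℝ, ℂ) f g (mulInvariantVectorField X g)

variable {n : ℕ} (Y : Module.Basis (Fin n) ℝ (GroupLieAlgebra 𝓘(ℝ, E) G))

/-- Iterated derivative along left-invariant vector fields. -/
def iterLieDeriv (w : List (Fin n)) (f : G → ℂ) : G → ℂ :=
  w.foldr (fun i u => lieDeriv (Y i) u) f

/-- The operator `∑ Y_i²`. It is the Laplacian (Casimir element) of `G` when the `Y_i` are
orthonormal for an `Ad`-invariant inner product. -/
def laplacian (f : G → ℂ) (g : G) : ℂ := ∑ i, lieDeriv (Y i) (lieDeriv (Y i) f) g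

variable {K : Subgroup G}

/-- The eigenvalue `λ_ξ` determined by `-L ξ(x) = λ_ξ ξ(x)`. -/
def eigenvalue (ξ : TypeOneRep G K) : ℝ :=
  Classical.epsilon fun l : ℝ =>
    ∀ (i j : Fin ξ.d) (x : G), -laplacian Y (fun y => ξ.mat y i j) x = (l : ℂ) * ξ.mat x i j

/-- The weight `⟨ξ⟩ = (1 + λ_ξ)^{1/2}`. -/
def weight (ξ : Dual G K) : ℝ := Real.sqrt (1 + eigenvalue Y ξ.rep)

variable (E K) in
/-- The space `C^∞(G/K)`. A function on `G/K` is smooth iff its lift to `G` is. -/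
def smoothFun : Submodule ℂ (G ⧸ K → ℂ) where
  carrier := {f | ContMDiff 𝓘(ℝ, E) 𝓘(ℝ, ℂ) ∞ fun x : G => f (x : G ⧸ K)}
  add_mem' hf hg := ContMDiff.add hf hg
  zero_mem' := contMDiff_const
  smul_mem' c f hf :=
    (show ContDiff ℝ ∞ (fun z : ℂ => c * z) by fun_prop).contMDiff.comp
      (show ContMDiff 𝓘(ℝ, E) 𝓘(ℝ, ℂ) ∞ fun x : G => f (x : G ⧸ K) from hf)

variable (K) in
/-- The space `D'(G/K)`: the linear functionals on `C^∞(G/K)` that are continuous for the seminorms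
`sup |Y_{i_1} ⋯ Y_{i_l} φ|`, which define the topology of `C^∞(G/K)`. -/
def Distribution : Submodule ℂ (smoothFun E K →ₗ[ℂ] ℂ) where
  carrier := {u | ∃ (N : ℕ) (C : ℝ), ∀ (φ : smoothFun E K) (A : ℝ),
    (∀ w : List (Fin n), w.length ≤ N →
      ∀ x : G, ‖iterLieDeriv Y w (fun y : G => φ.1 (y : G ⧸ K)) x‖ ≤ A) → ‖u φ‖ ≤ C * A}
  zero_mem' := ⟨0, 0, by simp⟩
  add_mem' := by
    rintro u v ⟨N, C, hu⟩ ⟨N', C', hv⟩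
    refine ⟨max N N', C + C', fun φ A h => ?_⟩
    calc ‖(u + v) φ‖ ≤ ‖u φ‖ + ‖v φ‖ := norm_add_le _ _
      _ ≤ C * A + C' * A := add_le_add
          (hu φ A fun w hw => h w (hw.trans (le_max_left _ _)))
          (hv φ A fun w hw => h w (hw.trans (le_max_right _ _)))
      _ = (C + C') * A := by ring
  smul_mem' := by
    rintro c u ⟨N, C, hu⟩
    refine ⟨N, ‖c‖ * C, fun φ A h => ?_⟩
    rw [LinearMap.smul_apply, norm_smul, mul_assoc]
    exact mul_le_mul_of_nonneg_left (hu φ A h) (norm_nonneg c)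

variable {Y}

open Classical in
/-- The pairing of a distribution with a smooth function (and `0` if the function is not smooth). -/
def distPair (u : Distribution Y K) (φ : G ⧸ K → ℂ) : ℂ :=
  if h : φ ∈ smoothFun E K then u.1 ⟨φ, h⟩ else 0

/-- The Fourier coefficients `û(ξ) = ⟨u, I_ξ ξ(·)^*⟩` of a distribution on `G/K`. -/
def distFourier (u : Distribution Y K) : MatFamily G K :=
  fun ξ => Matrix.of fun i j => distPair u fun x => (ξ.rep.onM x)ᴴ i j

open Classical in
/-- The dyadic block `∑_{2^m ≤ ⟨ξ⟩ < 2^{m+1}} d_ξ Tr[ξ(x) û(ξ)]`. -/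
def distBlock (u : Distribution Y K) (m : ℕ) : G ⧸ K → ℂ :=
  fourierSeries fun ξ =>
    if (2 : ℝ) ^ m ≤ weight Y ξ ∧ weight Y ξ < (2 : ℝ) ^ (m + 1) then distFourier u ξ else 0

variable [IsTopologicalGroup G] [CompactSpace G] [MeasurableSpace G] [BorelSpace G]

/-- The distribution `φ ↦ ∫_M f φ` defined by a smooth function `f`. -/
def distOfSmooth (Y : Module.Basis (Fin n) ℝ (GroupLieAlgebra 𝓘(ℝ, E) G))
    (f : smoothFun E K) : Distribution Y K :=
  have hc : ∀ φ : smoothFun E K, Continuous fun x : G => φ.1 (x : G ⧸ K) :=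
    fun φ => ContMDiff.continuous φ.2
  have hm : ∀ φ : smoothFun E K, Measurable φ.1 := fun φ =>
    QuotientGroup.measurable_from_quotient.2 (hc φ).measurable
  have hb : ∀ φ : smoothFun E K, ∃ C, ∀ x, ‖φ.1 x‖ ≤ C := fun φ => by
    obtain ⟨C, hC⟩ := isCompact_univ.exists_bound_of_continuousOn (hc φ).continuousOn
    exact ⟨C, fun x => QuotientGroup.induction_on x fun y => hC y (Set.mem_univ y)⟩
  have hi : ∀ φ : smoothFun E K, Integrable (fun x => f.1 x * φ.1 x) (haarM G K) := fun φ => by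
    obtain ⟨C, hC⟩ := hb f
    obtain ⟨D, hD⟩ := hb φ
    refine Integrable.of_bound ((hm f).mul (hm φ)).aestronglyMeasurable (C * D)
      (Filter.Eventually.of_forall fun x => ?_)
    rw [norm_mul]
    exact mul_le_mul (hC x) (hD x) (norm_nonneg _) ((norm_nonneg _).trans (hC x))
  ⟨{ toFun := fun φ => ∫ x, f.1 x * φ.1 x ∂(haarM G K)
     map_add' := fun φ ψ => by
      rw [← integral_add (hi φ) (hi ψ)]
      exact integral_congr_ae (Filter.Eventually.of_forall fun x => mul_add _ _ _)
     map_smul' := fun c φ => by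
      rw [RingHom.id_apply, smul_eq_mul, ← integral_const_mul]
      exact integral_congr_ae (Filter.Eventually.of_forall fun x => mul_left_comm _ _ _) }, by
    obtain ⟨C, hC⟩ := hb f
    refine ⟨0, C, fun φ A h => ?_⟩
    have hA : ∀ x, ‖φ.1 x‖ ≤ A := fun x =>
      QuotientGroup.induction_on x fun y => h [] (le_refl 0) y
    have := norm_integral_le_of_norm_le_const (μ := haarM G K) (f := fun x => f.1 x * φ.1 x)
      (C := C * A) (Filter.Eventually.of_forall fun x => by
        rw [norm_mul]
        exact mul_le_mul (hC x) (hA x) (norm_nonneg _) ((norm_nonneg _).trans (hC x)))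
    simpa using this⟩

/-- The Besov (quasi-)norm
`‖u‖_{B^r_{p,q}} = ‖ (2^{mr} ‖∑_{2^m ≤ ⟨ξ⟩ < 2^{m+1}} d_ξ Tr[ξ(x) û(ξ)]‖_{L^p(M)})_m ‖_{ℓ^q}`. -/
def besovNorm (r : ℝ) (p q : ℝ≥0∞) (u : Distribution Y K) : ℝ≥0∞ :=
  if q = ⊤ then ⨆ m : ℕ, (2 : ℝ≥0∞) ^ ((m : ℝ) * r) * eLpNorm (distBlock u m) p (haarM G K)
  else (∑' m : ℕ, ((2 : ℝ≥0∞) ^ ((m : ℝ) * r) * eLpNorm (distBlock u m) p (haarM G K)) ^ q.toReal)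
    ^ (1 / q.toReal)

variable (Y K) in
/-- The Besov space `B^r_{p,q}(G/K)`. -/
def besovSpace (r : ℝ) (p q : ℝ≥0∞) : Set (Distribution Y K) := {u | besovNorm r p q u < ⊤}

variable (E) in
/-- `Op(σ)` is bounded from `L^{p₁}(G/K)` into `L^{p₂}(G/K)`:
`‖Op(σ)f‖_{L^{p₂}} ≤ C ‖f‖_{L^{p₁}}` for all `f ∈ C^∞(G/K)`. -/
def IsLpBounded (p₁ p₂ : ℝ≥0∞) (σ : MatFamily G K) : Prop :=
  ∃ C : ℝ≥0, ∀ f ∈ smoothFun E K,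
    eLpNorm (Op σ f) p₂ (haarM G K) ≤ C * eLpNorm f p₁ (haarM G K)

end Smooth

end HomBesov

end

/-!
By the orthogonality relations, `Op(σ)` multiplies the Fourier coefficients of a trigonometric
polynomial by `σ`. Tested on the matrix coefficients of `ξ`, the bound from `L^{p₁}` into `L^{p₂}`
therefore controls the entries of `σ(ξ)` by a multiple of `d_ξ`.

That is polynomial in `λ_ξ`, because representations with `λ_ξ ≤ l` vary slowly: the Casimir
eigenvalue bounds the differential of `ξ`, so the reproducing kernel of these representations stays
above half its value `∑ d_ξ²` at the identity on a neighbourhood of measure at least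
`c (1 + l)^{-n}`, and the orthogonality relations turn this into `∑ d_ξ² ≤ C (1 + l)^n`. By
integration by parts along `Y_1, …, Y_n`, smooth functions have rapidly decreasing coefficients
and distributions have coefficients of polynomial growth; the counting bound makes every Fourier
series with coefficients of polynomial growth converge to a distribution. Hence `σ` acts on
distributions.

Finally a dyadic block of `u` is a trigonometric polynomial, which `Op(σ)` maps to the corresponding
block of `Tu`. The `L^{p₁}`-`L^{p₂}` bound applies to every block and sums up to the Besov bound.
-/

noncomputable section

namespace HomBesov

/-! ### Schur's lemma and the orthogonality relations -/

open scoped ComplexOrder in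
theorem exists_unitary_smul {m n : Type*} [Fintype m] [Fintype n] [DecidableEq m] [DecidableEq n]
    {A : Matrix m n ℂ} (hA : A ≠ 0) {c c' : ℂ} (hc : Aᴴ * A = c • (1 : Matrix n n ℂ))
    (hc' : A * Aᴴ = c' • (1 : Matrix m m ℂ)) :
    ∃ r : ℂ, (r • A) * (r • A)ᴴ = 1 ∧ (r • A)ᴴ * (r • A) = 1 := by
  have hcc' : c' = c := smul_left_injective ℂ hA <| by
    simpa [hc, hc'] using Matrix.mul_assoc A Aᴴ A
  have hc0 : c ≠ 0 := fun h => hA <| Matrix.conjTranspose_mul_self_eq_zero.1 <| by simp [hc, h]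
  obtain ⟨j⟩ : Nonempty n := by
    by_contra h
    rw [not_nonempty_iff] at h
    exact hA (Subsingleton.elim _ _)
  have hcnn : 0 ≤ c := by
    simpa [hc] using (Matrix.posSemidef_conjTranspose_mul_self A).diag_nonneg (i := j)
  obtain ⟨t, ht, rfl⟩ : ∃ t : ℝ, 0 ≤ t ∧ (t : ℂ) = c := by
    rw [Complex.le_def] at hcnn
    exact ⟨c.re, hcnn.1, Complex.ext rfl hcnn.2⟩
  have hr : ((√t : ℝ) : ℂ)⁻¹ * (((√t : ℝ) : ℂ)⁻¹ * t) = 1 := by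
    rw [← mul_assoc, ← mul_inv, ← Complex.ofReal_mul, Real.mul_self_sqrt ht, inv_mul_cancel₀ hc0]
  refine ⟨((√t : ℝ) : ℂ)⁻¹, ?_, ?_⟩ <;>
    simp only [Matrix.conjTranspose_smul, Matrix.smul_mul, Matrix.mul_smul, hc, hc', hcc',
      smul_smul, star_inv₀, RCLike.star_def, Complex.conj_ofReal, hr, one_smul]

section Representations

variable {G : Type*} [Group G] [TopologicalSpace G] {K : Subgroup G}

namespace TypeOneRep

variable (ξ η : TypeOneRep G K)

theorem mat_mul (g h : G) : ξ.mat (g * h) = ξ.mat g * ξ.mat h :=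
  congrArg Subtype.val (map_mul ξ.hom g h)

theorem mat_one : ξ.mat 1 = 1 :=
  congrArg Subtype.val (map_one ξ.hom)

theorem conjTranspose_mul_mat (g : G) : (ξ.mat g)ᴴ * ξ.mat g = 1 :=
  Matrix.mem_unitaryGroup_iff'.1 (ξ.hom g).2

theorem mat_mul_conjTranspose (g : G) : ξ.mat g * (ξ.mat g)ᴴ = 1 :=
  Matrix.mem_unitaryGroup_iff.1 (ξ.hom g).2

theorem mat_inv (g : G) : ξ.mat g⁻¹ = (ξ.mat g)ᴴ :=
  congrArg Subtype.val (map_inv ξ.hom g)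

theorem norm_mat_apply_le (g : G) (i j : Fin ξ.d) : ‖ξ.mat g i j‖ ≤ 1 :=
  entry_norm_bound_of_unitary (ξ.hom g).2 i j

theorem continuous_mat_apply (i j : Fin ξ.d) : Continuous fun g => ξ.mat g i j :=
  ξ.continuous_hom.matrix_elem i j

theorem continuous_mat_mul_star (a j : Fin ξ.d) (b l : Fin η.d) :
    Continuous fun x => ξ.mat x a j * star (η.mat x b l) :=
  (ξ.continuous_mat_apply a j).mul (η.continuous_mat_apply b l).star

theorem continuous_trace_mat : Continuous fun x => (ξ.mat x).trace :=
  ξ.continuous_hom.matrix_trace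

theorem d_pos : 0 < ξ.d := ξ.k_pos.trans_le ξ.k_le

instance : Nonempty (Fin ξ.d) := ⟨⟨0, ξ.d_pos⟩⟩

theorem exists_eq_smul_one_of_commute {A : Matrix (Fin ξ.d) (Fin ξ.d) ℂ}
    (hA : ∀ g, A * ξ.mat g = ξ.mat g * A) : ∃ c : ℂ, A = c • (1 : Matrix _ _ ℂ) := by
  have := ξ.irreducible
  let f : (toRep ξ.hom).IntertwiningMap (toRep ξ.hom) :=
    (Matrix.toLin' A).intertwiningMap_of_isIntertwiningMap _ _ fun g v => by
      simpa [Matrix.toLin'_mul, toRep, mat] using congrArg (fun B => Matrix.toLin' B v) (hA g)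
  obtain ⟨c, hc⟩ :=
    (Representation.IsIrreducible.algebraMap_intertwiningMap_bijective_of_isAlgClosed
      (ρ := toRep ξ.hom)).2 f
  refine ⟨c, Matrix.toLin'.injective (LinearMap.ext fun v => ?_)⟩
  calc Matrix.toLin' A v = (algebraMap ℂ _ c : (toRep ξ.hom).IntertwiningMap _) v := by rw [hc]; rfl
    _ = Matrix.toLin' (c • 1) v := by rw [map_smul, Matrix.toLin'_one]; rfl

theorem eq_zero_of_intertwining {A : Matrix (Fin η.d) (Fin ξ.d) ℂ}
    (hA : ∀ g, A * ξ.mat g = η.mat g * A) (hne : ¬ Equivalent ξ η) : A = 0 := by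
  have hA' : ∀ g, Aᴴ * η.mat g = ξ.mat g * Aᴴ := fun g => by
    simpa [Matrix.conjTranspose_mul, mat_inv] using (congrArg Matrix.conjTranspose (hA g⁻¹)).symm
  obtain ⟨c, hc⟩ := ξ.exists_eq_smul_one_of_commute (A := Aᴴ * A) fun g => by
    rw [Matrix.mul_assoc, hA, ← Matrix.mul_assoc, hA', Matrix.mul_assoc]
  obtain ⟨c', hc'⟩ := η.exists_eq_smul_one_of_commute (A := A * Aᴴ) fun g => by
    rw [Matrix.mul_assoc, hA', ← Matrix.mul_assoc, hA, Matrix.mul_assoc]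
  by_contra hA0
  obtain ⟨r, h, h'⟩ := exists_unitary_smul hA0 hc hc'
  exact hne ⟨r • A, h, h', fun g => by rw [Matrix.smul_mul, Matrix.mul_smul, hA]⟩

end TypeOneRep

theorem Dual.not_equivalent_rep {ξ η : Dual G K} (h : ξ ≠ η) :
    ¬ TypeOneRep.Equivalent ξ.rep η.rep :=
  fun he => h (Quotient.out_equiv_out.1 he)

end Representations

section Orthogonality

variable {G : Type*} [Group G] [TopologicalSpace G] [IsTopologicalGroup G] [CompactSpace G]
  [MeasurableSpace G] [BorelSpace G] {K : Subgroup G}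

instance : (haarG G).IsHaarMeasure := by unfold haarG; infer_instance

instance : (haarG G).IsMulRightInvariant where
  map_mul_right_eq_self g := by
    have : IsProbabilityMeasure ((haarG G).map (· * g)) :=
      Measure.isProbabilityMeasure_map (measurable_mul_const g).aemeasurable
    exact Measure.isHaarMeasure_eq_of_isProbabilityMeasure _ _

theorem integrable_of_continuous {F : Type*} [NormedAddCommGroup F] {f : G → F}
    (hf : Continuous f) : Integrable f (haarG G) :=
  hf.integrable_of_hasCompactSupport (HasCompactSupport.of_compactSpace f)

namespace TypeOneRep

variable (ξ η : TypeOneRep G K)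

/-- The average `∫ ξ(x) E_{jl} η(x)^* dx` of the matrix unit `E_{jl}`, which intertwines `η` and
`ξ`. -/
def intertwiningAverage (j : Fin ξ.d) (l : Fin η.d) : Matrix (Fin ξ.d) (Fin η.d) ℂ :=
  Matrix.of fun a b => ∫ x, ξ.mat x a j * star (η.mat x b l) ∂(haarG G)

theorem intertwiningAverage_mul_mat (j : Fin ξ.d) (l : Fin η.d) (g : G) :
    ξ.intertwiningAverage η j l * η.mat g = ξ.mat g * ξ.intertwiningAverage η j l := by
  ext a b
  simp only [intertwiningAverage, Matrix.mul_apply, Matrix.of_apply]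
  have hleft : ∑ c, ξ.mat g a c * ∫ x, ξ.mat x c j * star (η.mat x b l) ∂(haarG G) =
      ∫ x, ξ.mat (g * x) a j * star (η.mat x b l) ∂(haarG G) := by
    simp_rw [← integral_const_mul]
    rw [← integral_finsetSum _ fun c _ =>
      (integrable_of_continuous (ξ.continuous_mat_mul_star η c j b l)).const_mul _]
    congr 1 with x
    simp only [mat_mul, Matrix.mul_apply, Finset.sum_mul, mul_assoc]
  have hright : ∑ c, (∫ x, ξ.mat x a j * star (η.mat x c l) ∂(haarG G)) * η.mat g c b =
      ∫ x, ξ.mat x a j * star (η.mat (g⁻¹ * x) b l) ∂(haarG G) := by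
    simp_rw [← integral_mul_const]
    rw [← integral_finsetSum _ fun c _ =>
      (integrable_of_continuous (ξ.continuous_mat_mul_star η a j c l)).mul_const _]
    congr 1 with x
    simp only [mat_mul, mat_inv, Matrix.mul_apply, Matrix.conjTranspose_apply, star_sum,
      star_mul', star_star, Finset.mul_sum]
    exact Finset.sum_congr rfl fun c _ => by ring
  rw [hleft, hright, ← integral_mul_left_eq_self _ g]
  simp only [inv_mul_cancel_left]

theorem trace_intertwiningAverage_self (j l : Fin ξ.d) :
    (ξ.intertwiningAverage ξ j l).trace = if j = l then 1 else 0 := by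
  have hcol : ∀ x, ∑ a, ξ.mat x a j * star (ξ.mat x a l) = if j = l then 1 else 0 := fun x => by
    have h := congrFun (congrFun (ξ.conjTranspose_mul_mat x) l) j
    simp only [Matrix.mul_apply, Matrix.conjTranspose_apply, Matrix.one_apply] at h
    simp_rw [mul_comm (ξ.mat x _ j), h, eq_comm]
  simp only [Matrix.trace, Matrix.diag_apply, intertwiningAverage, Matrix.of_apply]
  rw [← integral_finsetSum _ fun a _ =>
    integrable_of_continuous (ξ.continuous_mat_mul_star ξ a j a l)]
  simp only [hcol, integral_const, probReal_univ, one_smul]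

theorem integral_mat_mul_star_of_not_equivalent (hne : ¬ Equivalent η ξ)
    (a j : Fin ξ.d) (b l : Fin η.d) :
    ∫ x, ξ.mat x a j * star (η.mat x b l) ∂(haarG G) = 0 :=
  congrFun (congrFun (η.eq_zero_of_intertwining ξ (ξ.intertwiningAverage_mul_mat η j l) hne) a) b

theorem integral_mat_mul_star (a j b l : Fin ξ.d) :
    ∫ x, ξ.mat x a j * star (ξ.mat x b l) ∂(haarG G) =
      if a = b ∧ j = l then (ξ.d : ℂ)⁻¹ else 0 := by
  obtain ⟨c, hc⟩ := ξ.exists_eq_smul_one_of_commute (ξ.intertwiningAverage_mul_mat ξ j l)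
  have hd : (ξ.d : ℂ) ≠ 0 := by exact_mod_cast ξ.d_pos.ne'
  have hcd : c = if j = l then (ξ.d : ℂ)⁻¹ else 0 := by
    have htrace := ξ.trace_intertwiningAverage_self j l
    rw [hc, Matrix.trace_smul, Matrix.trace_one, Fintype.card_fin, smul_eq_mul,
      ← eq_div_iff hd] at htrace
    rw [htrace, ite_div, one_div, zero_div]
  have hab := congrFun (congrFun hc a) b
  simp only [intertwiningAverage, Matrix.of_apply, Matrix.smul_apply, Matrix.one_apply, smul_eq_mul,
    mul_ite, mul_one, mul_zero] at hab
  rw [hab, hcd, ite_and]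

end TypeOneRep

end Orthogonality

/-! ### Left-invariant derivatives -/

section ComplexValued

variable {E : Type*} [NormedAddCommGroup E] [NormedSpace ℝ E]
  {G : Type*} [TopologicalSpace G] [ChartedSpace E G]

theorem contMDiff_mul_complex {f h : G → ℂ} (hf : ContMDiff 𝓘(ℝ, E) 𝓘(ℝ, ℂ) ∞ f)
    (hh : ContMDiff 𝓘(ℝ, E) 𝓘(ℝ, ℂ) ∞ h) :
    ContMDiff 𝓘(ℝ, E) 𝓘(ℝ, ℂ) ∞ fun x => f x * h x :=
  (show ContDiff ℝ ∞ (fun z : ℂ × ℂ => z.1 * z.2) by fun_prop).contMDiff.comp (hf.prodMk_space hh)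

theorem contMDiff_sum_const_mul {ι : Type*} (s : Finset ι) (c : ι → ℂ) {f : ι → G → ℂ}
    (hf : ∀ i, ContMDiff 𝓘(ℝ, E) 𝓘(ℝ, ℂ) ∞ (f i)) :
    ContMDiff 𝓘(ℝ, E) 𝓘(ℝ, ℂ) ∞ fun x => ∑ i ∈ s, c i * f i x :=
  contMDiff_finsetSum fun i _ => contMDiff_mul_complex contMDiff_const (hf i)

theorem contMDiff_star_complex {f : G → ℂ} (hf : ContMDiff 𝓘(ℝ, E) 𝓘(ℝ, ℂ) ∞ f) :
    ContMDiff 𝓘(ℝ, E) 𝓘(ℝ, ℂ) ∞ fun x => star (f x) :=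
  Complex.conjCLE.contDiff.contMDiff.comp hf

end ComplexValued

section LieAlgebra

variable {E : Type*} [NormedAddCommGroup E] [NormedSpace ℝ E]
  {G : Type*} [Group G] [TopologicalSpace G] [ChartedSpace E G]

/-- The identification of the Lie algebra with the model space `E`. Both are the same type; this map
marks the places where a tangent vector is used as a vector of the chart at the identity. -/
def toModel : GroupLieAlgebra 𝓘(ℝ, E) G ≃ₗ[ℝ] E := LinearEquiv.refl ℝ E

theorem mfderiv_one_eq_fderiv {f : G → ℂ} (hf : ContMDiff 𝓘(ℝ, E) 𝓘(ℝ, ℂ) ∞ f)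
    (X : GroupLieAlgebra 𝓘(ℝ, E) G) :
    mfderiv 𝓘(ℝ, E) 𝓘(ℝ, ℂ) f 1 X =
      fderiv ℝ (fun e => f ((extChartAt 𝓘(ℝ, E) (1 : G)).symm e))
        (extChartAt 𝓘(ℝ, E) (1 : G) 1) (toModel X) := by
  have h := (hf.mdifferentiableAt (x := 1) (by simp)).hasMFDerivAt.2
  rw [modelWithCornersSelf_coe, Set.range_id] at h
  let D : E →L[ℝ] ℂ := mfderiv 𝓘(ℝ, E) 𝓘(ℝ, ℂ) f 1
  have hD : HasFDerivWithinAt (fun e => f ((extChartAt 𝓘(ℝ, E) (1 : G)).symm e)) D Set.univ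
    (extChartAt 𝓘(ℝ, E) (1 : G) 1) := h
  rw [(hasFDerivWithinAt_univ.1 hD).fderiv]
  rfl

theorem iterLieDeriv_append {n : ℕ}
    (Y : Module.Basis (Fin n) ℝ (GroupLieAlgebra 𝓘(ℝ, E) G))
    (v w : List (Fin n)) (f : G → ℂ) :
    iterLieDeriv Y (v ++ w) f = iterLieDeriv Y v (iterLieDeriv Y w f) :=
  List.foldr_append

end LieAlgebra

section LieDerivative

variable {E : Type*} [NormedAddCommGroup E] [NormedSpace ℝ E]
  {G : Type*} [Group G] [TopologicalSpace G] [ChartedSpace E G] [LieGroup 𝓘(ℝ, E) ∞ G]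

theorem contMDiff_comp_mul_left {f : G → ℂ} (hf : ContMDiff 𝓘(ℝ, E) 𝓘(ℝ, ℂ) ∞ f) (g : G) :
    ContMDiff 𝓘(ℝ, E) 𝓘(ℝ, ℂ) ∞ fun x => f (g * x) :=
  hf.comp contMDiff_mul_left

theorem lieDeriv_eq_mfderiv {f : G → ℂ} (hf : ContMDiff 𝓘(ℝ, E) 𝓘(ℝ, ℂ) ∞ f)
    (X : GroupLieAlgebra 𝓘(ℝ, E) G) (g : G) :
    lieDeriv X f g = mfderiv 𝓘(ℝ, E) 𝓘(ℝ, ℂ) (fun y => f (g * y)) 1 X :=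
  (mfderiv_comp_apply_of_eq (I' := 𝓘(ℝ, E)) (f := fun y => g * y) 1
    (hf.mdifferentiableAt (by simp))
    ((contMDiff_mul_left (I := 𝓘(ℝ, E)) (n := ∞)).mdifferentiableAt (by simp)) (mul_one g) X).symm

theorem lieDeriv_one {f : G → ℂ} (hf : ContMDiff 𝓘(ℝ, E) 𝓘(ℝ, ℂ) ∞ f)
    (X : GroupLieAlgebra 𝓘(ℝ, E) G) : lieDeriv X f 1 = mfderiv 𝓘(ℝ, E) 𝓘(ℝ, ℂ) f 1 X := by
  have hone : (fun y => f (1 * y)) = f := funext fun y => congrArg f (one_mul y)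
  rw [lieDeriv_eq_mfderiv hf, hone]
  rfl

theorem lieDeriv_translate {f : G → ℂ} (hf : ContMDiff 𝓘(ℝ, E) 𝓘(ℝ, ℂ) ∞ f)
    (X : GroupLieAlgebra 𝓘(ℝ, E) G) (g : G) :
    lieDeriv X f g = lieDeriv X (fun x => f (g * x)) 1 := by
  rw [lieDeriv_eq_mfderiv hf, lieDeriv_one (contMDiff_comp_mul_left hf g)]

theorem lieDeriv_Ad {f : G → ℂ} (hf : ContMDiff 𝓘(ℝ, E) 𝓘(ℝ, ℂ) ∞ f)
    (X : GroupLieAlgebra 𝓘(ℝ, E) G) (g : G) :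
    lieDeriv (Ad g X) f 1 = lieDeriv X (fun x => f (g * x * g⁻¹)) 1 := by
  have hconj : ContMDiff 𝓘(ℝ, E) 𝓘(ℝ, E) ∞ fun x : G => g * x * g⁻¹ :=
    (contMDiff_mul_right (a := g⁻¹)).comp (contMDiff_mul_left (a := g))
  have hfconj : ContMDiff 𝓘(ℝ, E) 𝓘(ℝ, ℂ) ∞ fun x : G => f (g * x * g⁻¹) := hf.comp hconj
  rw [lieDeriv_one hf, lieDeriv_one hfconj]
  exact (mfderiv_comp_apply_of_eq (y := (1 : G)) (f := fun x => g * x * g⁻¹) 1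
    (hf.mdifferentiableAt (by simp)) (hconj.mdifferentiableAt (by simp)) (by simp) X).symm

theorem contMDiff_mulInvariantVectorField_infty (X : GroupLieAlgebra 𝓘(ℝ, E) G) :
    ContMDiff 𝓘(ℝ, E) 𝓘(ℝ, E).tangent ∞
      (fun g : G => (mulInvariantVectorField X g : TangentBundle 𝓘(ℝ, E) G)) := by
  -- the field is the derivative of the multiplication, composed with `g ↦ ((g, 0), (1, X))`
  have hsection : ContMDiff 𝓘(ℝ, E) (𝓘(ℝ, E).tangent.prod 𝓘(ℝ, E).tangent) ∞ fun g : G =>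
      ((Bundle.TotalSpace.mk' E g 0, Bundle.TotalSpace.mk' E 1 X) :
        TangentBundle 𝓘(ℝ, E) G × TangentBundle 𝓘(ℝ, E) G) :=
    (Bundle.contMDiff_zeroSection _ _).prodMk contMDiff_const
  have hmul : ContMDiff (𝓘(ℝ, E).prod 𝓘(ℝ, E)).tangent 𝓘(ℝ, E).tangent ∞
      (tangentMap (𝓘(ℝ, E).prod 𝓘(ℝ, E)) 𝓘(ℝ, E) fun p : G × G => p.1 * p.2) :=
    ContMDiff.contMDiff_tangentMap (contMDiff_mul 𝓘(ℝ, E) ∞) (m := ∞) le_rfl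
  convert! (hmul.comp contMDiff_equivTangentBundleProd_symm).comp hsection with g
  · simp
  · simp only [Function.comp_apply, tangentMap]
    rw [mfderiv_prod_eq_add_apply ((contMDiff_mul 𝓘(ℝ, E) ∞).mdifferentiableAt (by simp))]
    exact (zero_add _).symm.trans
      (congrArg₂ (fun a b : E => a + b) (ContinuousLinearMap.map_zero _).symm rfl)

theorem contMDiff_lieDeriv (X : GroupLieAlgebra 𝓘(ℝ, E) G) {f : G → ℂ}
    (hf : ContMDiff 𝓘(ℝ, E) 𝓘(ℝ, ℂ) ∞ f) : ContMDiff 𝓘(ℝ, E) 𝓘(ℝ, ℂ) ∞ (lieDeriv X f) :=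
  (contMDiff_snd_tangentBundle_modelSpace ℂ 𝓘(ℝ, ℂ)).comp <|
    (hf.contMDiff_tangentMap (m := ∞) le_rfl).comp (contMDiff_mulInvariantVectorField_infty X)

theorem contMDiff_iterLieDeriv {n : ℕ} (Y : Module.Basis (Fin n) ℝ (GroupLieAlgebra 𝓘(ℝ, E) G))
    {f : G → ℂ} (hf : ContMDiff 𝓘(ℝ, E) 𝓘(ℝ, ℂ) ∞ f) (w : List (Fin n)) :
    ContMDiff 𝓘(ℝ, E) 𝓘(ℝ, ℂ) ∞ (iterLieDeriv Y w f) := by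
  induction w with
  | nil => exact hf
  | cons i w ih => exact contMDiff_lieDeriv _ ih

/-- The function `f` near `g`, read in the chart at the identity moved to `g`. -/
def localForm (f : G → ℂ) (g : G) (e : E) : ℂ := f (g * (extChartAt 𝓘(ℝ, E) (1 : G)).symm e)

theorem contMDiffAt_extChartAt_one_symm {e : E} (he : e ∈ (extChartAt 𝓘(ℝ, E) (1 : G)).target) :
    ContMDiffAt 𝓘(ℝ, E) 𝓘(ℝ, E) ∞ (extChartAt 𝓘(ℝ, E) (1 : G)).symm e :=
  (contMDiffOn_extChartAt_symm (1 : G)).contMDiffAt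
    ((isOpen_extChartAt_target (1 : G)).mem_nhds he)

theorem contDiffAt_localForm {f : G → ℂ} (hf : ContMDiff 𝓘(ℝ, E) 𝓘(ℝ, ℂ) ∞ f) (g : G) {e : E}
    (he : e ∈ (extChartAt 𝓘(ℝ, E) (1 : G)).target) : ContDiffAt ℝ ∞ (localForm f g) e := by
  rw [← contMDiffAt_iff_contDiffAt]
  exact (contMDiff_comp_mul_left hf g).contMDiffAt.comp e (contMDiffAt_extChartAt_one_symm he)

theorem differentiableAt_localForm {f : G → ℂ} (hf : ContMDiff 𝓘(ℝ, E) 𝓘(ℝ, ℂ) ∞ f) (g : G) :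
    DifferentiableAt ℝ (localForm f g) (extChartAt 𝓘(ℝ, E) (1 : G) 1) :=
  (contDiffAt_localForm hf g (mem_extChartAt_target (1 : G))).differentiableAt (by simp)

theorem lieDeriv_eq_fderiv {f : G → ℂ} (hf : ContMDiff 𝓘(ℝ, E) 𝓘(ℝ, ℂ) ∞ f)
    (X : GroupLieAlgebra 𝓘(ℝ, E) G) (g : G) :
    lieDeriv X f g = fderiv ℝ (localForm f g) (extChartAt 𝓘(ℝ, E) (1 : G) 1) (toModel X) := by
  rw [lieDeriv_eq_mfderiv hf, mfderiv_one_eq_fderiv (contMDiff_comp_mul_left hf g)]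
  rfl

theorem lieDeriv_mul {f h : G → ℂ} (hf : ContMDiff 𝓘(ℝ, E) 𝓘(ℝ, ℂ) ∞ f)
    (hh : ContMDiff 𝓘(ℝ, E) 𝓘(ℝ, ℂ) ∞ h) (X : GroupLieAlgebra 𝓘(ℝ, E) G) (g : G) :
    lieDeriv X (fun x => f x * h x) g = f g * lieDeriv X h g + lieDeriv X f g * h g := by
  have hprod : localForm (E := E) (fun x => f x * h x) g = localForm f g * localForm h g := rfl
  rw [lieDeriv_eq_fderiv (contMDiff_mul_complex hf hh), lieDeriv_eq_fderiv hf,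
    lieDeriv_eq_fderiv hh, hprod, ((differentiableAt_localForm hf g).hasFDerivAt.mul
      (differentiableAt_localForm hh g).hasFDerivAt).fderiv]
  simp [localForm, mul_comm]

theorem lieDeriv_sum_const_mul {ι : Type*} (s : Finset ι) (c : ι → ℂ) {f : ι → G → ℂ}
    (hf : ∀ i, ContMDiff 𝓘(ℝ, E) 𝓘(ℝ, ℂ) ∞ (f i)) (X : GroupLieAlgebra 𝓘(ℝ, E) G) (g : G) :
    lieDeriv X (fun x => ∑ i ∈ s, c i * f i x) g = ∑ i ∈ s, c i * lieDeriv X (f i) g := by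
  have hsum : localForm (E := E) (fun x => ∑ i ∈ s, c i * f i x) g =
    fun e => ∑ i ∈ s, c i * localForm (f i) g e := rfl
  simp_rw [lieDeriv_eq_fderiv (contMDiff_sum_const_mul s c hf), lieDeriv_eq_fderiv (hf _), hsum]
  rw [(HasFDerivAt.fun_sum (u := s) fun i _ =>
    (differentiableAt_localForm (hf i) g).hasFDerivAt.const_mul (c i)).fderiv]
  simp

theorem lieDeriv_star {f : G → ℂ} (hf : ContMDiff 𝓘(ℝ, E) 𝓘(ℝ, ℂ) ∞ f)
    (X : GroupLieAlgebra 𝓘(ℝ, E) G) (g : G) :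
    lieDeriv X (fun x => star (f x)) g = star (lieDeriv X f g) := by
  have hstar : localForm (E := E) (fun x => star (f x)) g = fun e => star (localForm f g e) := rfl
  rw [lieDeriv_eq_fderiv (contMDiff_star_complex hf), lieDeriv_eq_fderiv hf, hstar,
    (differentiableAt_localForm hf g).hasFDerivAt.star.fderiv]
  simp

theorem iterLieDeriv_star {n : ℕ} (Y : Module.Basis (Fin n) ℝ (GroupLieAlgebra 𝓘(ℝ, E) G))
    (w : List (Fin n)) {f : G → ℂ} (hf : ContMDiff 𝓘(ℝ, E) 𝓘(ℝ, ℂ) ∞ f) :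
    iterLieDeriv Y w (fun x => star (f x)) = fun x => star (iterLieDeriv Y w f x) := by
  induction w with
  | nil => rfl
  | cons a w ih =>
    change lieDeriv (Y a) (iterLieDeriv Y w _) = fun x => star (lieDeriv (Y a) _ x)
    rw [ih]
    exact funext (lieDeriv_star (contMDiff_iterLieDeriv Y hf w) _)

theorem lieDeriv_const (c : ℂ) (X : GroupLieAlgebra 𝓘(ℝ, E) G) (g : G) :
    lieDeriv X (fun _ => c) g = 0 := by
  have hconst : localForm (E := E) (fun _ : G => c) g = fun _ => c := rfl
  rw [lieDeriv_eq_fderiv contMDiff_const, hconst, fderiv_fun_const]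
  rfl

theorem hasDerivAt_localForm_line {f : G → ℂ} (hf : ContMDiff 𝓘(ℝ, E) 𝓘(ℝ, ℂ) ∞ f)
    (X : GroupLieAlgebra 𝓘(ℝ, E) G) (g : G) :
    HasDerivAt (fun t : ℝ => localForm f g (extChartAt 𝓘(ℝ, E) (1 : G) 1 + t • toModel X))
      (lieDeriv X f g) 0 := by
  rw [lieDeriv_eq_fderiv hf]
  have hline : HasDerivAt (fun t : ℝ => extChartAt 𝓘(ℝ, E) (1 : G) 1 + t • toModel X)
      (toModel X) 0 := by
    simpa using ((hasDerivAt_id (0 : ℝ)).smul_const (toModel X)).const_add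
      (extChartAt 𝓘(ℝ, E) (1 : G) 1)
  exact (differentiableAt_localForm hf g).hasFDerivAt.comp_hasDerivAt_of_eq 0 hline (by simp)

end LieDerivative

/-! ### Integration by parts -/

section LipschitzLine

variable {E : Type*} [NormedAddCommGroup E] [NormedSpace ℝ E]
  {G : Type*} [Group G] [TopologicalSpace G] [ChartedSpace E G] [LieGroup 𝓘(ℝ, E) ∞ G]

theorem contDiffAt_localForm_mul_chart_line {f : G → ℂ} (hf : ContMDiff 𝓘(ℝ, E) 𝓘(ℝ, ℂ) ∞ f)
    (X : GroupLieAlgebra 𝓘(ℝ, E) G) (x₀ : G) :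
    ContDiffAt ℝ ∞ (fun p : ℝ × E => localForm f (x₀ * (extChartAt 𝓘(ℝ, E) (1 : G)).symm p.2)
      (extChartAt 𝓘(ℝ, E) (1 : G) 1 + p.1 • toModel X)) (0, extChartAt 𝓘(ℝ, E) (1 : G) 1) := by
  rw [← contMDiffAt_iff_contDiffAt]
  set c := extChartAt 𝓘(ℝ, E) (1 : G)
  have hsymm : ContMDiffAt 𝓘(ℝ, E) 𝓘(ℝ, E) ∞ c.symm (c 1) :=
    contMDiffAt_extChartAt_one_symm (mem_extChartAt_target (1 : G))
  have hpoint : ContMDiffAt 𝓘(ℝ, ℝ × E) 𝓘(ℝ, E) ∞ (fun p : ℝ × E => c.symm p.2) (0, c 1) :=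
    hsymm.comp (I' := 𝓘(ℝ, E)) ((0 : ℝ), c 1) (f := fun p : ℝ × E => p.2)
      contDiff_snd.contMDiff.contMDiffAt
  have hline : ContMDiffAt 𝓘(ℝ, ℝ × E) 𝓘(ℝ, E) ∞
      (fun p : ℝ × E => c.symm (c 1 + p.1 • toModel X)) (0, c 1) :=
    ContMDiffAt.comp (I' := 𝓘(ℝ, E)) ((0 : ℝ), c 1)
      (f := fun p : ℝ × E => c 1 + p.1 • toModel X) (by simpa using hsymm)
      (show ContDiff ℝ ∞ fun p : ℝ × E => c 1 + p.1 • toModel X by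
        fun_prop).contMDiff.contMDiffAt
  exact ContMDiffAt.comp (I' := 𝓘(ℝ, E)) ((0 : ℝ), c 1) hf.contMDiffAt
    (((contMDiffAt_const (c := x₀)).mul hpoint).mul hline)

theorem eventually_lipschitzOnWith_localForm_line {f : G → ℂ}
    (hf : ContMDiff 𝓘(ℝ, E) 𝓘(ℝ, ℂ) ∞ f) (X : GroupLieAlgebra 𝓘(ℝ, E) G) (x₀ : G) :
    ∃ (C : ℝ≥0) (ε : ℝ), 0 < ε ∧ ∀ᶠ x in nhds x₀, LipschitzOnWith C
      (fun t : ℝ => localForm f x (extChartAt 𝓘(ℝ, E) (1 : G) 1 + t • toModel X))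
      (Metric.ball 0 ε) := by
  obtain ⟨C, t, ht, hC⟩ := ((contDiffAt_localForm_mul_chart_line hf X x₀).of_le
    (m := 1) (by simp)).exists_lipschitzOnWith
  obtain ⟨U, hU, V, hV, hUV⟩ := mem_nhds_prod_iff.1 ht
  obtain ⟨ε, hε, hεU⟩ := Metric.mem_nhds_iff.1 hU
  have htendsto : Filter.Tendsto (fun x => x₀⁻¹ * x) (nhds x₀) (nhds 1) := by
    simpa using (contMDiff_mul_left (a := x₀⁻¹) (I := 𝓘(ℝ, E)) (n := ∞)).continuous.tendsto x₀
  refine ⟨C, ε, hε, ?_⟩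
  filter_upwards [htendsto (extChartAt_source_mem_nhds (I := 𝓘(ℝ, E)) (1 : G)),
    ((continuousAt_extChartAt (I := 𝓘(ℝ, E)) (1 : G)).tendsto.comp htendsto) hV] with x hxs hxV
  have hx : x₀ * (extChartAt 𝓘(ℝ, E) (1 : G)).symm (extChartAt 𝓘(ℝ, E) (1 : G) (x₀⁻¹ * x)) = x := by
    rw [(extChartAt 𝓘(ℝ, E) (1 : G)).left_inv hxs, mul_inv_cancel_left]
  intro a ha b hb
  have hlip := hC (hUV (Set.mk_mem_prod (hεU ha) hxV)) (hUV (Set.mk_mem_prod (hεU hb) hxV))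
  simp only [Function.comp_apply, hx] at hlip
  exact hlip.trans_eq (by simp [Prod.edist_eq])

theorem exists_lipschitzOnWith_localForm_line [CompactSpace G] {f : G → ℂ}
    (hf : ContMDiff 𝓘(ℝ, E) 𝓘(ℝ, ℂ) ∞ f) (X : GroupLieAlgebra 𝓘(ℝ, E) G) :
    ∃ (C : ℝ≥0) (ε : ℝ), 0 < ε ∧ ∀ x, LipschitzOnWith C
      (fun t : ℝ => localForm f x (extChartAt 𝓘(ℝ, E) (1 : G) 1 + t • toModel X))
      (Metric.ball 0 ε) := by
  choose C ε hε hC using eventually_lipschitzOnWith_localForm_line hf X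
  obtain ⟨s, hs⟩ := CompactSpace.elim_nhds_subcover _ hC
  have hsne : s.Nonempty := by
    obtain ⟨x, hx, -⟩ := Set.mem_iUnion₂.1 (hs.ge (Set.mem_univ (1 : G)))
    exact ⟨x, hx⟩
  refine ⟨s.sup C, s.inf' hsne ε, (Finset.lt_inf'_iff hsne).2 fun x _ => hε x, fun x => ?_⟩
  obtain ⟨x₀, hx₀, hx⟩ := Set.mem_iUnion₂.1 (hs.ge (Set.mem_univ x))
  exact (LipschitzOnWith.mono hx (Metric.ball_subset_ball (Finset.inf'_le ε hx₀))).weaken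
    (Finset.le_sup hx₀)

end LipschitzLine

section IntegrationByParts

variable {E : Type*} [NormedAddCommGroup E] [NormedSpace ℝ E]
  {G : Type*} [Group G] [TopologicalSpace G] [ChartedSpace E G] [LieGroup 𝓘(ℝ, E) ∞ G]
  [IsTopologicalGroup G] [CompactSpace G] [MeasurableSpace G] [BorelSpace G]

theorem integral_lieDeriv_eq_zero {f : G → ℂ} (hf : ContMDiff 𝓘(ℝ, E) 𝓘(ℝ, ℂ) ∞ f)
    (X : GroupLieAlgebra 𝓘(ℝ, E) G) : ∫ x, lieDeriv X f x ∂(haarG G) = 0 := by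
  set F : ℝ → G → ℂ := fun t x => localForm f x (extChartAt 𝓘(ℝ, E) (1 : G) 1 + t • toModel X)
  obtain ⟨C, ε, hε, hC⟩ := exists_lipschitzOnWith_localForm_line hf X
  have hcont : ∀ t, Continuous (F t) := fun t => hf.continuous.comp (continuous_mul_const _)
  have hderiv : HasDerivAt (fun t => ∫ x, F t x ∂(haarG G)) (∫ x, lieDeriv X f x ∂(haarG G)) 0 :=
    (hasDerivAt_integral_of_dominated_loc_of_lip (bound := fun _ => (C : ℝ))
      (Metric.ball_mem_nhds 0 hε)
      (Filter.Eventually.of_forall fun t => (integrable_of_continuous (hcont t)).1)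
      (integrable_of_continuous (hcont 0))
      (integrable_of_continuous (contMDiff_lieDeriv X hf).continuous).1
      (Filter.Eventually.of_forall fun x => by simpa only [Real.nnabs_coe] using hC x)
      (integrable_const _)
      (Filter.Eventually.of_forall fun x => hasDerivAt_localForm_line hf X x)).2
  have hconst : (fun t => ∫ x, F t x ∂(haarG G)) = fun _ => ∫ x, f x ∂(haarG G) :=
    funext fun t => integral_mul_right_eq_self f _
  exact hderiv.unique (hconst ▸ hasDerivAt_const _ _)

theorem integral_mul_lieDeriv {f h : G → ℂ} (hf : ContMDiff 𝓘(ℝ, E) 𝓘(ℝ, ℂ) ∞ f)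
    (hh : ContMDiff 𝓘(ℝ, E) 𝓘(ℝ, ℂ) ∞ h) (X : GroupLieAlgebra 𝓘(ℝ, E) G) :
    ∫ x, f x * lieDeriv X h x ∂(haarG G) = -∫ x, lieDeriv X f x * h x ∂(haarG G) := by
  have hzero := integral_lieDeriv_eq_zero (contMDiff_mul_complex hf hh) X
  simp_rw [lieDeriv_mul hf hh X] at hzero
  rw [integral_add (f := fun x => f x * lieDeriv X h x) (g := fun x => lieDeriv X f x * h x)
    (integrable_of_continuous (hf.continuous.mul (contMDiff_lieDeriv X hh).continuous))
    (integrable_of_continuous ((contMDiff_lieDeriv X hf).continuous.mul hh.continuous))] at hzero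
  exact eq_neg_of_add_eq_zero_left hzero

variable {n : ℕ} (Y : Module.Basis (Fin n) ℝ (GroupLieAlgebra 𝓘(ℝ, E) G))

theorem integral_mul_laplacian {f h : G → ℂ} (hf : ContMDiff 𝓘(ℝ, E) 𝓘(ℝ, ℂ) ∞ f)
    (hh : ContMDiff 𝓘(ℝ, E) 𝓘(ℝ, ℂ) ∞ h) :
    ∫ x, f x * laplacian Y h x ∂(haarG G) =
      ∑ i, ∫ x, lieDeriv (Y i) (lieDeriv (Y i) f) x * h x ∂(haarG G) := by
  simp only [laplacian, Finset.mul_sum]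
  rw [integral_finsetSum (f := fun i x => f x * lieDeriv (Y i) (lieDeriv (Y i) h) x) _
    fun i _ => integrable_of_continuous
      (hf.continuous.mul (contMDiff_lieDeriv _ (contMDiff_lieDeriv _ hh)).continuous)]
  refine Finset.sum_congr rfl fun i _ => ?_
  rw [integral_mul_lieDeriv hf (contMDiff_lieDeriv _ hh),
    integral_mul_lieDeriv (contMDiff_lieDeriv _ hf) hh, neg_neg]

theorem one_add_mul_norm_integral_mul_le {f h : G → ℂ} (hf : ContMDiff 𝓘(ℝ, E) 𝓘(ℝ, ℂ) ∞ f)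
    (hh : ContMDiff 𝓘(ℝ, E) 𝓘(ℝ, ℂ) ∞ h) {l : ℝ} (hl : 0 ≤ l)
    (hlap : ∀ x, -laplacian Y h x = (l : ℂ) * h x) :
    (1 + l) * ‖∫ x, f x * h x ∂(haarG G)‖ ≤ ‖∫ x, f x * h x ∂(haarG G)‖ +
      ∑ i, ‖∫ x, lieDeriv (Y i) (lieDeriv (Y i) f) x * h x ∂(haarG G)‖ := by
  have hparts : (l : ℂ) * ∫ x, f x * h x ∂(haarG G) =
      -∑ i, ∫ x, lieDeriv (Y i) (lieDeriv (Y i) f) x * h x ∂(haarG G) := by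
    rw [← integral_mul_laplacian Y hf hh, ← integral_neg, ← integral_const_mul]
    congr 1 with x
    rw [← mul_neg, hlap, mul_left_comm]
  calc (1 + l) * ‖∫ x, f x * h x ∂(haarG G)‖
      = ‖∫ x, f x * h x ∂(haarG G)‖ + ‖(l : ℂ) * ∫ x, f x * h x ∂(haarG G)‖ := by
        rw [norm_mul, Complex.norm_real, Real.norm_of_nonneg hl, add_mul, one_mul]
    _ ≤ _ := by
        rw [hparts, norm_neg]
        gcongr
        exact norm_sum_le _ _

theorem pow_mul_norm_integral_mul_le {h : G → ℂ} (hh : ContMDiff 𝓘(ℝ, E) 𝓘(ℝ, ℂ) ∞ h)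
    (hb : ∀ x, ‖h x‖ ≤ 1) {l : ℝ} (hl : 0 ≤ l) (hlap : ∀ x, -laplacian Y h x = (l : ℂ) * h x)
    (M : ℕ) {f : G → ℂ} (hf : ContMDiff 𝓘(ℝ, E) 𝓘(ℝ, ℂ) ∞ f) {A : ℝ}
    (hA : ∀ w : List (Fin n), w.length ≤ 2 * M → ∀ x, ‖iterLieDeriv Y w f x‖ ≤ A) :
    (1 + l) ^ M * ‖∫ x, f x * h x ∂(haarG G)‖ ≤ (1 + n) ^ M * A := by
  induction M generalizing f with
  | zero =>
    have hfA : ∀ x, ‖f x‖ ≤ A := hA [] (by simp)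
    simpa using norm_integral_le_of_norm_le_const (μ := haarG G) (f := fun x => f x * h x)
      (Filter.Eventually.of_forall fun x => (norm_mul_le _ _).trans <|
        (mul_le_mul (hfA x) (hb x) (norm_nonneg _) ((norm_nonneg _).trans (hfA x))).trans_eq
          (mul_one A))
  | succ M ih =>
    have hderiv : ∀ i, (1 + l) ^ M *
        ‖∫ x, lieDeriv (Y i) (lieDeriv (Y i) f) x * h x ∂(haarG G)‖ ≤ (1 + n) ^ M * A := fun i =>
      ih (contMDiff_lieDeriv _ (contMDiff_lieDeriv _ hf)) fun w hw x => by
        simpa only [iterLieDeriv_append] using! hA (w ++ [i, i]) (by simp; omega) x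
    calc (1 + l) ^ (M + 1) * ‖∫ x, f x * h x ∂(haarG G)‖
        = (1 + l) ^ M * ((1 + l) * ‖∫ x, f x * h x ∂(haarG G)‖) := by ring
      _ ≤ (1 + l) ^ M * (‖∫ x, f x * h x ∂(haarG G)‖ +
          ∑ i, ‖∫ x, lieDeriv (Y i) (lieDeriv (Y i) f) x * h x ∂(haarG G)‖) := by
          gcongr
          exact one_add_mul_norm_integral_mul_le Y hf hh hl hlap
      _ ≤ (1 + n) ^ M * A + ∑ _i : Fin n, (1 + n) ^ M * A := by
          rw [mul_add, Finset.mul_sum]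
          exact add_le_add (ih hf fun w hw => hA w (by omega))
            (Finset.sum_le_sum fun i _ => hderiv i)
      _ = (1 + n) ^ (M + 1) * A := by simp; ring

end IntegrationByParts

/-! ### Smoothness of continuous representations -/

theorem contDiffOn_integral_smul_of_support_subset {P E F : Type*}
    [NormedAddCommGroup P] [NormedSpace ℝ P] [NormedAddCommGroup E] [NormedSpace ℝ E]
    [NormedAddCommGroup F] [NormedSpace ℝ F] [MeasurableSpace E] [BorelSpace E] {μ : Measure E}
    {s : Set P} (hs : IsOpen s) {k : Set E} (hk : IsCompact k) {κ : P → E → ℝ}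
    (hκk : ∀ p t, p ∈ s → t ∉ k → κ p t = 0)
    (hκ : ContDiffOn ℝ ∞ (fun q : P × E => κ q.1 q.2) (s ×ˢ Set.univ))
    {f : E → F} (hf : LocallyIntegrable f μ) :
    ContDiffOn ℝ ∞ (fun p => ∫ t, κ p t • f t ∂μ) s := by
  -- the integral is the value at `0` of the convolution of `f` with `t ↦ κ p (-t)`
  have hconv := contDiffOn_convolution_right_with_param_comp (𝕜 := ℝ) (μ := μ) (n := ⊤)
    (ContinuousLinearMap.lsmul ℝ ℝ (E := F)).flip (v := fun _ : P => (0 : E)) contDiffOn_const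
    (g := fun p t => κ p (-t)) (k := -k) hs hk.neg
    (fun p t hp ht => hκk p (-t) hp (by simpa using ht)) hf
    (hκ.comp (f := fun q : P × E => (q.1, -q.2)) (by fun_prop) fun q hq => ⟨hq.1, trivial⟩)
  simpa [convolution] using hconv

section Convolution

variable {E : Type*} [NormedAddCommGroup E] [NormedSpace ℝ E]
  {G : Type*} [Group G] [TopologicalSpace G] [ChartedSpace E G]

open Classical in
/-- The kernel `(x, y) ↦ φ (x⁻¹ * y)` in the chart at the identity, extended by `0` outside of the
target of the chart. -/
def chartKernel (φ : G → ℝ) (p t : E) : ℝ :=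
  if t ∈ (extChartAt 𝓘(ℝ, E) (1 : G)).target then
    φ (((extChartAt 𝓘(ℝ, E) (1 : G)).symm p)⁻¹ * (extChartAt 𝓘(ℝ, E) (1 : G)).symm t)
  else 0

variable {φ : G → ℝ} {V N : Set G} (hφV : ∀ x ∈ V, ∀ y, φ (x⁻¹ * y) ≠ 0 → y ∈ N)

include hφV in
theorem chartKernel_eq_zero {p t : E} (hp : (extChartAt 𝓘(ℝ, E) (1 : G)).symm p ∈ V)
    (ht : t ∉ extChartAt 𝓘(ℝ, E) (1 : G) '' N) : chartKernel φ p t = 0 := by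
  unfold chartKernel
  split_ifs with htt
  · by_contra h
    exact ht ⟨_, hφV _ hp _ h, (extChartAt 𝓘(ℝ, E) (1 : G)).right_inv htt⟩
  · rfl

variable (hNc : IsCompact N) (hN : N ⊆ (extChartAt 𝓘(ℝ, E) (1 : G)).source)

include hNc hN in
theorem isCompact_image_extChartAt_one : IsCompact (extChartAt 𝓘(ℝ, E) (1 : G) '' N) :=
  hNc.image_of_continuousOn ((continuousOn_extChartAt (1 : G)).mono hN)

theorem isOpen_extChartAt_one_symm_preimage (hV : IsOpen V) :
    IsOpen ((extChartAt 𝓘(ℝ, E) (1 : G)).target ∩ (extChartAt 𝓘(ℝ, E) (1 : G)).symm ⁻¹' V) :=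
  (continuousOn_extChartAt_symm (1 : G)).isOpen_inter_preimage
    (isOpen_extChartAt_target (1 : G)) hV

variable [LieGroup 𝓘(ℝ, E) ∞ G]

include hφV hNc hN in
theorem contDiffOn_chartKernel (hφ : ContMDiff 𝓘(ℝ, E) 𝓘(ℝ, ℝ) ∞ φ) (hV : IsOpen V) :
    ContDiffOn ℝ ∞ (fun q : E × E => chartKernel φ q.1 q.2)
      (((extChartAt 𝓘(ℝ, E) (1 : G)).target ∩ (extChartAt 𝓘(ℝ, E) (1 : G)).symm ⁻¹' V) ×ˢ
        Set.univ) := by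
  rintro ⟨p, t⟩ ⟨hp, -⟩
  apply ContDiffAt.contDiffWithinAt
  set c := extChartAt 𝓘(ℝ, E) (1 : G)
  by_cases htt : t ∈ c.target
  · have hfst : ContMDiffAt 𝓘(ℝ, E × E) 𝓘(ℝ, E) ∞ (fun q : E × E => c.symm q.1) (p, t) :=
      ContMDiffAt.comp (I' := 𝓘(ℝ, E)) (p, t) (f := fun q : E × E => q.1)
        (contMDiffAt_extChartAt_one_symm hp.1) contDiff_fst.contMDiff.contMDiffAt
    have hsnd : ContMDiffAt 𝓘(ℝ, E × E) 𝓘(ℝ, E) ∞ (fun q : E × E => c.symm q.2) (p, t) :=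
      ContMDiffAt.comp (I' := 𝓘(ℝ, E)) (p, t) (f := fun q : E × E => q.2)
        (contMDiffAt_extChartAt_one_symm htt) contDiff_snd.contMDiff.contMDiffAt
    have hker : ContMDiffAt 𝓘(ℝ, E × E) 𝓘(ℝ, ℝ) ∞
        (fun q : E × E => φ ((c.symm q.1)⁻¹ * c.symm q.2)) (p, t) :=
      ContMDiffAt.comp (I' := 𝓘(ℝ, E)) (p, t) hφ.contMDiffAt (hfst.inv.mul hsnd)
    refine (contMDiffAt_iff_contDiffAt.1 hker).congr_of_eventuallyEq ?_
    filter_upwards [continuous_snd.continuousAt.preimage_mem_nhds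
      ((isOpen_extChartAt_target (1 : G)).mem_nhds htt)] with q hq
    exact if_pos hq
  · have htN : t ∉ c '' N := fun ⟨y, hy, hyt⟩ => htt (hyt ▸ c.map_source (hN hy))
    refine (contDiffAt_const (c := (0 : ℝ))).congr_of_eventuallyEq ?_
    filter_upwards [prod_mem_nhds ((isOpen_extChartAt_one_symm_preimage hV).mem_nhds hp)
      ((isCompact_image_extChartAt_one hNc hN).isClosed.isOpen_compl.mem_nhds htN)] with q hq
    exact chartKernel_eq_zero hφV hq.1.2 hq.2

variable [FiniteDimensional ℝ E] [MeasurableSpace E] [BorelSpace E] [CompactSpace G]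
  [MeasurableSpace G] [BorelSpace G] {ν : Measure G} [IsFiniteMeasure ν]
  {F : Type*} [NormedAddCommGroup F] [NormedSpace ℝ F] {f : G → F}

omit [LieGroup 𝓘(ℝ, E) ∞ G] [BorelSpace G] [NormedSpace ℝ F] in
variable (E ν) in
theorem integrable_indicator_comp_extChartAt_one_symm (hf : Continuous f) :
    Integrable ((extChartAt 𝓘(ℝ, E) (1 : G)).target.indicator
      (f ∘ (extChartAt 𝓘(ℝ, E) (1 : G)).symm))
      ((ν.restrict (extChartAt 𝓘(ℝ, E) (1 : G)).source).map (extChartAt 𝓘(ℝ, E) (1 : G))) := by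
  have htarget : MeasurableSet (extChartAt 𝓘(ℝ, E) (1 : G)).target :=
    (isOpen_extChartAt_target (1 : G)).measurableSet
  obtain ⟨C, hC⟩ := isCompact_univ.exists_bound_of_continuousOn hf.continuousOn
  refine Integrable.of_bound ((aestronglyMeasurable_indicator_iff htarget).2
    ((hf.comp_continuousOn (continuousOn_extChartAt_symm (1 : G))).aestronglyMeasurable htarget)) C
    (Filter.Eventually.of_forall fun t => ?_)
  exact (norm_indicator_le_norm_self _ _).trans (hC _ (Set.mem_univ _))

include hφV hNc hN in
theorem integral_smul_eq_integral_chartKernel_smul (hφ : ContMDiff 𝓘(ℝ, E) 𝓘(ℝ, ℝ) ∞ φ)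
    (hV : IsOpen V) (hf : Continuous f) {x : G} (hxV : x ∈ V)
    (hx : x ∈ (extChartAt 𝓘(ℝ, E) (1 : G)).source) :
    ∫ y, φ (x⁻¹ * y) • f y ∂ν =
      ∫ t, chartKernel φ (extChartAt 𝓘(ℝ, E) (1 : G) x) t •
        (extChartAt 𝓘(ℝ, E) (1 : G)).target.indicator (f ∘ (extChartAt 𝓘(ℝ, E) (1 : G)).symm) t
        ∂((ν.restrict (extChartAt 𝓘(ℝ, E) (1 : G)).source).map (extChartAt 𝓘(ℝ, E) (1 : G))) := by
  have hsource : MeasurableSet (extChartAt 𝓘(ℝ, E) (1 : G)).source :=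
    (isOpen_extChartAt_source (1 : G)).measurableSet
  have hcont : Continuous (chartKernel φ (extChartAt 𝓘(ℝ, E) (1 : G) x)) :=
    continuousOn_univ.1 <| (contDiffOn_chartKernel hφV hNc hN hφ hV).continuousOn.comp
      (f := fun t : E => (extChartAt 𝓘(ℝ, E) (1 : G) x, t)) (s := Set.univ) (by fun_prop)
      fun t _ => ⟨⟨(extChartAt 𝓘(ℝ, E) (1 : G)).map_source hx, by
        rw [Set.mem_preimage, (extChartAt 𝓘(ℝ, E) (1 : G)).left_inv hx]
        exact hxV⟩, trivial⟩
  rw [integral_map (f := fun t => chartKernel φ (extChartAt 𝓘(ℝ, E) (1 : G) x) t •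
      (extChartAt 𝓘(ℝ, E) (1 : G)).target.indicator (f ∘ (extChartAt 𝓘(ℝ, E) (1 : G)).symm) t)
    ((continuousOn_extChartAt (1 : G)).aemeasurable hsource)
    (hcont.aestronglyMeasurable.smul (integrable_indicator_comp_extChartAt_one_symm E ν hf).1),
    ← setIntegral_eq_integral_of_forall_compl_eq_zero
      (s := (extChartAt 𝓘(ℝ, E) (1 : G)).source)]
  · refine setIntegral_congr_fun hsource fun y hy => ?_
    simp only [chartKernel, Set.indicator, if_pos ((extChartAt 𝓘(ℝ, E) (1 : G)).map_source hy),
      Function.comp_apply, (extChartAt 𝓘(ℝ, E) (1 : G)).left_inv hy,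
      (extChartAt 𝓘(ℝ, E) (1 : G)).left_inv hx]
  · intro y hy
    by_contra h
    exact hy (hN (hφV x hxV y (left_ne_zero_of_smul h)))

include hφV hNc hN in
theorem contMDiffAt_one_integral_smul (hφ : ContMDiff 𝓘(ℝ, E) 𝓘(ℝ, ℝ) ∞ φ) (hV : IsOpen V)
    (h1V : 1 ∈ V) (hf : Continuous f) :
    ContMDiffAt 𝓘(ℝ, E) 𝓘(ℝ, F) ∞ (fun x => ∫ y, φ (x⁻¹ * y) • f y ∂ν) 1 := by
  have hchart := (contDiffOn_integral_smul_of_support_subset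
    (isOpen_extChartAt_one_symm_preimage hV) (isCompact_image_extChartAt_one hNc hN)
    (fun p t hp ht => chartKernel_eq_zero hφV hp.2 ht) (contDiffOn_chartKernel hφV hNc hN hφ hV)
    (integrable_indicator_comp_extChartAt_one_symm E ν hf).locallyIntegrable).contDiffAt
    ((isOpen_extChartAt_one_symm_preimage hV).mem_nhds
      ⟨mem_extChartAt_target (1 : G), by simpa [extChartAt_to_inv] using h1V⟩)
  refine ((contMDiffAt_iff_contDiffAt.2 hchart).comp (1 : G)
    contMDiffAt_extChartAt).congr_of_eventuallyEq ?_
  filter_upwards [hV.mem_nhds h1V, extChartAt_source_mem_nhds (I := 𝓘(ℝ, E)) (1 : G)] with x hxV hx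
  exact integral_smul_eq_integral_chartKernel_smul hφV hNc hN hφ hV hf hxV hx

end Convolution

section Homomorphism

variable {G : Type*} [Group G] [TopologicalSpace G] [IsTopologicalGroup G] [CompactSpace G]
  {𝔸 : Type*} [NormedRing 𝔸] [NormedAlgebra ℝ 𝔸] [CompleteSpace 𝔸] {π : G →* 𝔸}

theorem isUnit_integral_smul [MeasurableSpace G] [BorelSpace G] (hπ : Continuous π) {φ : G → ℝ}
    (hφ : Continuous φ) (hφ0 : ∀ y, 0 ≤ φ y) (hφ1 : φ 1 ≠ 0)
    (hφπ : ∀ y ∈ Function.support φ, ‖π y - 1‖ ≤ 1 / 2) :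
    IsUnit (∫ y, φ y • π y ∂(haarG G)) := by
  have hint : Integrable φ (haarG G) := integrable_of_continuous hφ
  set m : ℝ := ∫ y, φ y ∂(haarG G)
  have hm : 0 < m := (integral_pos_iff_support_of_nonneg hφ0 hint).2
    (hφ.isOpen_support.measure_pos _ ⟨1, hφ1⟩)
  have hdiff : (∫ y, φ y • π y ∂(haarG G)) - m • 1 = ∫ y, φ y • (π y - 1) ∂(haarG G) := by
    simp_rw [smul_sub]
    rw [integral_sub (f := fun y => φ y • π y) (integrable_of_continuous (hφ.smul hπ))
      (hint.smul_const 1), integral_smul_const]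
  have hclose : ‖(∫ y, φ y • π y ∂(haarG G)) - m • 1‖ ≤ m * (1 / 2) := by
    rw [hdiff, ← integral_mul_const]
    refine norm_integral_le_of_norm_le (hint.mul_const _) (Filter.Eventually.of_forall fun y => ?_)
    rw [norm_smul, Real.norm_of_nonneg (hφ0 y)]
    by_cases hy : y ∈ Function.support φ
    · exact mul_le_mul_of_nonneg_left (hφπ y hy) (hφ0 y)
    · simp [Function.notMem_support.1 hy]
  have hnear : ‖1 - m⁻¹ • ∫ y, φ y • π y ∂(haarG G)‖ < 1 := by
    rw [norm_sub_rev, ← inv_smul_smul₀ hm.ne' (1 : 𝔸), ← smul_sub, norm_smul, norm_inv,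
      Real.norm_of_nonneg hm.le, inv_mul_lt_iff₀ hm]
    linarith
  have hunit := isUnit_one_sub_of_norm_lt_one hnear
  rw [sub_sub_cancel] at hunit
  exact (isUnit_smul_iff (Units.mk0 m⁻¹ (inv_ne_zero hm.ne')) _).1 hunit

variable {E : Type*} [NormedAddCommGroup E] [NormedSpace ℝ E] [FiniteDimensional ℝ E] [T2Space G]
  [ChartedSpace E G] [LieGroup 𝓘(ℝ, E) ∞ G]

/-- Averaging `π` against a bump function at `1` gives an invertible `b`, and `π x * b` is a
convolution of `π` with the bump function. -/
theorem contMDiffAt_one_of_continuous_hom (hπ : Continuous π) :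
    ContMDiffAt 𝓘(ℝ, E) 𝓘(ℝ, 𝔸) ∞ π 1 := by
  borelize G E
  have hnear : ∀ᶠ y in nhds (1 : G), ‖π y - 1‖ ≤ 1 / 2 := by
    filter_upwards [Metric.tendsto_nhds.1 (hπ.tendsto 1) (1 / 2) (by norm_num)] with y hy
    rw [map_one, dist_eq_norm] at hy
    exact hy.le
  obtain ⟨N, hN1, hN, hNc⟩ := local_compact_nhds
    (extChartAt_source_mem_nhds (I := 𝓘(ℝ, E)) (1 : G))
  obtain ⟨V₀, hV₀, h1V₀, hV₀N⟩ := exists_open_nhds_one_mul_subset hN1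
  obtain ⟨V₁, hV₁, hV₁o, h1V₁⟩ := mem_nhds_iff.1 hnear
  have hV : IsOpen (V₀ ∩ V₁) := hV₀.inter hV₁o
  obtain ⟨φ, -, hφ⟩ := (SmoothBumpFunction.nhds_basis_support (I := 𝓘(ℝ, E))
    (hV.mem_nhds ⟨h1V₀, h1V₁⟩)).mem_iff.1 (hV.mem_nhds ⟨h1V₀, h1V₁⟩)
  have hφN : ∀ x ∈ V₀ ∩ V₁, ∀ y, φ (x⁻¹ * y) ≠ 0 → y ∈ N := fun x hx y hy => by
    simpa using hV₀N (Set.mul_mem_mul hx.1 (hφ hy).1)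
  obtain ⟨b, hb⟩ := isUnit_integral_smul hπ φ.continuous (fun _ => φ.nonneg)
    φ.c_mem_support fun y hy => hV₁ (hφ hy).2
  have hconv : ∀ x, ∫ y, φ (x⁻¹ * y) • π y ∂(haarG G) = π x * b := fun x => by
    rw [hb, ← integral_mul_left_eq_self _ x, ← integral_const_mul_of_integrable
      (f := fun y => φ y • π y) (integrable_of_continuous (φ.continuous.smul hπ))]
    simp only [inv_mul_cancel_left, map_mul, mul_smul_comm]
  have hπb : (fun x => (∫ y, φ (x⁻¹ * y) • π y ∂(haarG G)) * ↑b⁻¹) = π := by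
    ext x
    rw [hconv, Units.mul_inv_cancel_right]
  rw [← hπb]
  exact (show ContDiff ℝ ∞ fun a : 𝔸 => a * ↑b⁻¹ by fun_prop).contMDiff.contMDiffAt.comp 1
    (contMDiffAt_one_integral_smul hφN hNc hN φ.contMDiff hV ⟨h1V₀, h1V₁⟩ hπ)

theorem contMDiff_of_continuous_hom (hπ : Continuous π) :
    ContMDiff 𝓘(ℝ, E) 𝓘(ℝ, 𝔸) ∞ π := by
  intro x₀
  have htranslate : (fun x => π x₀ * π (x₀⁻¹ * x)) = π := by
    ext x
    rw [← map_mul, mul_inv_cancel_left]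
  rw [← htranslate]
  refine (show ContDiff ℝ ∞ fun a : 𝔸 => π x₀ * a by fun_prop).contMDiff.contMDiffAt.comp x₀ ?_
  exact ContMDiffAt.comp (I' := 𝓘(ℝ, E)) x₀ (f := fun x => x₀⁻¹ * x)
    (by simpa using contMDiffAt_one_of_continuous_hom hπ)
    (contMDiff_mul_left (a := x₀⁻¹)).contMDiffAt

variable {K : Subgroup G} (ξ : TypeOneRep G K)

open scoped Matrix.Norms.L2Operator in
theorem TypeOneRep.contMDiff_mat_apply (i j : Fin ξ.d) :
    ContMDiff 𝓘(ℝ, E) 𝓘(ℝ, ℂ) ∞ fun x => ξ.mat x i j := by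
  have : CompleteSpace (Matrix (Fin ξ.d) (Fin ξ.d) ℂ) := FiniteDimensional.complete ℂ _
  have hmat : ContMDiff 𝓘(ℝ, E) 𝓘(ℝ, Matrix (Fin ξ.d) (Fin ξ.d) ℂ) ∞ ξ.mat :=
    contMDiff_of_continuous_hom (π := (Matrix.unitaryGroup (Fin ξ.d) ℂ).subtype.comp ξ.hom)
      ξ.continuous_hom
  exact (LinearMap.toContinuousLinearMap
    (Matrix.entryLinearMap ℝ ℂ i j)).contDiff.contMDiff.comp hmat

end Homomorphism

/-! ### The differential of a representation and its Casimir eigenvalue -/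

section OperatorNorm

open scoped Matrix.Norms.L2Operator

theorem norm_le_sqrt_of_sum_star_mul_self_eq {A ι : Type*} [CStarAlgebra A] [PartialOrder A]
    [StarOrderedRing A] {s : Finset ι} {a : ι → A} {l : ℝ} (hl : 0 ≤ l)
    (hsum : ∑ i ∈ s, star (a i) * a i = algebraMap ℝ A l) {i : ι} (hi : i ∈ s) :
    ‖a i‖ ≤ Real.sqrt l := by
  refine Real.le_sqrt_of_sq_le ?_
  rw [sq, ← CStarRing.norm_star_mul_self,
    CStarAlgebra.norm_le_iff_le_algebraMap _ hl (star_mul_self_nonneg _), ← hsum]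
  exact Finset.single_le_sum (f := fun i => star (a i) * a i)
    (fun j _ => star_mul_self_nonneg (a j)) hi

theorem norm_apply_le_l2_opNorm {m n 𝕜 : Type*} [RCLike 𝕜] [Fintype m] [Fintype n] [DecidableEq n]
    (A : Matrix m n 𝕜) (i : m) (j : n) : ‖A i j‖ ≤ ‖A‖ :=
  calc ‖A i j‖ ≤ ‖WithLp.toLp 2 (A *ᵥ (EuclideanSpace.single j (1 : 𝕜)).ofLp)‖ := by
        simpa using PiLp.norm_apply_le (WithLp.toLp 2 (A *ᵥ Pi.single j (1 : 𝕜))) i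
    _ ≤ ‖A‖ := by simpa using Matrix.l2_opNorm_mulVec A (EuclideanSpace.single j (1 : 𝕜))

namespace TypeOneRep

variable {G : Type*} [Group G] [TopologicalSpace G] {K : Subgroup G} (ξ : TypeOneRep G K)

theorem l2_opNorm_mat (x : G) : ‖ξ.mat x‖ = 1 :=
  CStarRing.norm_of_mem_unitary (ξ.hom x).2

theorem norm_mat_mul_apply_le {A : Matrix (Fin ξ.d) (Fin ξ.d) ℂ} (hA : ‖A‖ ≤ 1) (i j : Fin ξ.d)
    (x : G) : ‖(ξ.mat x * A) i j‖ ≤ 1 := by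
  refine (norm_apply_le_l2_opNorm _ i j).trans ((norm_mul_le _ _).trans ?_)
  rwa [ξ.l2_opNorm_mat, one_mul]

theorem l2_opNorm_proj_le : ‖ξ.proj‖ ≤ 1 := by
  rw [proj, Matrix.l2_opNorm_diagonal]
  refine (pi_norm_le_iff_of_nonneg zero_le_one).2 fun i => ?_
  split_ifs <;> simp

end TypeOneRep

end OperatorNorm

theorem sum_mul_self_of_mul_transpose_eq_one {m n R A : Type*} [Fintype m] [Fintype n]
    [DecidableEq m] [CommSemiring R] [Semiring A] [Algebra R A] {M : Matrix m n R}
    (hM : M * Mᵀ = 1) (D : m → A) :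
    ∑ a, (∑ j, M j a • D j) * (∑ j, M j a • D j) = ∑ j, D j * D j := by
  calc ∑ a, (∑ j, M j a • D j) * (∑ k, M k a • D k)
      = ∑ j, ∑ k, ∑ a, (M j a * M k a) • (D j * D k) := by
        simp_rw [Finset.sum_mul_sum, smul_mul_smul_comm]
        rw [Finset.sum_comm]
        exact Finset.sum_congr rfl fun j _ => Finset.sum_comm
    _ = ∑ j, ∑ k, (M * Mᵀ) j k • (D j * D k) := by
        simp_rw [← Finset.sum_smul, Matrix.mul_apply, Matrix.transpose_apply]
    _ = ∑ j, D j * D j := by simp [hM, Matrix.one_apply, ite_smul]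

section AdInvariance

variable {E : Type*} [NormedAddCommGroup E] [NormedSpace ℝ E]
  {G : Type*} [Group G] [TopologicalSpace G] [ChartedSpace E G]
  {n : ℕ} {Y : Module.Basis (Fin n) ℝ (GroupLieAlgebra 𝓘(ℝ, E) G)}

/-- The basis `Y` of the Lie algebra is orthonormal for some `Ad(G)`-invariant inner product. -/
def IsAdOrthonormal (Y : Module.Basis (Fin n) ℝ (GroupLieAlgebra 𝓘(ℝ, E) G)) : Prop :=
  ∃ B : LinearMap.BilinForm ℝ (GroupLieAlgebra 𝓘(ℝ, E) G),
    (∀ (g : G) (X Z : GroupLieAlgebra 𝓘(ℝ, E) G), B (Ad g X) (Ad g Z) = B X Z) ∧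
      ∀ i j, B (Y i) (Y j) = if i = j then 1 else 0

theorem IsAdOrthonormal.exists_mul_transpose_eq_one (hY : IsAdOrthonormal Y) (g : G) :
    ∃ M : Matrix (Fin n) (Fin n) ℝ, M * Mᵀ = 1 ∧ ∀ i, Ad g (Y i) = ∑ j, M j i • Y j := by
  obtain ⟨B, hB, hBY⟩ := hY
  let M : Matrix (Fin n) (Fin n) ℝ := Matrix.of fun j i => Y.repr (Ad g (Y i)) j
  have hAd : ∀ i, Ad g (Y i) = ∑ j, M j i • Y j := fun i => (Y.sum_repr _).symm
  refine ⟨M, mul_eq_one_comm.1 ?_, hAd⟩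
  ext i k
  have hBM := hB g (Y i) (Y k)
  rw [hBY, hAd i, hAd k] at hBM
  simp only [map_sum, LinearMap.sum_apply, map_smul, LinearMap.smul_apply, hBY] at hBM
  rw [Matrix.one_apply, ← hBM, Matrix.mul_apply]
  simp [mul_comm]

end AdInvariance

namespace TypeOneRep

variable {E : Type*} [NormedAddCommGroup E] [NormedSpace ℝ E] [FiniteDimensional ℝ E]
  {G : Type*} [Group G] [TopologicalSpace G] [IsTopologicalGroup G] [CompactSpace G] [T2Space G]
  [ChartedSpace E G] [LieGroup 𝓘(ℝ, E) ∞ G] {K : Subgroup G} (ξ : TypeOneRep G K)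

/-- The differential `X ↦ Xξ(1)` of a representation. -/
def diff : GroupLieAlgebra 𝓘(ℝ, E) G →ₗ[ℝ] Matrix (Fin ξ.d) (Fin ξ.d) ℂ where
  toFun X := Matrix.of fun i j => lieDeriv X (fun x => ξ.mat x i j) 1
  map_add' X Z := by
    ext i j
    simp [lieDeriv_eq_fderiv (ξ.contMDiff_mat_apply i j)]
  map_smul' a X := by
    ext i j
    simp [lieDeriv_eq_fderiv (ξ.contMDiff_mat_apply i j)]

theorem contMDiff_mat_mul_apply (A : Matrix (Fin ξ.d) (Fin ξ.d) ℂ) (i j : Fin ξ.d) :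
    ContMDiff 𝓘(ℝ, E) 𝓘(ℝ, ℂ) ∞ fun x => (ξ.mat x * A) i j := by
  simp_rw [Matrix.mul_apply, mul_comm _ (A _ _)]
  exact contMDiff_sum_const_mul _ _ fun a => ξ.contMDiff_mat_apply i a

theorem contMDiff_mul_mat_apply (A : Matrix (Fin ξ.d) (Fin ξ.d) ℂ) (i j : Fin ξ.d) :
    ContMDiff 𝓘(ℝ, E) 𝓘(ℝ, ℂ) ∞ fun x => (A * ξ.mat x) i j := by
  simp_rw [Matrix.mul_apply]
  exact contMDiff_sum_const_mul _ _ fun a => ξ.contMDiff_mat_apply a j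

theorem lieDeriv_mul_mat_apply (A : Matrix (Fin ξ.d) (Fin ξ.d) ℂ)
    (X : GroupLieAlgebra 𝓘(ℝ, E) G) (i j : Fin ξ.d) :
    lieDeriv X (fun x => (A * ξ.mat x) i j) 1 = (A * ξ.diff X) i j := by
  simp_rw [Matrix.mul_apply]
  exact lieDeriv_sum_const_mul _ _ (fun a => ξ.contMDiff_mat_apply a j) X 1

theorem lieDeriv_mat_apply (X : GroupLieAlgebra 𝓘(ℝ, E) G) (g : G) (i j : Fin ξ.d) :
    lieDeriv X (fun x => ξ.mat x i j) g = (ξ.mat g * ξ.diff X) i j := by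
  rw [lieDeriv_translate (ξ.contMDiff_mat_apply i j), ← lieDeriv_mul_mat_apply]
  simp_rw [mat_mul]

theorem lieDeriv_mat_mul_apply (A : Matrix (Fin ξ.d) (Fin ξ.d) ℂ)
    (X : GroupLieAlgebra 𝓘(ℝ, E) G) (i j : Fin ξ.d) :
    lieDeriv X (fun x => (ξ.mat x * A) i j) = fun x => (ξ.mat x * (ξ.diff X * A)) i j := by
  ext g
  rw [← Matrix.mul_assoc, Matrix.mul_apply]
  simp_rw [Matrix.mul_apply (M := ξ.mat _) (N := A), mul_comm _ (A _ _)]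
  rw [lieDeriv_sum_const_mul _ _ fun a => ξ.contMDiff_mat_apply i a]
  simp_rw [lieDeriv_mat_apply]

theorem conjTranspose_diff (X : GroupLieAlgebra 𝓘(ℝ, E) G) : (ξ.diff X)ᴴ = -ξ.diff X := by
  rw [eq_neg_iff_add_eq_zero]
  ext i j
  have hunitary : (fun x => ∑ a, (1 : ℂ) * (ξ.mat x i a * star (ξ.mat x j a))) =
      fun _ : G => (1 : Matrix (Fin ξ.d) (Fin ξ.d) ℂ) i j := by
    ext x
    simp [← ξ.mat_mul_conjTranspose x, Matrix.mul_apply]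
  have hderiv := lieDeriv_sum_const_mul Finset.univ (fun _ => (1 : ℂ))
    (fun a => contMDiff_mul_complex (ξ.contMDiff_mat_apply i a)
      (contMDiff_star_complex (ξ.contMDiff_mat_apply j a))) X 1
  rw [hunitary, lieDeriv_const] at hderiv
  simp_rw [lieDeriv_mul (ξ.contMDiff_mat_apply i _)
    (contMDiff_star_complex (ξ.contMDiff_mat_apply j _)),
    lieDeriv_star (ξ.contMDiff_mat_apply j _), mat_one, Matrix.one_apply] at hderiv
  simpa [Finset.sum_add_distrib, diff] using hderiv.symm

theorem diff_Ad (g : G) (X : GroupLieAlgebra 𝓘(ℝ, E) G) :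
    ξ.diff (Ad g X) = ξ.mat g * ξ.diff X * (ξ.mat g)ᴴ := by
  ext i j
  have hconj : (fun x => ξ.mat (g * x * g⁻¹) i j) =
      fun x => ∑ b, star (ξ.mat g j b) * (ξ.mat g * ξ.mat x) i b := by
    ext x
    rw [mat_mul, mat_mul, mat_inv, Matrix.mul_apply]
    exact Finset.sum_congr rfl fun b _ => by rw [Matrix.conjTranspose_apply, mul_comm]
  calc ξ.diff (Ad g X) i j
      = lieDeriv X (fun x => ξ.mat (g * x * g⁻¹) i j) 1 :=
        lieDeriv_Ad (ξ.contMDiff_mat_apply i j) X g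
    _ = ∑ b, star (ξ.mat g j b) * (ξ.mat g * ξ.diff X) i b := by
        rw [hconj, lieDeriv_sum_const_mul _ _ fun b => ξ.contMDiff_mul_mat_apply _ i b]
        simp_rw [lieDeriv_mul_mat_apply]
    _ = (ξ.mat g * ξ.diff X * (ξ.mat g)ᴴ) i j := by
        rw [Matrix.mul_apply]
        exact Finset.sum_congr rfl fun b _ => by rw [Matrix.conjTranspose_apply, mul_comm]

variable {n : ℕ} (Y : Module.Basis (Fin n) ℝ (GroupLieAlgebra 𝓘(ℝ, E) G))

theorem iterLieDeriv_mat_mul_apply (w : List (Fin n)) (A : Matrix (Fin ξ.d) (Fin ξ.d) ℂ)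
    (i j : Fin ξ.d) :
    iterLieDeriv Y w (fun x => (ξ.mat x * A) i j) =
      fun x => (ξ.mat x * ((w.map fun a => ξ.diff (Y a)).prod * A)) i j := by
  induction w with
  | nil => simp [iterLieDeriv]
  | cons a w ih =>
    change lieDeriv (Y a) (iterLieDeriv Y w _) = _
    rw [ih, lieDeriv_mat_mul_apply, List.map_cons, List.prod_cons, Matrix.mul_assoc (ξ.diff (Y a))]

/-- The image `∑ (dξ(Y_a))²` of the Casimir element in the representation. -/
def casimir : Matrix (Fin ξ.d) (Fin ξ.d) ℂ := ∑ a, ξ.diff (Y a) * ξ.diff (Y a)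

theorem laplacian_mat_mul_apply (A : Matrix (Fin ξ.d) (Fin ξ.d) ℂ) (i j : Fin ξ.d) (x : G) :
    laplacian Y (fun y => (ξ.mat y * A) i j) x = (ξ.mat x * (ξ.casimir Y * A)) i j := by
  simp_rw [laplacian, lieDeriv_mat_mul_apply, ← Matrix.mul_assoc (ξ.diff _)]
  rw [← Matrix.sum_apply, ← Matrix.mul_sum, ← Matrix.sum_mul, casimir]

variable {Y} (hY : IsAdOrthonormal Y)

include hY in
theorem casimir_commute (g : G) : ξ.casimir Y * ξ.mat g = ξ.mat g * ξ.casimir Y := by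
  obtain ⟨M, hM, hAd⟩ := hY.exists_mul_transpose_eq_one g
  have hinvariant : ξ.casimir Y = ξ.mat g * ξ.casimir Y * (ξ.mat g)ᴴ :=
    calc ξ.casimir Y = ∑ a, ξ.diff (Ad g (Y a)) * ξ.diff (Ad g (Y a)) := by
          simp_rw [hAd, map_sum, map_smul]
          exact (sum_mul_self_of_mul_transpose_eq_one hM _).symm
      _ = ∑ a, ξ.mat g * (ξ.diff (Y a) * ξ.diff (Y a)) * (ξ.mat g)ᴴ := by
          refine Finset.sum_congr rfl fun a _ => ?_
          rw [diff_Ad]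
          simp only [Matrix.mul_assoc]
          rw [← Matrix.mul_assoc (ξ.mat g)ᴴ, conjTranspose_mul_mat, Matrix.one_mul]
      _ = ξ.mat g * ξ.casimir Y * (ξ.mat g)ᴴ := by
          rw [← Matrix.sum_mul, ← Matrix.mul_sum, casimir]
  conv_lhs => rw [hinvariant]
  rw [Matrix.mul_assoc, conjTranspose_mul_mat, Matrix.mul_one]

theorem neg_casimir_eq_sum : -ξ.casimir Y = ∑ a, (ξ.diff (Y a))ᴴ * ξ.diff (Y a) := by
  simp_rw [casimir, conjTranspose_diff, Matrix.neg_mul, Finset.sum_neg_distrib]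

open scoped ComplexOrder in
include hY in
theorem exists_casimir_eq :
    ∃ l : ℝ, 0 ≤ l ∧ ξ.casimir Y = -((l : ℂ) • (1 : Matrix (Fin ξ.d) (Fin ξ.d) ℂ)) := by
  obtain ⟨c, hc⟩ := ξ.exists_eq_smul_one_of_commute (ξ.casimir_commute hY)
  have hpos : (-ξ.casimir Y).PosSemidef := by
    rw [neg_casimir_eq_sum]
    exact Matrix.posSemidef_sum _ fun a _ => Matrix.posSemidef_conjTranspose_mul_self _
  obtain ⟨i⟩ : Nonempty (Fin ξ.d) := inferInstance
  obtain ⟨l, hl, hlc⟩ : ∃ l : ℝ, 0 ≤ l ∧ (l : ℂ) = -c := by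
    have hdiag : 0 ≤ -c := by simpa [hc] using hpos.diag_nonneg (i := i)
    exact ⟨(-c).re, (Complex.le_def.1 hdiag).1, (Complex.eq_re_of_ofReal_le hdiag).symm⟩
  exact ⟨l, hl, by rw [hc, hlc, neg_smul, neg_neg]⟩

include hY in
theorem eigenvalue_nonneg_and_casimir_eq : 0 ≤ eigenvalue Y ξ ∧
    ξ.casimir Y = -((eigenvalue Y ξ : ℂ) • (1 : Matrix (Fin ξ.d) (Fin ξ.d) ℂ)) := by
  obtain ⟨l, hl, hcas⟩ := ξ.exists_casimir_eq hY
  have hlap : ∀ (i j : Fin ξ.d) (x : G),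
      -laplacian Y (fun y => ξ.mat y i j) x = (l : ℂ) * ξ.mat x i j := fun i j x => by
    simpa [hcas] using congrArg Neg.neg (ξ.laplacian_mat_mul_apply Y 1 i j x)
  have hspec : ∀ (i j : Fin ξ.d) (x : G),
      -laplacian Y (fun y => ξ.mat y i j) x = (eigenvalue Y ξ : ℂ) * ξ.mat x i j :=
    Classical.epsilon_spec (p := fun l : ℝ => ∀ (i j : Fin ξ.d) (x : G),
      -laplacian Y (fun y => ξ.mat y i j) x = (l : ℂ) * ξ.mat x i j) ⟨l, hlap⟩
  obtain ⟨i⟩ : Nonempty (Fin ξ.d) := inferInstance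
  have heq : eigenvalue Y ξ = l := by
    have hone := (hspec i i 1).symm.trans (hlap i i 1)
    rw [mat_one, Matrix.one_apply_eq, mul_one, mul_one] at hone
    exact_mod_cast hone
  exact ⟨heq ▸ hl, heq ▸ hcas⟩

include hY in
theorem eigenvalue_nonneg : 0 ≤ eigenvalue Y ξ := (ξ.eigenvalue_nonneg_and_casimir_eq hY).1

include hY in
theorem casimir_eq :
    ξ.casimir Y = -((eigenvalue Y ξ : ℂ) • (1 : Matrix (Fin ξ.d) (Fin ξ.d) ℂ)) :=
  (ξ.eigenvalue_nonneg_and_casimir_eq hY).2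

include hY in
theorem neg_laplacian_mat_mul_apply (A : Matrix (Fin ξ.d) (Fin ξ.d) ℂ) (i j : Fin ξ.d) (x : G) :
    -laplacian Y (fun y => (ξ.mat y * A) i j) x = (eigenvalue Y ξ : ℂ) * (ξ.mat x * A) i j := by
  simp [laplacian_mat_mul_apply, ξ.casimir_eq hY]

open scoped Matrix.Norms.L2Operator MatrixOrder

include hY in
theorem l2_opNorm_diff_basis_le (a : Fin n) : ‖ξ.diff (Y a)‖ ≤ Real.sqrt (eigenvalue Y ξ) := by
  refine norm_le_sqrt_of_sum_star_mul_self_eq (s := Finset.univ) (a := fun a => ξ.diff (Y a))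
    (ξ.eigenvalue_nonneg hY) ?_ (Finset.mem_univ a)
  simp_rw [Matrix.star_eq_conjTranspose]
  rw [← neg_casimir_eq_sum, ξ.casimir_eq hY, neg_neg, Algebra.algebraMap_eq_smul_one]
  rfl

include hY in
theorem norm_iterLieDeriv_mat_mul_apply_le (w : List (Fin n))
    {A : Matrix (Fin ξ.d) (Fin ξ.d) ℂ} (hA : ‖A‖ ≤ 1) (i j : Fin ξ.d) (x : G) :
    ‖iterLieDeriv Y w (fun x => (ξ.mat x * A) i j) x‖ ≤
      Real.sqrt (1 + eigenvalue Y ξ) ^ w.length := by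
  have hprod : ‖(w.map fun a => ξ.diff (Y a)).prod‖ ≤
      Real.sqrt (1 + eigenvalue Y ξ) ^ w.length := by
    induction w with
    | nil => simp
    | cons a w ih =>
      rw [List.map_cons, List.prod_cons, List.length_cons, pow_succ']
      refine (norm_mul_le _ _).trans (mul_le_mul ?_ ih (norm_nonneg _) (Real.sqrt_nonneg _))
      exact (ξ.l2_opNorm_diff_basis_le hY a).trans (Real.sqrt_le_sqrt (by linarith))
  rw [iterLieDeriv_mat_mul_apply]
  refine (norm_apply_le_l2_opNorm _ i j).trans ((norm_mul_le _ _).trans ?_)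
  rw [l2_opNorm_mat, one_mul]
  exact (norm_mul_le _ _).trans ((mul_le_of_le_one_right (norm_nonneg _) hA).trans hprod)

end TypeOneRep

/-! ### Counting representations -/

section Chart

variable {E : Type*} [NormedAddCommGroup E] [NormedSpace ℝ E]
  {G : Type*} [Group G] [TopologicalSpace G] [ChartedSpace E G] [LieGroup 𝓘(ℝ, E) ∞ G]

/-- The quotient `x⁻¹ y` in the chart at the identity, as a function of the coordinates of `x` and
`y`. -/
def chartInvMul (G : Type*) [Group G] [TopologicalSpace G] [ChartedSpace E G] (e z : E) : E :=
  extChartAt 𝓘(ℝ, E) (1 : G)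
    (((extChartAt 𝓘(ℝ, E) (1 : G)).symm e)⁻¹ * (extChartAt 𝓘(ℝ, E) (1 : G)).symm z)

variable (E G) in
theorem contDiffAt_chartInvMul : ContDiffAt ℝ ∞ (fun q : E × E => chartInvMul G q.1 q.2)
    (extChartAt 𝓘(ℝ, E) (1 : G) 1, extChartAt 𝓘(ℝ, E) (1 : G) 1) := by
  rw [← contMDiffAt_iff_contDiffAt]
  set c := extChartAt 𝓘(ℝ, E) (1 : G)
  have hsymm : ContMDiffAt 𝓘(ℝ, E) 𝓘(ℝ, E) ∞ c.symm (c 1) :=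
    contMDiffAt_extChartAt_one_symm (mem_extChartAt_target (1 : G))
  have hfst : ContMDiffAt 𝓘(ℝ, E × E) 𝓘(ℝ, E) ∞ (fun q : E × E => c.symm q.1) (c 1, c 1) :=
    ContMDiffAt.comp (I' := 𝓘(ℝ, E)) (c 1, c 1) (f := fun q : E × E => q.1)
      hsymm contDiff_fst.contMDiff.contMDiffAt
  have hsnd : ContMDiffAt 𝓘(ℝ, E × E) 𝓘(ℝ, E) ∞ (fun q : E × E => c.symm q.2) (c 1, c 1) :=
    ContMDiffAt.comp (I' := 𝓘(ℝ, E)) (c 1, c 1) (f := fun q : E × E => q.2)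
      hsymm contDiff_snd.contMDiff.contMDiffAt
  refine ContMDiffAt.comp (I' := 𝓘(ℝ, E)) (c 1, c 1) (g := c) ?_ (hfst.inv.mul hsnd)
  rw [inv_mul_cancel]
  exact contMDiffAt_extChartAt

variable (E G) in
theorem exists_eventually_norm_fderiv_chartInvMul_le :
    ∃ C : ℝ, 0 ≤ C ∧ ∀ᶠ e in nhds (extChartAt 𝓘(ℝ, E) (1 : G) 1),
      DifferentiableAt ℝ (chartInvMul G e) e ∧ ‖fderiv ℝ (chartInvMul G e) e‖ ≤ C := by
  have hsmooth := contDiffAt_chartInvMul E G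
  set c := extChartAt 𝓘(ℝ, E) (1 : G)
  set Φ : E × E → E := fun q => chartInvMul G q.1 q.2
  have hdiff : ∀ᶠ q in nhds (c 1, c 1), DifferentiableAt ℝ Φ q :=
    ((hsmooth.of_le (m := 1) (by simp)).eventually (by simp)).mono
      fun q hq => hq.differentiableAt one_ne_zero
  have hbound : ∀ᶠ q in nhds (c 1, c 1), ‖fderiv ℝ Φ q‖ < ‖fderiv ℝ Φ (c 1, c 1)‖ + 1 :=
    (hsmooth.fderiv_right (m := 0) (by simp)).continuousAt.norm.eventually_lt continuousAt_const
      (lt_add_one _)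
  refine ⟨‖fderiv ℝ Φ (c 1, c 1)‖ + 1, by positivity, ?_⟩
  have hdiag : Filter.Tendsto (fun e : E => (e, e)) (nhds (c 1)) (nhds (c 1, c 1)) :=
    (continuous_id.prodMk continuous_id).tendsto _
  filter_upwards [hdiag.eventually hdiff, hdiag.eventually hbound] with e he hbe
  have hderiv : HasFDerivAt (chartInvMul G e) ((fderiv ℝ Φ (e, e)).comp (.inr ℝ E E)) e :=
    he.hasFDerivAt.comp e (hasFDerivAt_prodMk_right e e)
  refine ⟨hderiv.differentiableAt, ?_⟩
  rw [hderiv.fderiv]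
  calc ‖(fderiv ℝ Φ (e, e)).comp (.inr ℝ E E)‖
      ≤ ‖fderiv ℝ Φ (e, e)‖ * ‖ContinuousLinearMap.inr ℝ E E‖ :=
        ContinuousLinearMap.opNorm_comp_le _ _
    _ ≤ ‖fderiv ℝ Φ (e, e)‖ :=
        mul_le_of_le_one_right (norm_nonneg _) (ContinuousLinearMap.norm_inr_le_one ℝ E E)
    _ ≤ _ := hbe.le

theorem norm_fderiv_comp_chart_symm_le {f : G → ℂ} (hf : ContMDiff 𝓘(ℝ, E) 𝓘(ℝ, ℂ) ∞ f)
    {M : ℝ} (hM : 0 ≤ M) (hbound : ∀ (X : GroupLieAlgebra 𝓘(ℝ, E) G) (g : G),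
      ‖lieDeriv X f g‖ ≤ M * ‖toModel X‖)
    {e : E} (he : e ∈ (extChartAt 𝓘(ℝ, E) (1 : G)).target)
    (hdiff : DifferentiableAt ℝ (chartInvMul G e) e) :
    ‖fderiv ℝ (fun z => f ((extChartAt 𝓘(ℝ, E) (1 : G)).symm z)) e‖ ≤
      M * ‖fderiv ℝ (chartInvMul G e) e‖ := by
  set c := extChartAt 𝓘(ℝ, E) (1 : G) with hc
  have hone : chartInvMul G e e = c 1 := congrArg c (inv_mul_cancel _)
  have hlocal : (fun z => f (c.symm z)) =ᶠ[nhds e]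
      fun z => localForm f (c.symm e) (chartInvMul G e z) := by
    have hsource : ∀ᶠ z in nhds e, (c.symm e)⁻¹ * c.symm z ∈ c.source := by
      have hcont : ContinuousAt c.symm e := (contMDiffAt_extChartAt_one_symm he).continuousAt
      have hmul := (contMDiff_mul_left (I := 𝓘(ℝ, E)) (n := ∞) (a := (c.symm e)⁻¹)).continuous
      refine (hmul.continuousAt.comp hcont).preimage_mem_nhds ?_
      rw [Function.comp_apply, inv_mul_cancel]
      exact extChartAt_source_mem_nhds (1 : G)
    filter_upwards [hsource] with z hz
    rw [localForm, chartInvMul, ← hc, c.left_inv hz, mul_inv_cancel_left]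
  have hderiv : HasFDerivAt (localForm f (c.symm e)) (fderiv ℝ (localForm f (c.symm e)) (c 1))
      (chartInvMul G e e) := by
    rw [hone]
    exact (differentiableAt_localForm hf _).hasFDerivAt
  have hcomp : HasFDerivAt (fun z => localForm f (c.symm e) (chartInvMul G e z)) _ e :=
    hderiv.comp e hdiff.hasFDerivAt
  rw [hlocal.fderiv_eq, hcomp.fderiv]
  refine (ContinuousLinearMap.opNorm_comp_le _ _).trans ?_
  refine mul_le_mul_of_nonneg_right ?_ (norm_nonneg _)
  refine ContinuousLinearMap.opNorm_le_bound _ hM fun v => ?_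
  have hv := hbound (toModel.symm v) (c.symm e)
  rwa [lieDeriv_eq_fderiv hf, LinearEquiv.apply_symm_apply] at hv

variable (E G) in
theorem exists_norm_sub_le_of_norm_lieDeriv_le : ∃ C ρ : ℝ, 0 ≤ C ∧ 0 < ρ ∧
    ∀ {f : G → ℂ} {M : ℝ}, ContMDiff 𝓘(ℝ, E) 𝓘(ℝ, ℂ) ∞ f → 0 ≤ M →
      (∀ (X : GroupLieAlgebra 𝓘(ℝ, E) G) (g : G), ‖lieDeriv X f g‖ ≤ M * ‖toModel X‖) →
      ∀ e ∈ Metric.ball (extChartAt 𝓘(ℝ, E) (1 : G) 1) ρ,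
      ∀ e' ∈ Metric.ball (extChartAt 𝓘(ℝ, E) (1 : G) 1) ρ,
        ‖f ((extChartAt 𝓘(ℝ, E) (1 : G)).symm e') - f ((extChartAt 𝓘(ℝ, E) (1 : G)).symm e)‖ ≤
          M * C * ‖e' - e‖ := by
  obtain ⟨C, hC, hCe⟩ := exists_eventually_norm_fderiv_chartInvMul_le E G
  obtain ⟨ρ, hρ, hball⟩ := Metric.eventually_nhds_iff_ball.1 (hCe.and
    ((isOpen_extChartAt_target (I := 𝓘(ℝ, E)) (1 : G)).mem_nhds (mem_extChartAt_target (1 : G))))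
  refine ⟨C, ρ, hC, hρ, fun {f M} hf hM hbound e he e' he' => ?_⟩
  refine (convex_ball _ ρ).norm_image_sub_le_of_norm_fderiv_le (𝕜 := ℝ)
    (f := fun z => f ((extChartAt 𝓘(ℝ, E) (1 : G)).symm z)) (fun z hz => ?_) (fun z hz => ?_) he he'
  · exact (contMDiffAt_iff_contDiffAt.1 (hf.contMDiffAt.comp z
      (contMDiffAt_extChartAt_one_symm (hball z hz).2))).differentiableAt (by simp)
  · exact (norm_fderiv_comp_chart_symm_le hf hM hbound (hball z hz).2 (hball z hz).1.1).trans
      (mul_le_mul_of_nonneg_left (hball z hz).1.2 hM)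

end Chart

section Grid

theorem norm_sub_le_of_floor_div_eq {ι : Type*} [Fintype ι] {v w : ι → ℝ} {δ : ℝ} (hδ : 0 < δ)
    (h : ∀ j, ⌊v j / δ⌋ = ⌊w j / δ⌋) : ‖v - w‖ ≤ δ := by
  refine (pi_norm_le_iff_of_nonneg hδ.le).2 fun j => ?_
  have hlt := Int.abs_sub_lt_one_of_floor_eq_floor (h j)
  rw [← sub_div, abs_div, abs_of_pos hδ, div_lt_one hδ] at hlt
  exact hlt.le

theorem exists_finset_floor_div_mem (ι : Type*) [Fintype ι] {R δ : ℝ} (hR : 0 ≤ R) (hδ : 0 < δ) :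
    ∃ T : Finset (ι → ℤ), (∀ v : ι → ℝ, ‖v‖ ≤ R → (fun j => ⌊v j / δ⌋) ∈ T) ∧
      (T.card : ℝ) ≤ (2 * (R / δ) + 3) ^ Fintype.card ι := by
  classical
  have hceil : (⌈R / δ⌉₊ : ℝ) ≤ R / δ + 1 := (Nat.ceil_lt_add_one (by positivity)).le
  refine ⟨Fintype.piFinset fun _ => Finset.Icc (-(⌈R / δ⌉₊ : ℤ)) ⌈R / δ⌉₊, fun v hv => ?_, ?_⟩
  · refine Fintype.mem_piFinset.2 fun j => Finset.mem_Icc.2 ?_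
    have hvj : |v j / δ| ≤ ⌈R / δ⌉₊ := by
      rw [abs_div, abs_of_pos hδ]
      exact le_trans (by gcongr; exact (norm_le_pi_norm v j).trans hv) (Nat.le_ceil _)
    constructor
    · rw [Int.le_floor]
      push_cast
      exact (abs_le.1 hvj).1
    · exact_mod_cast (Int.floor_le _).trans (abs_le.1 hvj).2
  · rw [Fintype.card_piFinset, Finset.prod_const, Finset.card_univ, Int.card_Icc]
    have hcard : ((⌈R / δ⌉₊ : ℤ) + 1 - -(⌈R / δ⌉₊ : ℤ)).toNat = 2 * ⌈R / δ⌉₊ + 1 := by omega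
    rw [hcard]
    push_cast
    refine pow_le_pow_left₀ (by positivity) ?_ _
    linarith

theorem one_le_card_mul_haarG {G ι : Type*} [Group G] [TopologicalSpace G] [IsTopologicalGroup G]
    [CompactSpace G] [MeasurableSpace G] [BorelSpace G] {T : Finset ι} {label : G → ι}
    (hT : ∀ x, label x ∈ T) {U : Set G} (hU : ∀ x y, label x = label y → x⁻¹ * y ∈ U) :
    1 ≤ T.card * (haarG G).real U := by
  have hcell : ∀ i, (haarG G).real (label ⁻¹' {i}) ≤ (haarG G).real U := fun i => by
    rcases (label ⁻¹' {i}).eq_empty_or_nonempty with h | ⟨x, hx⟩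
    · simp [h]
    · calc (haarG G).real (label ⁻¹' {i}) ≤ (haarG G).real ((fun y => x⁻¹ * y) ⁻¹' U) :=
            measureReal_mono (fun y hy => hU x y (hx.trans hy.symm)) (measure_ne_top (haarG G) _)
        _ = (haarG G).real U := by simp only [measureReal_def, measure_preimage_mul]
  calc (1 : ℝ) = (haarG G).real Set.univ := by simp
    _ ≤ (haarG G).real (⋃ i ∈ T, label ⁻¹' {i}) :=
        measureReal_mono (fun x _ => by simpa using hT x) (measure_ne_top (haarG G) _)
    _ ≤ ∑ i ∈ T, (haarG G).real (label ⁻¹' {i}) := measureReal_biUnion_finset_le _ _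
    _ ≤ ∑ _i ∈ T, (haarG G).real U := Finset.sum_le_sum fun i _ => hcell i
    _ = T.card * (haarG G).real U := by simp

end Grid

section SlowVariation

variable {E : Type*} [NormedAddCommGroup E] [NormedSpace ℝ E] [FiniteDimensional ℝ E]
  {G : Type*} [Group G] [TopologicalSpace G] [IsTopologicalGroup G] [CompactSpace G] [T2Space G]
  [ChartedSpace E G] [LieGroup 𝓘(ℝ, E) ∞ G] {K : Subgroup G}
  {n : ℕ} {Y : Module.Basis (Fin n) ℝ (GroupLieAlgebra 𝓘(ℝ, E) G)} (hY : IsAdOrthonormal Y)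

open scoped Matrix.Norms.L2Operator

include hY in
theorem TypeOneRep.l2_opNorm_diff_le (ξ : TypeOneRep G K) (X : GroupLieAlgebra 𝓘(ℝ, E) G) :
    ‖ξ.diff X‖ ≤ n * ‖(Y.map toModel).equivFunL.toContinuousLinearMap‖ *
      Real.sqrt (eigenvalue Y ξ) * ‖toModel X‖ := by
  have hop := (Y.map toModel).opNorm_le
    (u := (ξ.diff ∘ₗ toModel.symm.toLinearMap).toContinuousLinearMap)
    (Real.sqrt_nonneg (eigenvalue Y ξ)) fun a => by
      simpa using ξ.l2_opNorm_diff_basis_le hY a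
  have hX := (ξ.diff ∘ₗ toModel.symm.toLinearMap).toContinuousLinearMap.le_of_opNorm_le hop
    (toModel X)
  simpa using hX

include hY in
theorem TypeOneRep.norm_lieDeriv_mat_mul_left_apply_le (ξ : TypeOneRep G K) (x : G)
    (i j : Fin ξ.d) (X : GroupLieAlgebra 𝓘(ℝ, E) G) (g : G) :
    ‖lieDeriv X (fun y => ξ.mat (x * y) i j) g‖ ≤
      n * ‖(Y.map toModel).equivFunL.toContinuousLinearMap‖ * Real.sqrt (eigenvalue Y ξ) *
        ‖toModel X‖ := by
  rw [lieDeriv_translate (contMDiff_comp_mul_left (ξ.contMDiff_mat_apply i j) x)]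
  simp_rw [← mul_assoc]
  rw [← lieDeriv_translate (ξ.contMDiff_mat_apply i j), lieDeriv_mat_apply]
  refine (norm_apply_le_l2_opNorm _ i j).trans ((norm_mul_le _ _).trans ?_)
  rw [l2_opNorm_mat, one_mul]
  exact ξ.l2_opNorm_diff_le hY X

include hY in
theorem exists_norm_mat_inv_mul_sub_one_le : ∃ C ρ : ℝ, 0 ≤ C ∧ 0 < ρ ∧
    ∀ {K : Subgroup G} (ξ : TypeOneRep G K) (i : Fin ξ.d),
    ∀ e ∈ Metric.ball (extChartAt 𝓘(ℝ, E) (1 : G) 1) ρ,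
    ∀ e' ∈ Metric.ball (extChartAt 𝓘(ℝ, E) (1 : G) 1) ρ,
      ‖ξ.mat (((extChartAt 𝓘(ℝ, E) (1 : G)).symm e)⁻¹ *
        (extChartAt 𝓘(ℝ, E) (1 : G)).symm e') i i - 1‖ ≤
        C * Real.sqrt (eigenvalue Y ξ) * ‖e' - e‖ := by
  obtain ⟨C, ρ, hC, hρ, hlip⟩ := exists_norm_sub_le_of_norm_lieDeriv_le E G
  refine ⟨n * ‖(Y.map toModel).equivFunL.toContinuousLinearMap‖ * C, ρ, by positivity, hρ,
    fun ξ i e he e' he' => ?_⟩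
  set x := (extChartAt 𝓘(ℝ, E) (1 : G)).symm e
  have hdiff := hlip (contMDiff_comp_mul_left (ξ.contMDiff_mat_apply i i) x⁻¹) (by positivity)
    (ξ.norm_lieDeriv_mat_mul_left_apply_le hY x⁻¹ i i) e he e' he'
  rw [inv_mul_cancel, ξ.mat_one, Matrix.one_apply_eq] at hdiff
  exact hdiff.trans_eq (by ring)

variable (Y K) in
/-- The elements of `G` at which all representations with eigenvalue at most `l` have diagonal
entries close to `1`. -/
def nearIdentity (l : ℝ) : Set G :=
  {y | ∀ ξ : TypeOneRep G K, eigenvalue Y ξ ≤ l → ∀ i, ‖ξ.mat y i i - 1‖ ≤ 1 / 2}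

omit [FiniteDimensional ℝ E] [IsTopologicalGroup G] [CompactSpace G] [T2Space G]
  [LieGroup 𝓘(ℝ, E) ∞ G] in
theorem isClosed_nearIdentity (l : ℝ) : IsClosed (nearIdentity K Y l) := by
  simp only [nearIdentity, Set.ofPred_forall]
  exact isClosed_iInter fun ξ => isClosed_iInter fun _ => isClosed_iInter fun i =>
    isClosed_le ((ξ.continuous_mat_apply i i).sub continuous_const).norm continuous_const

include hY in
variable (K) in
theorem exists_inv_mul_mem_nearIdentity : ∃ (V : Set G) (C : ℝ), V ∈ nhds 1 ∧ 0 ≤ C ∧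
    ∃ φ : G → Fin n → ℝ, (∃ R, 0 < R ∧ ∀ x ∈ V, ‖φ x‖ ≤ R) ∧
      ∀ l, 0 ≤ l → ∀ x ∈ V, ∀ y ∈ V, C * (1 + l) * ‖φ y - φ x‖ ≤ 1 / 2 →
        x⁻¹ * y ∈ nearIdentity K Y l := by
  obtain ⟨C, ρ, hC, hρ, hmat⟩ := exists_norm_mat_inv_mul_sub_one_le hY
  set c := extChartAt 𝓘(ℝ, E) (1 : G)
  set A : E ≃L[ℝ] (Fin n → ℝ) := (Y.map toModel).equivFunL
  refine ⟨c.source ∩ c ⁻¹' Metric.ball (c 1) ρ, C * ‖A.symm.toContinuousLinearMap‖,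
    Filter.inter_mem (extChartAt_source_mem_nhds (1 : G))
      ((continuousAt_extChartAt (1 : G)).preimage_mem_nhds (Metric.ball_mem_nhds _ hρ)),
    by positivity, fun x => A (c x), ?_, fun l hl x hx y hy hxy ξ hξ i => ?_⟩
  · obtain ⟨R, hR, hball⟩ := (A.lipschitz.isBounded_image
      (Metric.isBounded_ball (x := c 1) (r := ρ))).exists_pos_norm_le
    exact ⟨R, hR, fun x hx => hball _ (Set.mem_image_of_mem A hx.2)⟩
  · have hnorm : ‖c y - c x‖ ≤ ‖A.symm.toContinuousLinearMap‖ * ‖A (c y) - A (c x)‖ := by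
      simpa using A.symm.toContinuousLinearMap.le_opNorm (A (c y) - A (c x))
    have hsqrt : Real.sqrt (eigenvalue Y ξ) ≤ 1 + l :=
      Real.sqrt_le_iff.2 ⟨by positivity, by nlinarith⟩
    have hle := hmat ξ i (c x) hx.2 (c y) hy.2
    rw [c.left_inv hx.1, c.left_inv hy.1] at hle
    calc ‖ξ.mat (x⁻¹ * y) i i - 1‖
        ≤ C * (1 + l) * (‖A.symm.toContinuousLinearMap‖ * ‖A (c y) - A (c x)‖) :=
          hle.trans (by gcongr)
      _ = C * ‖A.symm.toContinuousLinearMap‖ * (1 + l) * ‖A (c y) - A (c x)‖ := by ring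
      _ ≤ 1 / 2 := hxy

variable [MeasurableSpace G] [BorelSpace G]

include hY in
variable (K) in
theorem exists_one_le_mul_haarG_nearIdentity : ∃ C : ℝ, 0 < C ∧ ∀ l : ℝ, 0 ≤ l →
    1 ≤ C * (1 + l) ^ n * (haarG G).real (nearIdentity K Y l) := by
  obtain ⟨V, C, hV, hC, φ, ⟨R, hR, hφ⟩, hnear⟩ := exists_inv_mul_mem_nearIdentity K hY
  obtain ⟨t, ht⟩ := compact_covered_by_mul_left_translates isCompact_univ
    ⟨1, mem_interior_iff_mem_nhds.2 hV⟩
  have hcover : ∀ x, ∃ g ∈ t, g * x ∈ V := fun x => by simpa using ht (Set.mem_univ x)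
  choose a hat haV using hcover
  refine ⟨(t.card + 1) * (4 * (R * (C + 1)) + 3) ^ n, by positivity, fun l hl => ?_⟩
  set δ : ℝ := 1 / (2 * (C + 1) * (1 + l)) with hδ
  have hδpos : 0 < δ := by positivity
  obtain ⟨T, hT, hcard⟩ := exists_finset_floor_div_mem (Fin n) hR.le hδpos
  rw [Fintype.card_fin] at hcard
  let label : G → G × (Fin n → ℤ) := fun x => (a x, fun j => ⌊φ (a x * x) j / δ⌋)
  have hlabel : ∀ x y, label x = label y → x⁻¹ * y ∈ nearIdentity K Y l := fun x y hxy => by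
    obtain ⟨ha, hfloor⟩ : a x = a y ∧ _ := Prod.ext_iff.1 hxy
    have hnorm : ‖φ (a x * y) - φ (a x * x)‖ ≤ δ := norm_sub_le_of_floor_div_eq hδpos fun j => by
      simpa [label, ha] using (congrFun hfloor j).symm
    have hmem := hnear l hl _ (haV x) (a x * y) (by rw [ha]; exact haV y) <|
      calc C * (1 + l) * ‖φ (a x * y) - φ (a x * x)‖ ≤ (C + 1) * (1 + l) * δ := by
            gcongr; linarith
        _ = 1 / 2 := by rw [hδ]; field_simp
    rwa [mul_inv_rev, mul_assoc, inv_mul_cancel_left] at hmem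
  have hcells : ((t ×ˢ T).card : ℝ) ≤ (t.card + 1) * (4 * (R * (C + 1)) + 3) ^ n * (1 + l) ^ n := by
    have hbase : 2 * (R / δ) + 3 ≤ (4 * (R * (C + 1)) + 3) * (1 + l) := by
      have hRδ : R / δ = 2 * (R * (C + 1)) * (1 + l) := by rw [hδ]; field_simp
      rw [hRδ]
      linarith
    rw [Finset.card_product, Nat.cast_mul, mul_assoc, ← mul_pow]
    have hpow := hcard.trans (pow_le_pow_left₀ (by positivity) hbase n)
    gcongr
    linarith
  calc (1 : ℝ) ≤ (t ×ˢ T).card * (haarG G).real (nearIdentity K Y l) :=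
        one_le_card_mul_haarG (fun x => Finset.mk_mem_product (hat x) (hT _ (hφ _ (haV x)))) hlabel
    _ ≤ _ := by gcongr

end SlowVariation

section Counting

variable {G : Type*} [Group G] [TopologicalSpace G] {K : Subgroup G}

/-- The reproducing kernel of the finite set `F` of representations. -/
def kernelFun (F : Finset (Dual G K)) (x : G) : ℂ :=
  ∑ ξ ∈ F, (ξ.rep.d : ℂ) * (ξ.rep.mat x).trace

theorem continuous_kernelFun (F : Finset (Dual G K)) : Continuous (kernelFun F) :=
  continuous_finsetSum _ fun ξ _ => continuous_const.mul ξ.rep.continuous_trace_mat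

theorem card_div_two_le_re_trace {m : Type*} [Fintype m] {A : Matrix m m ℂ}
    (hA : ∀ i, ‖A i i - 1‖ ≤ 1 / 2) : (Fintype.card m : ℝ) / 2 ≤ A.trace.re := by
  rw [Matrix.trace, Complex.re_sum, div_eq_mul_one_div, ← nsmul_eq_mul]
  refine Finset.card_nsmul_le_sum _ _ _ fun i _ => ?_
  have hre := (abs_le.1 ((Complex.abs_re_le_norm _).trans (hA i))).1
  rw [Complex.sub_re, Complex.one_re] at hre
  rw [Matrix.diag_apply]
  linarith

theorem sum_sq_div_two_le_norm_kernelFun {F : Finset (Dual G K)} {x : G}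
    (hx : ∀ ξ ∈ F, ∀ i, ‖ξ.rep.mat x i i - 1‖ ≤ 1 / 2) :
    (∑ ξ ∈ F, (ξ.rep.d : ℝ) ^ 2) / 2 ≤ ‖kernelFun F x‖ := by
  refine le_trans ?_ (Complex.re_le_norm _)
  rw [kernelFun, Complex.re_sum, Finset.sum_div]
  refine Finset.sum_le_sum fun ξ hξ => ?_
  have htrace := card_div_two_le_re_trace (hx ξ hξ)
  rw [Fintype.card_fin] at htrace
  calc (ξ.rep.d : ℝ) ^ 2 / 2 = ξ.rep.d * (ξ.rep.d / 2) := by ring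
    _ ≤ ξ.rep.d * (ξ.rep.mat x).trace.re := by gcongr
    _ = ((ξ.rep.d : ℂ) * (ξ.rep.mat x).trace).re := by
      rw [← Complex.ofReal_natCast, Complex.re_ofReal_mul]

variable [IsTopologicalGroup G] [CompactSpace G] [MeasurableSpace G] [BorelSpace G]

open Classical in
theorem integral_trace_mul_star_trace (ξ η : Dual G K) :
    ∫ x, (ξ.rep.mat x).trace * star (η.rep.mat x).trace ∂(haarG G) = if ξ = η then 1 else 0 := by
  have hsum : ∫ x, (ξ.rep.mat x).trace * star (η.rep.mat x).trace ∂(haarG G) =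
      ∑ a, ∑ b, ∫ x, ξ.rep.mat x a a * star (η.rep.mat x b b) ∂(haarG G) := by
    simp_rw [← integral_finsetSum _ fun b _ =>
      integrable_of_continuous (ξ.rep.continuous_mat_mul_star η.rep _ _ b b)]
    rw [← integral_finsetSum _ fun a _ => integrable_of_continuous (continuous_finsetSum _
      fun b _ => ξ.rep.continuous_mat_mul_star η.rep a a b b)]
    congr 1 with x
    simp only [Matrix.trace, Matrix.diag_apply, star_sum, Finset.sum_mul_sum]
  rw [hsum]
  by_cases h : ξ = η
  · subst h
    have hd : (ξ.rep.d : ℂ) ≠ 0 := Nat.cast_ne_zero.2 ξ.rep.d_pos.ne'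
    simp_rw [ξ.rep.integral_mat_mul_star]
    simp [hd]
  · rw [if_neg h]
    exact Finset.sum_eq_zero fun a _ => Finset.sum_eq_zero fun b _ =>
      ξ.rep.integral_mat_mul_star_of_not_equivalent η.rep
        (Dual.not_equivalent_rep (Ne.symm h)) a a b b

theorem integral_norm_sq_kernelFun (F : Finset (Dual G K)) :
    ∫ x, ‖kernelFun F x‖ ^ 2 ∂(haarG G) = ∑ ξ ∈ F, (ξ.rep.d : ℝ) ^ 2 := by
  classical
  have hcont : ∀ ξ η : Dual G K, Continuous fun x => (ξ.rep.d : ℂ) * (η.rep.d : ℂ) *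
      ((ξ.rep.mat x).trace * star (η.rep.mat x).trace) := fun ξ η =>
    continuous_const.mul (ξ.rep.continuous_trace_mat.mul η.rep.continuous_trace_mat.star)
  have hexpand : ∀ x, ((‖kernelFun F x‖ ^ 2 : ℝ) : ℂ) = ∑ ξ ∈ F, ∑ η ∈ F,
      (ξ.rep.d : ℂ) * (η.rep.d : ℂ) * ((ξ.rep.mat x).trace * star (η.rep.mat x).trace) := by
    intro x
    rw [Complex.ofReal_pow, ← Complex.mul_conj', starRingEnd_apply]
    simp only [kernelFun, star_sum, Finset.sum_mul_sum, star_mul', star_natCast]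
    exact Finset.sum_congr rfl fun ξ _ => Finset.sum_congr rfl fun η _ => by ring
  suffices hcomplex : ∫ x, ((‖kernelFun F x‖ ^ 2 : ℝ) : ℂ) ∂(haarG G) =
      ∑ ξ ∈ F, (ξ.rep.d : ℂ) ^ 2 by
    rw [integral_complex_ofReal] at hcomplex
    exact_mod_cast hcomplex
  simp_rw [hexpand]
  rw [integral_finsetSum _ fun ξ _ => integrable_of_continuous
    (continuous_finsetSum _ fun η _ => hcont ξ η)]
  refine Finset.sum_congr rfl fun ξ hξ => ?_
  rw [integral_finsetSum _ fun η _ => integrable_of_continuous (hcont ξ η)]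
  simp_rw [integral_const_mul, integral_trace_mul_star_trace]
  simp [hξ, sq]

theorem sum_sq_mul_haarG_le {F : Finset (Dual G K)} {U : Set G} (hU : IsClosed U)
    (hF : ∀ x ∈ U, ∀ ξ ∈ F, ∀ i, ‖ξ.rep.mat x i i - 1‖ ≤ 1 / 2) :
    (∑ ξ ∈ F, (ξ.rep.d : ℝ) ^ 2) * (haarG G).real U ≤ 4 := by
  set N : ℝ := ∑ ξ ∈ F, (ξ.rep.d : ℝ) ^ 2
  have hint : Integrable (fun x => ‖kernelFun F x‖ ^ 2) (haarG G) :=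
    integrable_of_continuous ((continuous_kernelFun F).norm.pow 2)
  have hsq : (N / 2) ^ 2 * (haarG G).real U ≤ N :=
    calc (N / 2) ^ 2 * (haarG G).real U = ∫ _x in U, (N / 2) ^ 2 ∂(haarG G) := by simp [mul_comm]
      _ ≤ ∫ x in U, ‖kernelFun F x‖ ^ 2 ∂(haarG G) :=
          setIntegral_mono_on (integrable_const _).integrableOn hint.integrableOn
            hU.measurableSet fun x hx =>
              pow_le_pow_left₀ (by positivity) (sum_sq_div_two_le_norm_kernelFun (hF x hx)) 2
      _ ≤ ∫ x, ‖kernelFun F x‖ ^ 2 ∂(haarG G) :=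
          setIntegral_le_integral hint (Filter.Eventually.of_forall fun x => by positivity)
      _ = N := integral_norm_sq_kernelFun F
  have hN : 0 ≤ N := Finset.sum_nonneg fun ξ _ => by positivity
  rcases hN.eq_or_lt with hN | hN
  · simp [← hN]
  · refine le_of_mul_le_mul_left ?_ hN
    linarith

variable {E : Type*} [NormedAddCommGroup E] [NormedSpace ℝ E] [FiniteDimensional ℝ E] [T2Space G]
  [ChartedSpace E G] [LieGroup 𝓘(ℝ, E) ∞ G]
  {n : ℕ} {Y : Module.Basis (Fin n) ℝ (GroupLieAlgebra 𝓘(ℝ, E) G)} (hY : IsAdOrthonormal Y)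

include hY in
variable (K) in
theorem exists_sum_sq_le : ∃ C : ℝ, 0 < C ∧ ∀ l : ℝ, 0 ≤ l →
    ∀ F : Finset (Dual G K), (∀ ξ ∈ F, eigenvalue Y ξ.rep ≤ l) →
      ∑ ξ ∈ F, (ξ.rep.d : ℝ) ^ 2 ≤ C * (1 + l) ^ n := by
  obtain ⟨C, hC, hmeas⟩ := exists_one_le_mul_haarG_nearIdentity K hY
  refine ⟨4 * C, by positivity, fun l hl F hF => ?_⟩
  set N : ℝ := ∑ ξ ∈ F, (ξ.rep.d : ℝ) ^ 2
  calc N ≤ N * (C * (1 + l) ^ n * (haarG G).real (nearIdentity K Y l)) :=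
        le_mul_of_one_le_right (by positivity) (hmeas l hl)
    _ = C * (1 + l) ^ n * (N * (haarG G).real (nearIdentity K Y l)) := by ring
    _ ≤ C * (1 + l) ^ n * 4 := by
        gcongr
        exact sum_sq_mul_haarG_le (isClosed_nearIdentity l) fun x hx ξ hξ => hx ξ.rep (hF ξ hξ)
    _ = 4 * C * (1 + l) ^ n := by ring

end Counting

/-! ### Growth of Fourier coefficients -/

section Summability

variable {ι : Type*} {a : ι → ℝ} (ha : ∀ i, 0 ≤ a i) {C : ℝ} {n : ℕ}

include ha in
theorem sum_inv_one_add_pow_le_of_floor_eq {k : ℕ} {F : Finset ι} (hF : ∀ i ∈ F, ⌊a i⌋₊ = k)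
    (hC : 0 ≤ C) (hcard : (F.card : ℝ) ≤ C * (1 + (k + 1)) ^ n) :
    ∑ i ∈ F, ((1 + a i) ^ (n + 2))⁻¹ ≤ C * 2 ^ n * ((k + 1 : ℝ) ^ 2)⁻¹ := by
  calc ∑ i ∈ F, ((1 + a i) ^ (n + 2))⁻¹ ≤ ∑ _i ∈ F, ((k + 1 : ℝ) ^ (n + 2))⁻¹ := by
        refine Finset.sum_le_sum fun i hi => ?_
        have hk : (k : ℝ) ≤ a i := hF i hi ▸ Nat.floor_le (ha i)
        exact inv_anti₀ (by positivity) (pow_le_pow_left₀ (by positivity) (by linarith) _)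
    _ = F.card * ((k + 1 : ℝ) ^ (n + 2))⁻¹ := by simp
    _ ≤ C * (2 * (k + 1 : ℝ)) ^ n * ((k + 1 : ℝ) ^ (n + 2))⁻¹ := by
        gcongr
        refine hcard.trans (mul_le_mul_of_nonneg_left (pow_le_pow_left₀ (by positivity) ?_ n) hC)
        linarith [(Nat.cast_nonneg k : (0 : ℝ) ≤ k)]
    _ = C * 2 ^ n * ((k + 1 : ℝ) ^ 2)⁻¹ := by
        rw [mul_pow, pow_add]
        field_simp

include ha in
theorem summable_inv_one_add_pow_of_card_le
    (hcard : ∀ l, 0 ≤ l → ∀ F : Finset ι, (∀ i ∈ F, a i ≤ l) → (F.card : ℝ) ≤ C * (1 + l) ^ n) :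
    Summable fun i => ((1 + a i) ^ (n + 2))⁻¹ := by
  classical
  have hC : 0 ≤ C := by simpa using hcard 0 le_rfl ∅ (by simp)
  have hsquares : Summable fun k : ℕ => ((k + 1 : ℝ) ^ 2)⁻¹ := by
    simpa using (summable_nat_add_iff 1).2 (Real.summable_nat_pow_inv.2 one_lt_two)
  refine summable_of_sum_le (c := C * 2 ^ n * ∑' k : ℕ, ((k + 1 : ℝ) ^ 2)⁻¹)
    (fun i => by have := ha i; positivity) fun F => ?_
  have hmaps : ∀ i ∈ F, ⌊a i⌋₊ ∈ F.image fun i => ⌊a i⌋₊ := fun i hi =>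
    Finset.mem_image_of_mem _ hi
  rw [← Finset.sum_fiberwise_of_maps_to hmaps]
  calc ∑ k ∈ F.image fun i => ⌊a i⌋₊, ∑ i ∈ F with ⌊a i⌋₊ = k, ((1 + a i) ^ (n + 2))⁻¹
      ≤ ∑ k ∈ F.image fun i => ⌊a i⌋₊, C * 2 ^ n * ((k + 1 : ℝ) ^ 2)⁻¹ := by
        refine Finset.sum_le_sum fun k _ => ?_
        have hfloor : ∀ i ∈ F.filter fun i => ⌊a i⌋₊ = k, ⌊a i⌋₊ = k := fun i hi =>
          (Finset.mem_filter.1 hi).2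
        refine sum_inv_one_add_pow_le_of_floor_eq ha hfloor hC
          (hcard (k + 1) (by positivity) _ fun i hi => ?_)
        rw [← hfloor i hi]
        exact (Nat.lt_floor_add_one _).le
    _ = C * 2 ^ n * ∑ k ∈ F.image fun i => ⌊a i⌋₊, ((k + 1 : ℝ) ^ 2)⁻¹ := by rw [Finset.mul_sum]
    _ ≤ _ := mul_le_mul_of_nonneg_left (hsquares.sum_le_tsum _ fun k _ => by positivity)
        (by positivity)

end Summability

section DualGrowth

variable {E : Type*} [NormedAddCommGroup E] [NormedSpace ℝ E] [FiniteDimensional ℝ E]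
  {G : Type*} [Group G] [TopologicalSpace G] [IsTopologicalGroup G] [CompactSpace G] [T2Space G]
  [ChartedSpace E G] [LieGroup 𝓘(ℝ, E) ∞ G] [MeasurableSpace G] [BorelSpace G]
  {n : ℕ} {Y : Module.Basis (Fin n) ℝ (GroupLieAlgebra 𝓘(ℝ, E) G)} (K : Subgroup G)

include K in
theorem exists_dim_le (hY : IsAdOrthonormal Y) : ∃ C : ℝ, 0 < C ∧ ∀ ξ : Dual G K,
    (ξ.rep.d : ℝ) ≤ C * (1 + eigenvalue Y ξ.rep) ^ n := by
  obtain ⟨C, hC, hsum⟩ := exists_sum_sq_le K hY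
  refine ⟨C, hC, fun ξ => le_trans ?_ ((Finset.sum_singleton _ ξ).symm.trans_le
    (hsum _ (ξ.rep.eigenvalue_nonneg hY) {ξ} (by simp)))⟩
  exact le_self_pow₀ (Nat.one_le_cast.2 ξ.rep.d_pos) two_ne_zero

theorem summable_inv_one_add_eigenvalue_pow (hY : IsAdOrthonormal Y) :
    Summable fun ξ : Dual G K => ((1 + eigenvalue Y ξ.rep) ^ (n + 2))⁻¹ := by
  obtain ⟨C, -, hsum⟩ := exists_sum_sq_le K hY
  refine summable_inv_one_add_pow_of_card_le (fun ξ => ξ.rep.eigenvalue_nonneg hY)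
    (C := C) fun l hl F hF => le_trans ?_ (hsum l hl F hF)
  rw [Finset.card_eq_sum_ones, Nat.cast_sum]
  refine Finset.sum_le_sum fun ξ _ => ?_
  exact_mod_cast Nat.one_le_pow 2 _ ξ.rep.d_pos

theorem exists_summable_dim_pow_mul_div (hY : IsAdOrthonormal Y) (p q : ℕ) : ∃ M : ℕ,
    Summable fun ξ : Dual G K => (ξ.rep.d : ℝ) ^ p * (1 + eigenvalue Y ξ.rep) ^ q /
      (1 + eigenvalue Y ξ.rep) ^ M := by
  obtain ⟨C, hC, hdim⟩ := exists_dim_le K hY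
  refine ⟨n * p + q + (n + 2), Summable.of_nonneg_of_le (fun ξ => ?_) (fun ξ => ?_)
    ((summable_inv_one_add_eigenvalue_pow K hY).mul_left (C ^ p))⟩
  · have := ξ.rep.eigenvalue_nonneg hY
    positivity
  · have hnonneg := ξ.rep.eigenvalue_nonneg hY
    calc (ξ.rep.d : ℝ) ^ p * (1 + eigenvalue Y ξ.rep) ^ q /
          (1 + eigenvalue Y ξ.rep) ^ (n * p + q + (n + 2))
        ≤ (C * (1 + eigenvalue Y ξ.rep) ^ n) ^ p * (1 + eigenvalue Y ξ.rep) ^ q /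
          (1 + eigenvalue Y ξ.rep) ^ (n * p + q + (n + 2)) := by gcongr; exact hdim ξ
      _ = C ^ p * ((1 + eigenvalue Y ξ.rep) ^ (n + 2))⁻¹ := by
        rw [mul_pow, ← pow_mul, pow_add, pow_add]
        field_simp

theorem countable_dual (hY : IsAdOrthonormal Y) : Countable (Dual G K) := by
  have hsupport : Function.support (fun ξ : Dual G K =>
      ((1 + eigenvalue Y ξ.rep) ^ (n + 2))⁻¹) = Set.univ :=
    Function.support_eq_univ fun ξ => by
      have := ξ.rep.eigenvalue_nonneg hY
      positivity
  exact Set.countable_univ_iff.1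
    (hsupport ▸ (summable_inv_one_add_eigenvalue_pow K hY).countable_support)

theorem finite_weight_lt (hY : IsAdOrthonormal Y) (R : ℝ) :
    {ξ : Dual G K | weight Y ξ < R}.Finite := by
  have hsmall := (summable_inv_one_add_eigenvalue_pow K hY).tendsto_cofinite_zero.eventually
    (gt_mem_nhds (show (0 : ℝ) < ((1 + R ^ 2) ^ (n + 2))⁻¹ by positivity))
  refine (Filter.eventually_cofinite.1 hsmall).subset fun ξ (hξ : weight Y ξ < R) => ?_
  have hnonneg := ξ.rep.eigenvalue_nonneg hY
  rw [weight, Real.sqrt_lt' ((Real.sqrt_nonneg _).trans_lt hξ)] at hξ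
  rw [Set.mem_ofPred_eq, not_lt]
  gcongr
  linarith

end DualGrowth

section CoefficientGrowth

variable {E : Type*} [NormedAddCommGroup E] [NormedSpace ℝ E]
  {G : Type*} [Group G] [TopologicalSpace G] [ChartedSpace E G] {K : Subgroup G}
  {n : ℕ} {Y : Module.Basis (Fin n) ℝ (GroupLieAlgebra 𝓘(ℝ, E) G)}

variable (Y) in
/-- The matrix family `a` grows at most like a power of `1 + λ_ξ`, as do the Fourier coefficients
of distributions. -/
def HasPolynomialGrowth (a : MatFamily G K) : Prop :=
  ∃ (N : ℕ) (C : ℝ), 0 ≤ C ∧ ∀ (ξ : Dual G K) (i j : Fin ξ.rep.d),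
    ‖a ξ i j‖ ≤ C * (1 + eigenvalue Y ξ.rep) ^ N

variable (Y) in
/-- The matrix family `a` decays faster than every power of `1 + λ_ξ`, as do the Fourier
coefficients of smooth functions. -/
def IsRapidlyDecreasing (a : MatFamily G K) : Prop :=
  ∀ M : ℕ, ∃ C : ℝ, 0 ≤ C ∧ ∀ (ξ : Dual G K) (i j : Fin ξ.rep.d),
    ‖a ξ i j‖ ≤ C / (1 + eigenvalue Y ξ.rep) ^ M

theorem norm_mul_apply_le {m : Type*} [Fintype m] {A C : Matrix m m ℂ} {α β : ℝ}
    (hA : ∀ i j, ‖A i j‖ ≤ α) (hC : ∀ i j, ‖C i j‖ ≤ β) (i j : m) :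
    ‖(A * C) i j‖ ≤ Fintype.card m * (α * β) := by
  rw [Matrix.mul_apply]
  refine (norm_sum_le _ _).trans ((Finset.sum_le_sum (g := fun _ => α * β) fun k _ => ?_).trans_eq
    (by simp))
  rw [norm_mul]
  exact mul_le_mul (hA i k) (hC k j) (norm_nonneg _) ((norm_nonneg _).trans (hA i k))

theorem norm_trace_mul_le {m : Type*} [Fintype m] {A C : Matrix m m ℂ} {α β : ℝ}
    (hA : ∀ i j, ‖A i j‖ ≤ α) (hC : ∀ i j, ‖C i j‖ ≤ β) :
    ‖(A * C).trace‖ ≤ Fintype.card m ^ 2 * (α * β) := by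
  calc ‖(A * C).trace‖ ≤ ∑ _i : m, Fintype.card m * (α * β) :=
        (norm_sum_le _ _).trans (Finset.sum_le_sum fun i _ => norm_mul_apply_le hA hC i i)
    _ = Fintype.card m ^ 2 * (α * β) := by simp; ring

variable [FiniteDimensional ℝ E] [IsTopologicalGroup G] [CompactSpace G] [T2Space G]
  [LieGroup 𝓘(ℝ, E) ∞ G] [MeasurableSpace G] [BorelSpace G]

theorem HasPolynomialGrowth.mul (hY : IsAdOrthonormal Y) {a b : MatFamily G K}
    (ha : HasPolynomialGrowth Y a) (hb : HasPolynomialGrowth Y b) :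
    HasPolynomialGrowth Y fun ξ => a ξ * b ξ := by
  obtain ⟨D, hD, hdim⟩ := exists_dim_le K hY
  obtain ⟨N, C, hC, ha⟩ := ha
  obtain ⟨N', C', hC', hb⟩ := hb
  refine ⟨n + (N + N'), D * (C * C'), by positivity, fun ξ i j => ?_⟩
  have hnonneg := ξ.rep.eigenvalue_nonneg hY
  calc ‖(a ξ * b ξ) i j‖
      ≤ ξ.rep.d * (C * (1 + eigenvalue Y ξ.rep) ^ N * (C' * (1 + eigenvalue Y ξ.rep) ^ N')) := by
        simpa using norm_mul_apply_le (ha ξ) (hb ξ) i j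
    _ ≤ D * (1 + eigenvalue Y ξ.rep) ^ n *
        (C * (1 + eigenvalue Y ξ.rep) ^ N * (C' * (1 + eigenvalue Y ξ.rep) ^ N')) := by
        gcongr
        exact hdim ξ
    _ = D * (C * C') * (1 + eigenvalue Y ξ.rep) ^ (n + (N + N')) := by ring

theorem HasPolynomialGrowth.mul_isRapidlyDecreasing (hY : IsAdOrthonormal Y)
    {a b : MatFamily G K} (ha : HasPolynomialGrowth Y a) (hb : IsRapidlyDecreasing Y b) :
    IsRapidlyDecreasing Y fun ξ => a ξ * b ξ := fun M => by
  obtain ⟨D, hD, hdim⟩ := exists_dim_le K hY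
  obtain ⟨N, C, hC, ha⟩ := ha
  obtain ⟨C', hC', hb⟩ := hb (n + N + M)
  refine ⟨D * (C * C'), by positivity, fun ξ i j => ?_⟩
  have hnonneg := ξ.rep.eigenvalue_nonneg hY
  calc ‖(a ξ * b ξ) i j‖
      ≤ ξ.rep.d * (C * (1 + eigenvalue Y ξ.rep) ^ N *
        (C' / (1 + eigenvalue Y ξ.rep) ^ (n + N + M))) := by
        simpa using norm_mul_apply_le (ha ξ) (hb ξ) i j
    _ ≤ D * (1 + eigenvalue Y ξ.rep) ^ n * (C * (1 + eigenvalue Y ξ.rep) ^ N *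
        (C' / (1 + eigenvalue Y ξ.rep) ^ (n + N + M))) := by
        gcongr
        exact hdim ξ
    _ = D * (C * C') / (1 + eigenvalue Y ξ.rep) ^ M := by
        rw [pow_add, pow_add]
        field_simp

end CoefficientGrowth

section FourierCoefficients

variable {E : Type*} [NormedAddCommGroup E] [NormedSpace ℝ E]
  {G : Type*} [Group G] [TopologicalSpace G] [CompactSpace G] [ChartedSpace E G]
  [LieGroup 𝓘(ℝ, E) ∞ G] {K : Subgroup G}
  {n : ℕ} {Y : Module.Basis (Fin n) ℝ (GroupLieAlgebra 𝓘(ℝ, E) G)}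

theorem exists_norm_iterLieDeriv_le {f : G → ℂ} (hf : ContMDiff 𝓘(ℝ, E) 𝓘(ℝ, ℂ) ∞ f) (N : ℕ) :
    ∃ A : ℝ, ∀ w : List (Fin n), w.length ≤ N → ∀ x, ‖iterLieDeriv Y w f x‖ ≤ A := by
  have hbounded : ∀ w : List (Fin n), ∃ A : ℝ, ∀ x, ‖iterLieDeriv Y w f x‖ ≤ A := fun w => by
    obtain ⟨A, hA⟩ := isCompact_univ.exists_bound_of_continuousOn
      (contMDiff_iterLieDeriv Y hf w).continuous.continuousOn
    exact ⟨A, fun x => hA x (Set.mem_univ x)⟩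
  choose A hA using hbounded
  obtain ⟨M, hM⟩ := (List.finite_length_le (Fin n) N).image A |>.bddAbove
  exact ⟨M, fun w hw x => (hA w x).trans (hM (Set.mem_image_of_mem A hw))⟩

variable [FiniteDimensional ℝ E] [IsTopologicalGroup G] [T2Space G] [MeasurableSpace G]
  [BorelSpace G] (hY : IsAdOrthonormal Y)

open scoped Matrix.Norms.L2Operator in
include hY in
theorem TypeOneRep.pow_mul_norm_integral_mul_mat_mul_le (ξ : TypeOneRep G K)
    {A : Matrix (Fin ξ.d) (Fin ξ.d) ℂ} (hA : ‖A‖ ≤ 1) (M : ℕ) {f : G → ℂ}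
    (hf : ContMDiff 𝓘(ℝ, E) 𝓘(ℝ, ℂ) ∞ f) {S : ℝ}
    (hS : ∀ w : List (Fin n), w.length ≤ 2 * M → ∀ x, ‖iterLieDeriv Y w f x‖ ≤ S)
    (i j : Fin ξ.d) :
    (1 + eigenvalue Y ξ) ^ M * ‖∫ x, f x * (ξ.mat x * A) i j ∂(haarG G)‖ ≤ (1 + n) ^ M * S :=
  pow_mul_norm_integral_mul_le Y (ξ.contMDiff_mat_mul_apply _ i j)
    (ξ.norm_mat_mul_apply_le hA i j) (ξ.eigenvalue_nonneg hY)
    (ξ.neg_laplacian_mat_mul_apply hY _ i j) M hf hS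

open scoped Matrix.Norms.L2Operator in
include hY in
theorem isRapidlyDecreasing_fourier {f : G ⧸ K → ℂ} (hf : f ∈ smoothFun E K) :
    IsRapidlyDecreasing Y (fourier f) := fun M => by
  have hstar : ContMDiff 𝓘(ℝ, E) 𝓘(ℝ, ℂ) ∞ fun x : G => star (f x) := contMDiff_star_complex hf
  obtain ⟨S, hS⟩ := exists_norm_iterLieDeriv_le (Y := Y) hstar (2 * M)
  have hS0 : 0 ≤ S := (norm_nonneg _).trans (hS [] (Nat.zero_le _) 1)
  refine ⟨(1 + n) ^ M * S, by positivity, fun ξ i j => ?_⟩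
  have hnonneg := ξ.rep.eigenvalue_nonneg hY
  have hconj : fourier f ξ i j =
      star (∫ x : G, star (f x) *
        (ξ.rep.mat x * (1 : Matrix (Fin ξ.rep.d) (Fin ξ.rep.d) ℂ)) j i ∂(haarG G)) := by
    rw [fourier, Matrix.of_apply, ← starRingEnd_apply, ← integral_conj]
    simp
  rw [hconj, norm_star, le_div_iff₀' (by positivity)]
  exact ξ.rep.pow_mul_norm_integral_mul_mat_mul_le hY norm_one.le M hstar hS j i

omit [MeasurableSpace G] [BorelSpace G] in
theorem conjTranspose_onM_mem_smoothFun (ξ : TypeOneRep G K) (i j : Fin ξ.d) :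
    (fun x => (ξ.onM x)ᴴ i j) ∈ smoothFun E K :=
  contMDiff_star_complex (ξ.contMDiff_mat_mul_apply ξ.proj j i)

omit [MeasurableSpace G] [BorelSpace G] in
include hY in
theorem hasPolynomialGrowth_distFourier (u : Distribution Y K) :
    HasPolynomialGrowth Y (distFourier u) := by
  obtain ⟨N, C, hu⟩ := u.2
  refine ⟨N, |C|, abs_nonneg C, fun ξ i j => ?_⟩
  have hnonneg := ξ.rep.eigenvalue_nonneg hY
  have hmem := conjTranspose_onM_mem_smoothFun (E := E) ξ.rep i j
  rw [distFourier, Matrix.of_apply, distPair, dif_pos hmem]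
  have hone : 1 ≤ Real.sqrt (1 + eigenvalue Y ξ.rep) := Real.one_le_sqrt.2 (by linarith)
  have hsqrt : Real.sqrt (1 + eigenvalue Y ξ.rep) ≤ 1 + eigenvalue Y ξ.rep :=
    Real.sqrt_le_iff.2 ⟨by positivity, by nlinarith⟩
  refine (hu ⟨_, hmem⟩ ((1 + eigenvalue Y ξ.rep) ^ N) fun w hw x => ?_).trans
    (mul_le_mul_of_nonneg_right (le_abs_self C) (by positivity))
  change ‖iterLieDeriv Y w (fun x => star ((ξ.rep.mat x * ξ.rep.proj) j i)) x‖ ≤ _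
  rw [iterLieDeriv_star Y w (ξ.rep.contMDiff_mat_mul_apply _ j i), norm_star]
  calc ‖iterLieDeriv Y w (fun x => (ξ.rep.mat x * ξ.rep.proj) j i) x‖
      ≤ Real.sqrt (1 + eigenvalue Y ξ.rep) ^ w.length :=
        ξ.rep.norm_iterLieDeriv_mat_mul_apply_le hY w ξ.rep.l2_opNorm_proj_le j i x
    _ ≤ Real.sqrt (1 + eigenvalue Y ξ.rep) ^ N := pow_le_pow_right₀ hone hw
    _ ≤ (1 + eigenvalue Y ξ.rep) ^ N := by gcongr

end FourierCoefficients

/-! ### Fourier series and multiplier symbols -/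

section Projections

variable {G : Type*} [Group G] [TopologicalSpace G] {K : Subgroup G}

namespace TypeOneRep

variable (ξ : TypeOneRep G K)

theorem onM_mul (x : G) (A : Matrix (Fin ξ.d) (Fin ξ.d) ℂ) :
    ξ.onM (x : G ⧸ K) * A = ξ.mat x * (ξ.proj * A) :=
  Matrix.mul_assoc _ _ _

theorem continuous_onM : Continuous fun x : G => ξ.onM (x : G ⧸ K) :=
  ξ.continuous_hom.matrix_mul continuous_const

theorem proj_mul_apply (A : Matrix (Fin ξ.d) (Fin ξ.d) ℂ) (i j : Fin ξ.d) :
    (ξ.proj * A) i j = ξ.proj i i * A i j := by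
  simp [proj, Matrix.diagonal_mul]

theorem proj_mul_proj : ξ.proj * ξ.proj = ξ.proj := by
  simp [proj, Matrix.diagonal_mul_diagonal]

theorem conjTranspose_proj : ξ.projᴴ = ξ.proj := by
  ext i j
  by_cases hij : i = j <;> simp [proj, hij, Ne.symm, apply_ite]

theorem conjTranspose_onM_apply (x : G) (i j : Fin ξ.d) :
    (ξ.onM (x : G ⧸ K))ᴴ i j = ξ.proj i i * star (ξ.mat x j i) := by
  rw [← Matrix.conjTranspose_apply, ← proj_mul_apply]
  change (ξ.mat x * ξ.proj)ᴴ i j = _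
  rw [Matrix.conjTranspose_mul, conjTranspose_proj]

end TypeOneRep

variable {σ : MatFamily G K} (hσ : IsMultiplierSymbol σ)

include hσ

theorem IsMultiplierSymbol.mul_proj (ξ : Dual G K) : σ ξ * ξ.rep.proj = σ ξ := by
  ext i j
  rw [TypeOneRep.proj, Matrix.mul_diagonal]
  split_ifs with h
  · rw [mul_one]
  · rw [mul_zero, hσ ξ i j (Or.inr (not_lt.1 h))]

theorem IsMultiplierSymbol.proj_mul (ξ : Dual G K) : ξ.rep.proj * σ ξ = σ ξ := by
  ext i j
  rw [TypeOneRep.proj, Matrix.diagonal_mul]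
  split_ifs with h
  · rw [one_mul]
  · rw [zero_mul, hσ ξ i j (Or.inl (not_lt.1 h))]

end Projections

section FiniteSeries

variable {G : Type*} [Group G] [TopologicalSpace G] {K : Subgroup G} {a : MatFamily G K}
  {F : Finset (Dual G K)}

theorem fourierSeries_eq_sum (ha : ∀ ξ ∉ F, a ξ = 0) (x : G ⧸ K) :
    fourierSeries a x = ∑ ξ ∈ F, (ξ.rep.d : ℂ) * (ξ.rep.onM x * a ξ).trace :=
  tsum_eq_sum fun ξ hξ => by rw [ha ξ hξ, Matrix.mul_zero, Matrix.trace_zero, mul_zero]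

theorem continuous_fourierSeries_term (a : MatFamily G K) (ξ : Dual G K) :
    Continuous fun x : G => (ξ.rep.d : ℂ) * (ξ.rep.onM (x : G ⧸ K) * a ξ).trace :=
  continuous_const.mul (ξ.rep.continuous_onM.matrix_mul continuous_const).matrix_trace

theorem continuous_fourierSeries_of_finite (ha : ∀ ξ ∉ F, a ξ = 0) :
    Continuous fun x : G => fourierSeries a (x : G ⧸ K) := by
  simp_rw [fourierSeries_eq_sum ha]
  exact continuous_finsetSum _ fun ξ _ => continuous_fourierSeries_term a ξ

theorem measurable_of_continuous_lift [MeasurableSpace G] [BorelSpace G] {f : G ⧸ K → ℂ}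
    (hf : Continuous fun x : G => f x) : Measurable f :=
  QuotientGroup.measurable_from_quotient.2 hf.measurable

theorem fourierSeries_mem_smoothFun {E : Type*} [NormedAddCommGroup E] [NormedSpace ℝ E]
    [FiniteDimensional ℝ E] [IsTopologicalGroup G] [CompactSpace G] [T2Space G]
    [ChartedSpace E G] [LieGroup 𝓘(ℝ, E) ∞ G] (ha : ∀ ξ ∉ F, a ξ = 0) :
    fourierSeries a ∈ smoothFun E K := by
  change ContMDiff 𝓘(ℝ, E) 𝓘(ℝ, ℂ) ∞ fun x : G => fourierSeries a (x : G ⧸ K)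
  simp_rw [fourierSeries_eq_sum ha, TypeOneRep.onM_mul]
  exact contMDiff_sum_const_mul _ _ fun ξ => contMDiff_finsetSum fun i _ =>
    ξ.rep.contMDiff_mat_mul_apply _ i i

end FiniteSeries

section TrigonometricPolynomials

variable {G : Type*} [Group G] [TopologicalSpace G] [IsTopologicalGroup G] [CompactSpace G]
  [MeasurableSpace G] [BorelSpace G] {K : Subgroup G}

theorem integral_mul_trace_mul {m : Type*} [Fintype m] {φ : G → ℂ} (hφ : Continuous φ)
    {M : G → Matrix m m ℂ} (hM : Continuous M) (A : Matrix m m ℂ) :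
    ∫ x, φ x * (M x * A).trace ∂(haarG G) =
      (Matrix.of (fun i j => ∫ x, φ x * M x i j ∂(haarG G)) * A).trace := by
  have hcont : ∀ i j, Continuous fun x => φ x * M x i j * A j i := fun i j =>
    (hφ.mul (hM.matrix_elem i j)).mul continuous_const
  simp_rw [Matrix.trace, Matrix.diag_apply, Matrix.mul_apply, Matrix.of_apply, Finset.mul_sum,
    ← mul_assoc, ← integral_mul_const]
  rw [integral_finsetSum _ fun i _ => integrable_of_continuous
    (continuous_finsetSum _ fun j _ => hcont i j)]
  simp_rw [integral_finsetSum _ fun j _ => integrable_of_continuous (hcont _ j)]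

theorem TypeOneRep.integral_star_mat_mul_trace (ξ : TypeOneRep G K)
    (A : Matrix (Fin ξ.d) (Fin ξ.d) ℂ) (i j : Fin ξ.d) :
    ∫ x, star (ξ.mat x j i) * (ξ.mat x * A).trace ∂(haarG G) = (ξ.d : ℂ)⁻¹ * A i j := by
  rw [integral_mul_trace_mul (M := ξ.mat) (ξ.continuous_mat_apply j i).star ξ.continuous_hom]
  have horth : (Matrix.of fun a b => ∫ x, star (ξ.mat x j i) * ξ.mat x a b ∂(haarG G)) =
      Matrix.single j i (ξ.d : ℂ)⁻¹ := by
    ext a b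
    simp only [Matrix.of_apply, mul_comm (star _),
      ξ.integral_mat_mul_star, Matrix.single_apply, eq_comm]
  rw [horth, Matrix.trace_single_mul, smul_eq_mul]

theorem integral_star_mat_mul_trace_of_ne {ξ η : Dual G K} (hne : ξ ≠ η)
    (A : Matrix (Fin ξ.rep.d) (Fin ξ.rep.d) ℂ) (i j : Fin η.rep.d) :
    ∫ x, star (η.rep.mat x j i) * (ξ.rep.mat x * A).trace ∂(haarG G) = 0 := by
  rw [integral_mul_trace_mul (M := ξ.rep.mat) (η.rep.continuous_mat_apply j i).star
    ξ.rep.continuous_hom]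
  have horth : (Matrix.of fun a b => ∫ x, star (η.rep.mat x j i) * ξ.rep.mat x a b ∂(haarG G)) =
      0 := by
    ext a b
    simp only [Matrix.of_apply, mul_comm (star _), Matrix.zero_apply,
      ξ.rep.integral_mat_mul_star_of_not_equivalent η.rep (Dual.not_equivalent_rep hne.symm)]
  rw [horth, Matrix.zero_mul, Matrix.trace_zero]

theorem fourier_fourierSeries {a : MatFamily G K} {F : Finset (Dual G K)}
    (ha : ∀ ξ ∉ F, a ξ = 0) (η : Dual G K) :
    fourier (fourierSeries a) η = η.rep.proj * a η := by
  classical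
  ext i j
  have hcont : ∀ ξ : Dual G K, Continuous fun x : G => (ξ.rep.d : ℂ) *
      (ξ.rep.onM (x : G ⧸ K) * a ξ).trace * star (η.rep.mat x j i) := fun ξ =>
    (continuous_fourierSeries_term a ξ).mul (η.rep.continuous_mat_apply j i).star
  simp_rw [fourier, Matrix.of_apply, Matrix.conjTranspose_apply, fourierSeries_eq_sum ha,
    Finset.sum_mul]
  rw [integral_finsetSum _ fun ξ _ => integrable_of_continuous (hcont ξ)]
  simp_rw [mul_assoc, integral_const_mul, TypeOneRep.onM_mul, mul_comm (Matrix.trace _)]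
  have hd : (η.rep.d : ℂ) ≠ 0 := Nat.cast_ne_zero.2 η.rep.d_pos.ne'
  rw [Finset.sum_eq_single η (fun ξ _ hξ => by
      rw [integral_star_mat_mul_trace_of_ne hξ, mul_zero])
    (fun hη => by simp [ha η hη]),
    η.rep.integral_star_mat_mul_trace, mul_inv_cancel_left₀ hd]

theorem integral_haarM {f : G ⧸ K → ℂ} (hf : Measurable f) :
    ∫ x, f x ∂(haarM G K) = ∫ x : G, f x ∂(haarG G) :=
  integral_map QuotientGroup.measurable_coe.aemeasurable hf.aestronglyMeasurable

theorem enorm_fourier_apply_le {f : G ⧸ K → ℂ} (hf : Measurable f) {p : ℝ≥0∞} (hp : 1 ≤ p)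
    (ξ : Dual G K) (i j : Fin ξ.rep.d) : ‖fourier f ξ i j‖ₑ ≤ eLpNorm f p (haarM G K) := by
  have hmat : ∀ x : G, ‖(ξ.rep.mat x)ᴴ i j‖ₑ ≤ 1 := fun x => by
    rw [← ofReal_norm, Matrix.conjTranspose_apply, norm_star]
    exact ENNReal.ofReal_le_one.2 (ξ.rep.norm_mat_apply_le x j i)
  rw [fourier, Matrix.of_apply]
  calc ‖∫ x, f (x : G ⧸ K) * (ξ.rep.mat x)ᴴ i j ∂(haarG G)‖ₑ
      ≤ ∫⁻ x, ‖f (x : G ⧸ K) * (ξ.rep.mat x)ᴴ i j‖ₑ ∂(haarG G) :=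
        enorm_integral_le_lintegral_enorm _
    _ ≤ ∫⁻ x : G, ‖f (x : G ⧸ K)‖ₑ ∂(haarG G) := lintegral_mono fun x => by
        rw [enorm_mul]
        exact mul_le_of_le_one_right zero_le (hmat x)
    _ = ∫⁻ x, ‖f x‖ₑ ∂(haarM G K) :=
        (lintegral_map hf.enorm QuotientGroup.measurable_coe).symm
    _ = eLpNorm f 1 (haarM G K) := eLpNorm_one_eq_lintegral_enorm.symm
    _ ≤ eLpNorm f p (haarM G K) :=
        eLpNorm_le_eLpNorm_of_exponent_le hp hf.aestronglyMeasurable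

end TrigonometricPolynomials

section SymbolGrowth

variable {G : Type*} [Group G] [TopologicalSpace G] [IsTopologicalGroup G] [CompactSpace G]
  [MeasurableSpace G] [BorelSpace G] {K : Subgroup G} {σ : MatFamily G K}
  (hσ : IsMultiplierSymbol σ)

include hσ in
theorem IsMultiplierSymbol.Op_fourierSeries {a : MatFamily G K} {F : Finset (Dual G K)}
    (ha : ∀ ξ ∉ F, a ξ = 0) :
    Op σ (fourierSeries a) = fourierSeries fun ξ => σ ξ * a ξ := by
  unfold Op
  simp_rw [fourier_fourierSeries ha, ← Matrix.mul_assoc, hσ.mul_proj]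

include hσ in
theorem IsMultiplierSymbol.enorm_mul_apply_le {a : MatFamily G K} {F : Finset (Dual G K)}
    (ha : ∀ ξ ∉ F, a ξ = 0) {p : ℝ≥0∞} (hp : 1 ≤ p) (ξ : Dual G K) (i j : Fin ξ.rep.d) :
    ‖(σ ξ * a ξ) i j‖ₑ ≤ eLpNorm (Op σ (fourierSeries a)) p (haarM G K) := by
  have hσa : ∀ ξ ∉ F, σ ξ * a ξ = 0 := fun ξ hξ => by rw [ha ξ hξ, Matrix.mul_zero]
  have hcoeff : fourier (Op σ (fourierSeries a)) ξ = σ ξ * a ξ := by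
    rw [hσ.Op_fourierSeries ha, fourier_fourierSeries hσa, ← Matrix.mul_assoc, hσ.proj_mul]
  rw [← hcoeff]
  refine enorm_fourier_apply_le (measurable_of_continuous_lift ?_) hp ξ i j
  rw [hσ.Op_fourierSeries ha]
  exact continuous_fourierSeries_of_finite hσa

omit [IsTopologicalGroup G] [CompactSpace G] [MeasurableSpace G] [BorelSpace G] in
open Classical in
theorem norm_fourierSeries_single_le (ξ : Dual G K) (l : Fin ξ.rep.d) (x : G ⧸ K) :
    ‖fourierSeries (Pi.single ξ (Matrix.single l l 1) : MatFamily G K) x‖ ≤ ξ.rep.d := by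
  induction x using QuotientGroup.induction_on with
  | H x =>
    rw [fourierSeries_eq_sum (F := {ξ}) fun η hη =>
        Pi.single_eq_of_ne (Finset.notMem_singleton.1 hη) _, Finset.sum_singleton,
      Pi.single_eq_same, norm_mul, Matrix.trace_mul_single, Complex.norm_natCast,
      MulOpposite.op_one, one_smul]
    exact mul_le_of_le_one_right (Nat.cast_nonneg _)
      (ξ.rep.norm_mat_mul_apply_le ξ.rep.l2_opNorm_proj_le l l x)

variable {E : Type*} [NormedAddCommGroup E] [NormedSpace ℝ E] [FiniteDimensional ℝ E] [T2Space G]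
  [ChartedSpace E G] [LieGroup 𝓘(ℝ, E) ∞ G] {p₁ p₂ : ℝ≥0∞} (hp₂ : 1 ≤ p₂)

include hσ hp₂ in
-- Test the bound on `d_ξ (ξ(x) I_ξ)_{jj}`: the `j`-th column of `σ(ξ)` occurs among the Fourier
-- coefficients of its image.
theorem exists_norm_symbol_le (hA : IsLpBounded E p₁ p₂ σ) :
    ∃ C : ℝ, 0 ≤ C ∧ ∀ (ξ : Dual G K) (i j : Fin ξ.rep.d), ‖σ ξ i j‖ ≤ C * ξ.rep.d := by
  classical
  obtain ⟨C, hC⟩ := hA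
  refine ⟨C, C.coe_nonneg, fun ξ i j => ?_⟩
  set a : MatFamily G K := Pi.single ξ (Matrix.single j j 1) with ha_def
  have ha : ∀ η ∉ ({ξ} : Finset (Dual G K)), a η = 0 := fun η hη =>
    Pi.single_eq_of_ne (Finset.notMem_singleton.1 hη) _
  have hcoeff : (σ ξ * a ξ) i j = σ ξ i j := by simp [ha_def]
  have hnorm : eLpNorm (fourierSeries a) p₁ (haarM G K) ≤ ENNReal.ofReal ξ.rep.d :=
    (eLpNorm_le_of_ae_bound
      (Filter.Eventually.of_forall (norm_fourierSeries_single_le ξ j))).trans (by simp)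
  have hbound : ‖σ ξ i j‖ₑ ≤ ENNReal.ofReal (C * ξ.rep.d) := by
    rw [ENNReal.ofReal_mul C.coe_nonneg, ENNReal.ofReal_coe_nnreal, ← hcoeff]
    calc ‖(σ ξ * a ξ) i j‖ₑ ≤ eLpNorm (Op σ (fourierSeries a)) p₂ (haarM G K) :=
          hσ.enorm_mul_apply_le ha hp₂ ξ i j
      _ ≤ C * eLpNorm (fourierSeries a) p₁ (haarM G K) := hC _ (fourierSeries_mem_smoothFun ha)
      _ ≤ C * ENNReal.ofReal ξ.rep.d := by gcongr
  rw [← ofReal_norm] at hbound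
  exact (ENNReal.ofReal_le_ofReal_iff (by positivity)).1 hbound

include hσ hp₂ in
theorem IsLpBounded.hasPolynomialGrowth {n : ℕ}
    {Y : Module.Basis (Fin n) ℝ (GroupLieAlgebra 𝓘(ℝ, E) G)} (hY : IsAdOrthonormal Y)
    (hA : IsLpBounded E p₁ p₂ σ) : HasPolynomialGrowth Y σ := by
  obtain ⟨C, hC, hσC⟩ := exists_norm_symbol_le hσ hp₂ hA
  obtain ⟨D, hD, hdim⟩ := exists_dim_le K hY
  refine ⟨n, C * D, by positivity, fun ξ i j => (hσC ξ i j).trans ?_⟩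
  rw [mul_assoc]
  exact mul_le_mul_of_nonneg_left (hdim ξ) hC

end SymbolGrowth

/-! ### Distributions with given Fourier coefficients -/

section Pairing

variable {G : Type*} [Group G] [TopologicalSpace G] [IsTopologicalGroup G] [CompactSpace G]
  [MeasurableSpace G] [BorelSpace G] {K : Subgroup G}

/-- The integral of `φ` against the summand of index `ξ` of the Fourier series with
coefficients `a`. Summing over `ξ` gives the action on `φ` of the distribution with Fourier
coefficients `a`. -/
def termPairing (a : MatFamily G K) (φ : G ⧸ K → ℂ) (ξ : Dual G K) : ℂ :=
  ∫ x : G, φ x * ((ξ.rep.d : ℂ) * (ξ.rep.onM (x : G ⧸ K) * a ξ).trace) ∂(haarG G)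

theorem integrable_mul_fourierSeries_term {φ : G ⧸ K → ℂ} (hφ : Continuous fun x : G => φ x)
    (a : MatFamily G K) (ξ : Dual G K) :
    Integrable (fun x : G => φ x * ((ξ.rep.d : ℂ) * (ξ.rep.onM (x : G ⧸ K) * a ξ).trace))
      (haarG G) :=
  integrable_of_continuous (hφ.mul (continuous_fourierSeries_term a ξ))

theorem termPairing_add_right (a : MatFamily G K) {φ ψ : G ⧸ K → ℂ}
    (hφ : Continuous fun x : G => φ x) (hψ : Continuous fun x : G => ψ x) (ξ : Dual G K) :
    termPairing a (φ + ψ) ξ = termPairing a φ ξ + termPairing a ψ ξ := by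
  simp only [termPairing, Pi.add_apply, add_mul]
  exact integral_add (integrable_mul_fourierSeries_term hφ a ξ)
    (integrable_mul_fourierSeries_term hψ a ξ)

theorem termPairing_smul_right (a : MatFamily G K) (c : ℂ) (φ : G ⧸ K → ℂ) (ξ : Dual G K) :
    termPairing a (c • φ) ξ = c * termPairing a φ ξ := by
  simp only [termPairing, Pi.smul_apply, smul_eq_mul, mul_assoc]
  exact integral_const_mul _ _

theorem termPairing_add_left (a b : MatFamily G K) {φ : G ⧸ K → ℂ}
    (hφ : Continuous fun x : G => φ x) (ξ : Dual G K) :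
    termPairing (a + b) φ ξ = termPairing a φ ξ + termPairing b φ ξ := by
  simp only [termPairing, Pi.add_apply, Matrix.trace_add, mul_add]
  exact integral_add (integrable_mul_fourierSeries_term hφ a ξ)
    (integrable_mul_fourierSeries_term hφ b ξ)

theorem termPairing_smul_left (a : MatFamily G K) (c : ℂ) (φ : G ⧸ K → ℂ) (ξ : Dual G K) :
    termPairing (c • a) φ ξ = c * termPairing a φ ξ := by
  simp only [termPairing, Pi.smul_apply, Matrix.mul_smul, Matrix.trace_smul, smul_eq_mul,
    mul_left_comm _ c]
  exact integral_const_mul _ _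

theorem norm_termPairing_le (a : MatFamily G K) {φ : G ⧸ K → ℂ}
    (hφ : Continuous fun x : G => φ x) (ξ : Dual G K) {α β : ℝ}
    (hα : ∀ i j, ‖∫ x : G, φ x * ξ.rep.onM (x : G ⧸ K) i j ∂(haarG G)‖ ≤ α)
    (hβ : ∀ i j, ‖a ξ i j‖ ≤ β) : ‖termPairing a φ ξ‖ ≤ ξ.rep.d ^ 3 * (α * β) := by
  simp only [termPairing, mul_left_comm _ (ξ.rep.d : ℂ)]
  rw [integral_const_mul, integral_mul_trace_mul hφ ξ.rep.continuous_onM, norm_mul,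
    Complex.norm_natCast, pow_succ' _ 2, mul_assoc]
  refine mul_le_mul_of_nonneg_left ?_ (Nat.cast_nonneg _)
  simpa using norm_trace_mul_le (A := Matrix.of _) hα hβ

theorem termPairing_conjTranspose_onM (a : MatFamily G K) (ξ η : Dual G K) (i j : Fin η.rep.d) :
    termPairing a (fun x => (η.rep.onM x)ᴴ i j) ξ = ξ.rep.d * (η.rep.proj i i *
      ∫ x, star (η.rep.mat x j i) * (ξ.rep.mat x * (ξ.rep.proj * a ξ)).trace ∂(haarG G)) := by
  simp only [termPairing, TypeOneRep.conjTranspose_onM_apply, TypeOneRep.onM_mul, mul_assoc,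
    mul_left_comm _ (ξ.rep.d : ℂ), integral_const_mul]

theorem termPairing_conjTranspose_onM_self (a : MatFamily G K) (η : Dual G K)
    (i j : Fin η.rep.d) :
    termPairing a (fun x => (η.rep.onM x)ᴴ i j) η = (η.rep.proj * a η) i j := by
  have hd : (η.rep.d : ℂ) ≠ 0 := Nat.cast_ne_zero.2 η.rep.d_pos.ne'
  rw [termPairing_conjTranspose_onM, η.rep.integral_star_mat_mul_trace, mul_left_comm,
    mul_inv_cancel_left₀ hd, ← TypeOneRep.proj_mul_apply, ← Matrix.mul_assoc,
    TypeOneRep.proj_mul_proj]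

theorem termPairing_conjTranspose_onM_of_ne (a : MatFamily G K) {ξ η : Dual G K} (hne : ξ ≠ η)
    (i j : Fin η.rep.d) : termPairing a (fun x => (η.rep.onM x)ᴴ i j) ξ = 0 := by
  rw [termPairing_conjTranspose_onM, integral_star_mat_mul_trace_of_ne hne, mul_zero, mul_zero]

end Pairing

section DistributionCoefficients

variable {E : Type*} [NormedAddCommGroup E] [NormedSpace ℝ E] [FiniteDimensional ℝ E]
  {G : Type*} [Group G] [TopologicalSpace G] [IsTopologicalGroup G] [CompactSpace G] [T2Space G]
  [ChartedSpace E G] [LieGroup 𝓘(ℝ, E) ∞ G] {n : ℕ}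
  {Y : Module.Basis (Fin n) ℝ (GroupLieAlgebra 𝓘(ℝ, E) G)} {K : Subgroup G}

theorem distFourier_apply (u : Distribution Y K) (ξ : Dual G K) (i j : Fin ξ.rep.d) :
    distFourier u ξ i j =
      u.1 ⟨fun x => (ξ.rep.onM x)ᴴ i j, conjTranspose_onM_mem_smoothFun ξ.rep i j⟩ := by
  rw [distFourier, Matrix.of_apply, distPair, dif_pos]

theorem distFourier_add (u v : Distribution Y K) :
    distFourier (u + v) = distFourier u + distFourier v := by
  ext ξ i j
  simp only [Pi.add_apply, Matrix.add_apply, distFourier_apply]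
  rfl

theorem distFourier_smul (c : ℂ) (u : Distribution Y K) :
    distFourier (c • u) = c • distFourier u := by
  ext ξ i j
  simp only [Pi.smul_apply, Matrix.smul_apply, distFourier_apply]
  rfl

variable [MeasurableSpace G] [BorelSpace G]

theorem distFourier_distOfSmooth (f : smoothFun E K) (ξ : Dual G K) :
    distFourier (distOfSmooth Y f) ξ = ξ.rep.proj * fourier f.1 ξ := by
  have hf : Continuous fun x : G => f.1 x := ContMDiff.continuous f.2
  ext i j
  have hcoeff : Continuous fun x : G => (ξ.rep.onM (x : G ⧸ K))ᴴ i j :=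
    (ξ.rep.continuous_onM.matrix_elem j i).star
  rw [distFourier_apply, TypeOneRep.proj_mul_apply, fourier, Matrix.of_apply,
    ← integral_const_mul]
  refine (integral_haarM (measurable_of_continuous_lift (hf.mul hcoeff))).trans ?_
  simp_rw [TypeOneRep.conjTranspose_onM_apply, mul_left_comm, Matrix.conjTranspose_apply]

theorem distFourier_eq_of_hasSum {v : Distribution Y K} {a : MatFamily G K}
    (hv : ∀ φ : smoothFun E K, HasSum (termPairing a φ.1) (v.1 φ)) (η : Dual G K) :
    distFourier v η = η.rep.proj * a η := by
  ext i j
  rw [distFourier_apply, ← termPairing_conjTranspose_onM_self]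
  exact (hv _).unique (hasSum_single η fun ξ hξ => termPairing_conjTranspose_onM_of_ne a hξ i j)

end DistributionCoefficients

section Multiplier

variable {E : Type*} [NormedAddCommGroup E] [NormedSpace ℝ E] [FiniteDimensional ℝ E]
  {G : Type*} [Group G] [TopologicalSpace G] [IsTopologicalGroup G] [CompactSpace G] [T2Space G]
  [ChartedSpace E G] [LieGroup 𝓘(ℝ, E) ∞ G] [MeasurableSpace G] [BorelSpace G] {n : ℕ}
  {Y : Module.Basis (Fin n) ℝ (GroupLieAlgebra 𝓘(ℝ, E) G)} (hY : IsAdOrthonormal Y)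
  {K : Subgroup G} {a : MatFamily G K}

include hY

theorem HasPolynomialGrowth.exists_summable_norm_termPairing_le (ha : HasPolynomialGrowth Y a) :
    ∃ (N : ℕ) (g : Dual G K → ℝ), Summable g ∧ ∀ φ ∈ smoothFun E K, ∀ A : ℝ,
      (∀ w : List (Fin n), w.length ≤ N →
        ∀ x : G, ‖iterLieDeriv Y w (fun y : G => φ (y : G ⧸ K)) x‖ ≤ A) →
      ∀ ξ, ‖termPairing a φ ξ‖ ≤ g ξ * A := by
  obtain ⟨N, C, -, ha⟩ := ha
  obtain ⟨M, hM⟩ := exists_summable_dim_pow_mul_div K hY 3 N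
  refine ⟨2 * M, _, hM.mul_left (C * (1 + n) ^ M), fun φ hφ A hA ξ => ?_⟩
  have hnonneg := ξ.rep.eigenvalue_nonneg hY
  have hcoeff : ∀ i j, ‖∫ x : G, φ x * ξ.rep.onM (x : G ⧸ K) i j ∂(haarG G)‖ ≤
      (1 + n) ^ M * A / (1 + eigenvalue Y ξ.rep) ^ M := fun i j => by
    rw [le_div_iff₀' (by positivity)]
    exact ξ.rep.pow_mul_norm_integral_mul_mat_mul_le hY ξ.rep.l2_opNorm_proj_le M hφ hA i j
  calc ‖termPairing a φ ξ‖
      ≤ ξ.rep.d ^ 3 * ((1 + n) ^ M * A / (1 + eigenvalue Y ξ.rep) ^ M *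
        (C * (1 + eigenvalue Y ξ.rep) ^ N)) :=
        norm_termPairing_le a (ContMDiff.continuous hφ) ξ hcoeff (ha ξ)
    _ = _ := by ring

theorem HasPolynomialGrowth.exists_distribution_hasSum (ha : HasPolynomialGrowth Y a) :
    ∃ v : Distribution Y K, ∀ φ : smoothFun E K, HasSum (termPairing a φ.1) (v.1 φ) := by
  obtain ⟨N, g, hg, hbound⟩ := ha.exists_summable_norm_termPairing_le hY
  have hcont : ∀ φ : smoothFun E K, Continuous fun x : G => φ.1 (x : G ⧸ K) :=
    fun φ => ContMDiff.continuous φ.2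
  have hsum : ∀ φ : smoothFun E K, Summable (termPairing a φ.1) := fun φ => by
    obtain ⟨A, hA⟩ := exists_norm_iterLieDeriv_le (Y := Y) φ.2 N
    exact Summable.of_norm_bounded (hg.mul_right A) (hbound φ.1 φ.2 A hA)
  refine ⟨⟨{ toFun := fun φ => ∑' ξ, termPairing a φ.1 ξ
             map_add' := fun φ ψ => ?_
             map_smul' := fun c φ => ?_ }, N, ∑' ξ, g ξ, fun φ A hA => ?_⟩,
    fun φ => (hsum φ).hasSum⟩
  · rw [← (hsum φ).tsum_add (hsum ψ)]
    exact tsum_congr fun ξ => termPairing_add_right a (hcont φ) (hcont ψ) ξ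
  · rw [RingHom.id_apply, smul_eq_mul, ← tsum_mul_left]
    exact tsum_congr fun ξ => termPairing_smul_right a c φ.1 ξ
  · exact tsum_of_norm_bounded (hg.hasSum.mul_right A) (hbound φ.1 φ.2 A hA)

theorem HasPolynomialGrowth.exists_multiplier {σ : MatFamily G K} (hσ : HasPolynomialGrowth Y σ) :
    ∃ T : Distribution Y K →ₗ[ℂ] Distribution Y K, ∀ (u : Distribution Y K) (φ : smoothFun E K),
      HasSum (termPairing (fun ξ => σ ξ * distFourier u ξ) φ.1) ((T u).1 φ) := by
  choose T hT using fun u : Distribution Y K =>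
    (hσ.mul hY (hasPolynomialGrowth_distFourier hY u)).exists_distribution_hasSum hY
  refine ⟨{ toFun := T, map_add' := fun u v => ?_, map_smul' := fun c u => ?_ }, hT⟩
  · refine Subtype.ext (LinearMap.ext fun φ => (hT (u + v) φ).unique ?_)
    have hadd := (hT u φ).add (hT v φ)
    simp_rw [← termPairing_add_left _ _ (ContMDiff.continuous φ.2)] at hadd
    rw [distFourier_add]
    simp only [Pi.add_apply, Matrix.mul_add]
    exact hadd
  · refine Subtype.ext (LinearMap.ext fun φ => (hT (c • u) φ).unique ?_)
    have hsmul := (hT u φ).mul_left c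
    simp_rw [← termPairing_smul_left] at hsmul
    rw [distFourier_smul]
    simp only [Pi.smul_apply, Matrix.mul_smul]
    exact hsmul

theorem IsRapidlyDecreasing.exists_summable_norm_term_le (ha : IsRapidlyDecreasing Y a) :
    ∃ g : Dual G K → ℝ, Summable g ∧ ∀ (ξ : Dual G K) (x : G),
      ‖(ξ.rep.d : ℂ) * (ξ.rep.onM (x : G ⧸ K) * a ξ).trace‖ ≤ g ξ := by
  obtain ⟨M, hM⟩ := exists_summable_dim_pow_mul_div K hY 3 0
  obtain ⟨C, -, ha⟩ := ha M
  refine ⟨_, hM.mul_left C, fun ξ x => ?_⟩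
  have hcoeff : ∀ i j, ‖ξ.rep.onM (x : G ⧸ K) i j‖ ≤ 1 := fun i j =>
    ξ.rep.norm_mat_mul_apply_le ξ.rep.l2_opNorm_proj_le i j x
  rw [norm_mul, Complex.norm_natCast]
  calc ξ.rep.d * ‖(ξ.rep.onM (x : G ⧸ K) * a ξ).trace‖
      ≤ ξ.rep.d * (ξ.rep.d ^ 2 * (1 * (C / (1 + eigenvalue Y ξ.rep) ^ M))) :=
        mul_le_mul_of_nonneg_left (by simpa using norm_trace_mul_le hcoeff (ha ξ))
          (Nat.cast_nonneg _)
    _ = _ := by ring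

theorem IsRapidlyDecreasing.continuous_fourierSeries (ha : IsRapidlyDecreasing Y a) :
    Continuous fun x : G => fourierSeries a (x : G ⧸ K) := by
  obtain ⟨g, hg, hbound⟩ := ha.exists_summable_norm_term_le hY
  exact continuous_tsum (continuous_fourierSeries_term a) hg hbound

theorem IsRapidlyDecreasing.integrable_fourierSeries_mul (ha : IsRapidlyDecreasing Y a)
    {φ : G ⧸ K → ℂ} (hφ : Continuous fun x : G => φ x) :
    Integrable (fun x => fourierSeries a x * φ x) (haarM G K) := by
  have hcont := (ha.continuous_fourierSeries hY).mul hφ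
  exact (integrable_map_measure (measurable_of_continuous_lift hcont).aestronglyMeasurable
    QuotientGroup.measurable_coe.aemeasurable).2 (integrable_of_continuous hcont)

theorem IsRapidlyDecreasing.hasSum_termPairing (ha : IsRapidlyDecreasing Y a)
    {φ : G ⧸ K → ℂ} (hφ : Continuous fun x : G => φ x) :
    HasSum (termPairing a φ) (∫ x, fourierSeries a x * φ x ∂(haarM G K)) := by
  have : Countable (Dual G K) := countable_dual K hY
  obtain ⟨g, hg, hbound⟩ := ha.exists_summable_norm_term_le hY
  obtain ⟨D, hD⟩ := isCompact_univ.exists_bound_of_continuousOn hφ.continuousOn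
  have hterm : ∀ (ξ : Dual G K) (x : G),
      ‖φ x * ((ξ.rep.d : ℂ) * (ξ.rep.onM (x : G ⧸ K) * a ξ).trace)‖ ≤ D * g ξ := fun ξ x => by
    rw [norm_mul]
    exact mul_le_mul (hD x (Set.mem_univ x)) (hbound ξ x) (norm_nonneg _)
      ((norm_nonneg _).trans (hD x (Set.mem_univ x)))
  have hsum := hasSum_integral_of_summable_integral_norm (μ := haarG G)
    (integrable_mul_fourierSeries_term hφ a)
    (Summable.of_norm_bounded (hg.mul_left D) fun ξ => by
      simpa using norm_integral_le_of_norm_le_const (μ := haarG G)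
        (Filter.Eventually.of_forall fun x => (norm_norm _).trans_le (hterm ξ x)))
  rw [integral_haarM (measurable_of_continuous_lift ((ha.continuous_fourierSeries hY).mul hφ))]
  have hfactor : ∀ x : G, fourierSeries a (x : G ⧸ K) * φ x =
      ∑' ξ : Dual G K, φ x * ((ξ.rep.d : ℂ) * (ξ.rep.onM (x : G ⧸ K) * a ξ).trace) := fun x => by
    rw [tsum_mul_left, mul_comm]
    rfl
  simp_rw [hfactor]
  exact hsum

end Multiplier

/-! ### Besov norms -/

section Besov

variable {E : Type*} [NormedAddCommGroup E] [NormedSpace ℝ E]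
  {G : Type*} [Group G] [TopologicalSpace G] [IsTopologicalGroup G] [CompactSpace G]
  [ChartedSpace E G] [MeasurableSpace G] [BorelSpace G] {n : ℕ}
  {Y : Module.Basis (Fin n) ℝ (GroupLieAlgebra 𝓘(ℝ, E) G)} {K : Subgroup G}

theorem besovNorm_le_of_eLpNorm_le {p₁ p₂ : ℝ≥0∞} {C : ℝ≥0} {u v : Distribution Y K}
    (h : ∀ m, eLpNorm (distBlock v m) p₂ (haarM G K) ≤
      C * eLpNorm (distBlock u m) p₁ (haarM G K)) (r : ℝ) {q : ℝ≥0∞} (hq : 0 < q) :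
    besovNorm r p₂ q v ≤ C * besovNorm r p₁ q u := by
  have hblock : ∀ m : ℕ, (2 : ℝ≥0∞) ^ ((m : ℝ) * r) * eLpNorm (distBlock v m) p₂ (haarM G K) ≤
      C * ((2 : ℝ≥0∞) ^ ((m : ℝ) * r) * eLpNorm (distBlock u m) p₁ (haarM G K)) := fun m => by
    rw [mul_left_comm]
    gcongr
    exact h m
  unfold besovNorm
  split_ifs with hq_top
  · rw [ENNReal.mul_iSup]
    exact iSup_mono hblock
  · have hq_pos : 0 < q.toReal := ENNReal.toReal_pos hq.ne' hq_top
    calc (∑' m : ℕ, ((2 : ℝ≥0∞) ^ ((m : ℝ) * r) *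
          eLpNorm (distBlock v m) p₂ (haarM G K)) ^ q.toReal) ^ (1 / q.toReal)
        ≤ (∑' m : ℕ, (C * ((2 : ℝ≥0∞) ^ ((m : ℝ) * r) *
          eLpNorm (distBlock u m) p₁ (haarM G K))) ^ q.toReal) ^ (1 / q.toReal) := by
          gcongr ?_ ^ _
          exact ENNReal.tsum_le_tsum fun m => ENNReal.rpow_le_rpow (hblock m) hq_pos.le
      _ = C * (∑' m : ℕ, ((2 : ℝ≥0∞) ^ ((m : ℝ) * r) *
          eLpNorm (distBlock u m) p₁ (haarM G K)) ^ q.toReal) ^ (1 / q.toReal) := by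
          simp_rw [ENNReal.mul_rpow_of_nonneg (C : ℝ≥0∞) (_ * _) hq_pos.le]
          rw [ENNReal.tsum_mul_left, ENNReal.mul_rpow_of_nonneg _ _ (by positivity),
            ← ENNReal.rpow_mul, mul_one_div_cancel hq_pos.ne', ENNReal.rpow_one]

variable [FiniteDimensional ℝ E] [T2Space G] [LieGroup 𝓘(ℝ, E) ∞ G] (hY : IsAdOrthonormal Y)

open Classical in
include hY in
theorem exists_finset_dyadic_eq_zero (a : MatFamily G K) (m : ℕ) :
    ∃ F : Finset (Dual G K), ∀ ξ ∉ F, (if (2 : ℝ) ^ m ≤ weight Y ξ ∧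
      weight Y ξ < (2 : ℝ) ^ (m + 1) then a ξ else 0) = 0 :=
  ⟨(finite_weight_lt K hY (2 ^ (m + 1))).toFinset, fun _ hξ =>
    if_neg fun hdyadic => hξ ((Set.Finite.mem_toFinset _).2 hdyadic.2)⟩

include hY in
theorem distBlock_mem_smoothFun (u : Distribution Y K) (m : ℕ) : distBlock u m ∈ smoothFun E K :=
  fourierSeries_mem_smoothFun (exists_finset_dyadic_eq_zero hY (distFourier u) m).choose_spec

include hY in
theorem IsMultiplierSymbol.Op_distBlock {σ : MatFamily G K} (hσ : IsMultiplierSymbol σ)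
    {u v : Distribution Y K} (huv : ∀ ξ, distFourier v ξ = σ ξ * distFourier u ξ) (m : ℕ) :
    Op σ (distBlock u m) = distBlock v m := by
  obtain ⟨F, hF⟩ := exists_finset_dyadic_eq_zero hY (distFourier u) m
  unfold distBlock
  simp_rw [hσ.Op_fourierSeries hF, huv, mul_ite, mul_zero]

end Besov

end HomBesov

end

open HomBesov in
theorem theorem2p1_general
    {E : Type*} [NormedAddCommGroup E] [NormedSpace ℝ E] [FiniteDimensional ℝ E]
    {G : Type*} [Group G] [TopologicalSpace G] [IsTopologicalGroup G] [T2Space G] [CompactSpace G]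
    [ChartedSpace E G] [LieGroup 𝓘(ℝ, E) ∞ G] [MeasurableSpace G] [BorelSpace G]
    (B : LinearMap.BilinForm ℝ (GroupLieAlgebra 𝓘(ℝ, E) G))
    (hB : ∀ (g : G) (X Z : GroupLieAlgebra 𝓘(ℝ, E) G), B (Ad g X) (Ad g Z) = B X Z)
    {n : ℕ} (Y : Module.Basis (Fin n) ℝ (GroupLieAlgebra 𝓘(ℝ, E) G))
    (hY : ∀ i j, B (Y i) (Y j) = if i = j then 1 else 0)
    (K : Subgroup G) (σ : MatFamily G K) (hσ : IsMultiplierSymbol σ)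
    (p₁ p₂ : ℝ≥0∞) (hp₂ : 1 ≤ p₂) (hA : IsLpBounded E p₁ p₂ σ) :
    ∃ T : Distribution Y K →ₗ[ℂ] Distribution Y K,
      (∀ f φ : smoothFun E K,
        Integrable (fun x => Op σ f.1 x * φ.1 x) (haarM G K) ∧
        (T (distOfSmooth Y f)).1 φ = ∫ x, Op σ f.1 x * φ.1 x ∂(haarM G K)) ∧
      (∀ (u : Distribution Y K) (ξ : Dual G K), distFourier (T u) ξ = σ ξ * distFourier u ξ) ∧
      ∀ (r : ℝ) (q : ℝ≥0∞), 0 < q → ∃ C : ℝ≥0, ∀ u ∈ besovSpace Y K r p₁ q,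
        T u ∈ besovSpace Y K r p₂ q ∧
        besovNorm r p₂ q (T u) ≤ C * besovNorm r p₁ q u := by
  have hY' : IsAdOrthonormal Y := ⟨B, hB, hY⟩
  have hgrowth : HasPolynomialGrowth Y σ := hA.hasPolynomialGrowth hσ hp₂ hY'
  obtain ⟨T, hT⟩ := hgrowth.exists_multiplier hY'
  have hcoeff : ∀ (u : Distribution Y K) (ξ : Dual G K),
      distFourier (T u) ξ = σ ξ * distFourier u ξ := fun u ξ => by
    rw [distFourier_eq_of_hasSum (hT u), ← Matrix.mul_assoc, hσ.proj_mul]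
  refine ⟨T, fun f φ => ?_, hcoeff, fun r q hq => ?_⟩
  · have hφ : Continuous fun x : G => φ.1 x := ContMDiff.continuous φ.2
    have hdecay : IsRapidlyDecreasing Y fun ξ => σ ξ * fourier f.1 ξ :=
      hgrowth.mul_isRapidlyDecreasing hY' (isRapidlyDecreasing_fourier hY' f.2)
    refine ⟨hdecay.integrable_fourierSeries_mul hY' hφ, (hT _ φ).unique ?_⟩
    simp_rw [distFourier_distOfSmooth, ← Matrix.mul_assoc, hσ.mul_proj]
    exact hdecay.hasSum_termPairing hY' hφ
  · obtain ⟨C, hC⟩ := hA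
    have hbesov : ∀ u, besovNorm r p₂ q (T u) ≤ C * besovNorm r p₁ q u := fun u =>
      besovNorm_le_of_eLpNorm_le (fun m => by
        rw [← hσ.Op_distBlock hY' (hcoeff u) m]
        exact hC _ (distBlock_mem_smoothFun hY' u m)) r hq
    exact ⟨C, fun u hu =>
      ⟨(hbesov u).trans_lt (ENNReal.mul_lt_top ENNReal.coe_lt_top hu), hbesov u⟩⟩

theorem theorem2p1
    {E : Type*} [NormedAddCommGroup E] [NormedSpace ℝ E] [FiniteDimensional ℝ E]
    {G : Type*} [Group G] [TopologicalSpace G] [IsTopologicalGroup G] [T2Space G] [CompactSpace G]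
    [ChartedSpace E G] [LieGroup 𝓘(ℝ, E) ∞ G] [MeasurableSpace G] [BorelSpace G]
    -- an `Ad`-invariant inner product on the Lie algebra and an orthonormal basis of it
    (B : LinearMap.BilinForm ℝ (GroupLieAlgebra 𝓘(ℝ, E) G))
    (hB : ∀ (g : G) (X Z : GroupLieAlgebra 𝓘(ℝ, E) G),
      B (HomBesov.Ad g X) (HomBesov.Ad g Z) = B X Z)
    {n : ℕ} (Y : Module.Basis (Fin n) ℝ (GroupLieAlgebra 𝓘(ℝ, E) G))
    (hY : ∀ i j, B (Y i) (Y j) = if i = j then 1 else 0)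
    (K : Subgroup G) (hK : IsClosed (K : Set G))
    (σ : HomBesov.MatFamily G K) (hσ : HomBesov.IsMultiplierSymbol σ)
    (p₁ p₂ : ℝ≥0∞) (hp₁ : 1 ≤ p₁) (hp₂ : 1 ≤ p₂)
    (hA : HomBesov.IsLpBounded E p₁ p₂ σ) :
    ∃ T : HomBesov.Distribution Y K →ₗ[ℂ] HomBesov.Distribution Y K,
      -- `T` extends `A = Op(σ)` from smooth functions to distributions ...
      (∀ f φ : HomBesov.smoothFun E K,
        MeasureTheory.Integrable (fun x => HomBesov.Op σ f.1 x * φ.1 x) (HomBesov.haarM G K) ∧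
        (T (HomBesov.distOfSmooth Y f)).1 φ =
          ∫ x, HomBesov.Op σ f.1 x * φ.1 x ∂(HomBesov.haarM G K)) ∧
      -- ... as the Fourier multiplier with symbol `σ` ...
      (∀ (u : HomBesov.Distribution Y K) (ξ : HomBesov.Dual G K),
        HomBesov.distFourier (T u) ξ = σ ξ * HomBesov.distFourier u ξ) ∧
      -- ... and is bounded between the Besov spaces
      ∀ (r : ℝ) (q : ℝ≥0∞), 0 < q → ∃ C : ℝ≥0, ∀ u ∈ HomBesov.besovSpace Y K r p₁ q,
        T u ∈ HomBesov.besovSpace Y K r p₂ q ∧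
        HomBesov.besovNorm r p₂ q (T u) ≤ C * HomBesov.besovNorm r p₁ q u :=
  theorem2p1_general B hB Y hY K σ hσ p₁ p₂ hp₂ hA
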